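/- **Problem.** Let $\mathcal X,\mathcal Y$ be finite dimensional real inner product spaces, $X\subseteq\mathcal X$ and $Y\subseteq\mathcal Y$ nonempty convex sets, $Y$ compact with diameter $D_y=\sup_{y,y'\in Y}\|y-y'\|$, and $\Omega\supseteq X$ open. For a set $Z$ let $\overline{\mathrm{Conv}}(Z)$ be the set of proper lower semicontinuous convex functions with values in $(-\infty,\infty]$ and effective domain $Z$. Assume: $\Phi$ is finite and continuous on $\Omega\times Y$, and $\nabla_x\Phi$ exists and is continuous there; $h\in\overline{\mathrm{Conv}}(X)$, and $-\Phi(x,\cdot)\in\overline{\mathrm{Conv}}(Y)$ for every $x\in\Omega$; there are $L_x,L_y>0$ and $m\in(0,L_x]$ with $$\Phi(x,y)-\Phi(x',y)-\langle\nabla_x\Phi(x',y),x-x'\rangle\ge-\tfrac m2\|x-x'\|^2,\qquad \|\nabla_x\Phi(x,y)-\nabla_x\Phi(x',y')\|\le L_x\|x-x'\|+L_y\|y-y'\|$$ for all $x,x'\in X$, $y,y'\in Y$; and $\inf_X\hat p$ is finite, where $p(x)=\max_{y\in Y}\Phi(x,y)$ and $\hat p=p+h$. Let $x_0\in X$, $y_0\in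 Y$ and, for $\xi>0$, $$p_\xi(x)=\max_{y\in Y}\{\Phi(x,y)-\tfrac1{2\xi}\|y-y_0\|^2\},\qquad L_\xi=L_y\big(\xi L_y+\sqrt{\xi(L_x+m)}\big)+L_x,\qquad \Omega_\xi=1+\frac{\sqrt\xi L_y+\sqrt{L_x}}{\sqrt m}.$$ **ACG method** with inputs $\mu,L,\psi_s,\psi_n,z_0$, where $\psi=\psi_s+\psi_n$. Put $w_0=z_0$, $A_0=0$, $\Gamma_0\equiv0$, and for $j\ge0$ $$A_{j+1}=A_j+\tfrac{1}{2L}\Big(\mu A_j+1+\sqrt{(\mu A_j+1)^2+4L(\mu A_j+1)A_j}\Big),\qquad \theta_j=\tfrac{A_j}{A_{j+1}},\qquad \tilde z_j=\theta_jz_j+(1-\theta_j)w_j,$$ $$\Gamma_{j+1}=\theta_j\Gamma_j+(1-\theta_j)\big[\psi_s(\tilde z_j)+\langle\nabla\psi_s(\tilde z_j),\cdot-\tilde z_j\rangle\big],\qquad w_{j+1}=\operatorname{argmin}\Big\{\Gamma_{j+1}+\psi_n+\tfrac1{2A_{j+1}}\|\cdot-w_0\|^2\Big\},$$ $$z_{j+1}=\theta_jz_j+(1-\theta_j)w_{j+1},\quad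 u_{j+1}=\tfrac{w_0-w_{j+1}}{A_{j+1}},\quad \varepsilon_{j+1}=\psi(z_{j+1})-\Gamma_{j+1}(w_{j+1})-\psi_n(w_{j+1})-\langle u_{j+1},z_{j+1}-w_{j+1}\rangle.$$ **AIPP-S scheme** with smoothing constant $\xi>0$ and tolerance $\rho>0$. Put $f=p_\xi$, $M=L_\xi$, $\lambda=\frac1{4m}$, $\sigma=\frac12$, $\phi=f+h$, $M_\lambda=M+\lambda^{-1}$. Starting from $k=1$ and $x_0$, run ACG with $z_0=x_{k-1}$, $\mu=\frac12$, $L=\lambda M+\frac12$, $\psi_s=\lambda f+\frac14\|\cdot-x_{k-1}\|^2$, $\psi_n=\lambda h+\frac14\|\cdot-x_{k-1}\|^2$ up to the first iteration $j\ge\lceil6\sqrt{2\lambda M+1}\,\rceil$ whose triple $(x,u,\varepsilon)=(z_j,u_j,\varepsilon_j)$ satisfies $$\varepsilon\ge0,\qquad u\in\partial_\varepsilon\big(\lambda\phi+\tfrac12\|\cdot-x_{k-1}\|^2\big)(x),\qquad \|u\|^2+2\varepsilon\le\sigma\|x_{k-1}-x+u\|^2.\tag{$*$}$$ If $\|x_{k-1}-x+u\|>\frac{\lambda\rho}{20}$,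 set $x_k=x$ and repeat with $k+1$ in place of $k$. Otherwise resume this ACG call up to the first iteration, from the present one on, whose triple satisfies $(*)$ and $\varepsilon\le\frac{\lambda\rho^2}{32M_\lambda}$; with its $x$ compute $$\bar x=\operatorname{argmin}_{x'}\{\langle\nabla f(x),x'-x\rangle+h(x')+\tfrac{M_\lambda}2\|x'-x\|^2\},\qquad \bar u=M_\lambda(x-\bar x)+\nabla f(\bar x)-\nabla f(x)$$ and output $(\bar x,\bar u)$. **Oracles.** The scheme is implemented with access to $\Phi$ and $h$ only through oracles that return $\Phi(x,y)$, $\nabla_x\Phi(x,y)$, $h(x)$ and the exact solutions of $\min_{x\in X}\{\kappa h(x)+\frac12\|x-a\|^2\}$ and $\max_{y\in Y}\{\kappa\Phi(a,y)-\frac12\|y-b\|^2\}$ ($\kappa>0$). Here $p_\xi(x)$ is computed as $\Phi(x,y_\xi(x))-\frac1{2\xi}\|y_\xi(x)-y_0\|^2$ and $\nabla p_\xi(x)$ as $\nabla_x\Phi(x,y_\xi(x))$, where $y_\xi(x)$ is the maximizer in the definition of $p_\xi(x)$, and the two argmins above are computed by one solution of the first problem each. Each individual evaluation of one of the five oracles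 is counted. **Proposition.** Let $\delta>0$, $\tau>0$, $\xi>0$ satisfy $$\xi\ge\frac{D_y}{\tau},\qquad \tau\le\min\Big\{\frac{m\delta^2}{2D_y},\frac{\delta^2}{32mD_y}\Big\}$$ (no condition on $\tau$ if $D_y=0$), and run AIPP-S with $\xi$ and $\rho=\delta/2$. Then the scheme terminates, and: (a) its implementation outputs the same pair after at most $$C\,\Omega_\xi\left[\frac{R(\hat p;\lambda)}{\lambda^2\delta^2}+\frac{D_y^2}{\lambda\xi\delta^2}+\log_1^+(\Omega_\xi)\right]$$ oracle evaluations, where $C$ is an absolute constant, $\lambda=\frac1{4m}$, $R(\hat p;\lambda)=\inf_{x'}\{\frac12\|x_0-x'\|^2+\lambda[\hat p(x')-\inf\hat p]\}$ and $\log_1^+(t)=\max\{1,\log t\}$. If $D_y>0$ and both inequalities on $\xi$ and $\tau$ hold with equality, this bound is $O(\delta^{-3})$ as $\delta\downarrow0$ with the other data fixed; (b) the first component $x$ of the output lies in $X$, and there is $\hat x\in X$ with $\|\hat x-x\|\le\delta$ such that the directional derivative $\hat p'(\hat x;d)=\lim_{t\downarrow0}[\hat p(\hat x+td)-\hat p(\hat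 x)]/t\in[-\infty,\infty]$ exists for every $d$ and $\inf_{\|d\|\le1}\hat p'(\hat x;d)\ge-\delta$. -/

import Mathlib

universe u v w

noncomputable section

namespace AIPPS



/-! ### Convex-analytic notions -/

section General

variable {E : Type u} [NormedAddCommGroup E] [InnerProductSpace ℝ E]

/-- Proper lower semicontinuous convex functions `E → (-∞, ∞]` with effective domain equal to `Z`
(convexity is convexity of the epigraph). -/
def ConvBar (Z : Set E) : Set (E → EReal) :=
  {ψ | Z.Nonempty ∧ (∀ z, ψ z ≠ ⊥) ∧ {z | ψ z < ⊤} = Z ∧ LowerSemicontinuous ψ ∧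
    Convex ℝ {q : E × ℝ | ψ q.1 ≤ (q.2 : EReal)}}

/-- The `ε`-subdifferential of `ψ` at `z`. -/
def epsSubdiff (ε : ℝ) (ψ : E → EReal) (z : E) : Set E :=
  {g | ∀ z', ψ z + ((inner ℝ g (z' - z) - ε : ℝ) : EReal) ≤ ψ z'}

/-- `ℓ` is the (one-sided, extended-valued) directional derivative of `ψ` at `z` along `d`. -/
def HasDirDeriv (ψ : E → EReal) (z d : E) (ℓ : EReal) : Prop :=
  Filter.Tendsto (fun t : ℝ => (ψ (z + t • d) - ψ z) / ((t : ℝ) : EReal))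
    (nhdsWithin 0 (Set.Ioi 0)) (nhds ℓ)

/-- A minimizer of `f` over `S` (in all uses below it exists and is unique). -/
def argminOn {α : Type*} [Nonempty α] {β : Type*} [Preorder β] (S : Set α) (f : α → β) : α :=
  Classical.epsilon fun x => x ∈ S ∧ IsMinOn f S x

/-- A maximizer of `f` over `S` (in all uses below it exists and is unique). -/
def argmaxOn {α : Type*} [Nonempty α] {β : Type*} [Preorder β] (S : Set α) (f : α → β) : α :=
  Classical.epsilon fun x => x ∈ S ∧ IsMaxOn f S x

/-- `log₁⁺ t = max {1, log t}`. -/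
def logOnePlus (t : ℝ) : ℝ := max 1 (Real.log t)

/-- `R(φ; lam) = inf_{x'} { ‖x₀ - x'‖² / 2 + lam (φ x' - inf φ) }`. -/
def Rfun (φ : E → EReal) (x₀ : E) (lam : ℝ) : EReal :=
  ⨅ x' : E, ((‖x₀ - x'‖ ^ 2 / 2 : ℝ) : EReal) + (lam : EReal) * (φ x' - ⨅ x : E, φ x)

end General

/-! ### The accelerated composite gradient (ACG) method -/

section ACG

variable {E : Type u} [NormedAddCommGroup E] [InnerProductSpace ℝ E] [FiniteDimensional ℝ E]

/-- The quantities `(A_j, y_j, z_j, Γ_j, u_j, ε_j)` of the ACG method. -/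
structure ACGIterate (E : Type u) where
  A : ℝ
  y : E
  z : E
  Γ : E → ℝ
  u : E
  ε : ℝ

/-- The value of `A_{j+1}` in terms of `A_j`. -/
def acgA (μ L A : ℝ) : ℝ :=
  A + (μ * A + 1 + √((μ * A + 1) ^ 2 + 4 * L * (μ * A + 1) * A)) / (2 * L)

/-- One iteration of the ACG method with inputs `(μ, L)`, `(ψs, ψn)` and `z₀ = y₀`. -/
def acgNext (μ L : ℝ) (ψs : E → ℝ) (ψn : E → EReal) (z₀ : E) (s : ACGIterate E) :
    ACGIterate E :=
  let A' := acgA μ L s.A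
  let zt := (s.A / A') • s.z + ((A' - s.A) / A') • s.y
  let Γ' : E → ℝ := fun y => s.A / A' * s.Γ y +
    (A' - s.A) / A' * (ψs zt + inner ℝ (gradient ψs zt) (y - zt))
  let y' := argminOn Set.univ fun y : E =>
    (Γ' y : EReal) + ψn y + ((1 / (2 * A') * ‖y - z₀‖ ^ 2 : ℝ) : EReal)
  let z' := (s.A / A') • s.z + ((A' - s.A) / A') • y'
  let u' := (1 / A') • (z₀ - y')
  { A := A', y := y', z := z', Γ := Γ', u := u',
    ε := (ψs z' + (ψn z').toReal) - Γ' y' - (ψn y').toReal - inner ℝ u' (z' - y') }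

/-- The ACG sequence; the components `u`, `ε` of the iterate of index `0` are not used. -/
def acgSeq (μ L : ℝ) (ψs : E → ℝ) (ψn : E → EReal) (z₀ : E) : ℕ → ACGIterate E
  | 0 => { A := 0, y := z₀, z := z₀, Γ := fun _ => 0, u := 0, ε := 0 }
  | j + 1 => acgNext μ L ψs ψn z₀ (acgSeq μ L ψs ψn z₀ j)

end ACG

/-! ### The accelerated inexact proximal point (AIPP) method -/

section AIPP

variable {E : Type u} [NormedAddCommGroup E] [InnerProductSpace ℝ E] [FiniteDimensional ℝ E]

/-- The ACG sequence used in an outer iteration with prox-centre `xp = x_{k-1}`. -/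
def aippACG (f : E → ℝ) (h : E → EReal) (M lam : ℝ) (xp : E) : ℕ → ACGIterate E :=
  acgSeq (1 / 2) (lam * M + 1 / 2)
    (fun x => lam * f x + 1 / 4 * ‖x - xp‖ ^ 2)
    (fun x => (lam : EReal) * h x + ((1 / 4 * ‖x - xp‖ ^ 2 : ℝ) : EReal)) xp

/-- The minimal number of ACG iterations of an outer iteration. -/
def minIter (M lam : ℝ) : ℕ := ⌈6 * √(2 * lam * M + 1)⌉₊

/-- The inexact prox criterion on a triple `(x, u, ε)`, for the prox-centre `xp`. -/
def InexactProx (f : E → ℝ) (h : E → EReal) (lam σ : ℝ) (xp x u : E) (ε : ℝ) : Prop :=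
  0 ≤ ε ∧
  u ∈ epsSubdiff ε (fun x' => (lam : EReal) * ((f x' : EReal) + h x') +
    ((1 / 2 * ‖x' - xp‖ ^ 2 : ℝ) : EReal)) x ∧
  ‖u‖ ^ 2 + 2 * ε ≤ σ * ‖xp - x + u‖ ^ 2

/-- The final composite gradient step, from the point `x` to the output pair. -/
def aippOutput (f : E → ℝ) (h : E → EReal) (M lam : ℝ) (x : E) : E × E :=
  let Mlam := M + 1 / lam
  let xb := argminOn Set.univ fun x' : E =>
    ((inner ℝ (gradient f x) (x' - x) : ℝ) : EReal) + h x' +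
      ((Mlam / 2 * ‖x' - x‖ ^ 2 : ℝ) : EReal)
  (xb, Mlam • (x - xb) + gradient f xb - gradient f x)

/-- `AIPPRun f h M lam σ ρ xp out`: the AIPP method, started at step 1 of an outer iteration
with prox-centre `xp` and tolerance `ρ`, terminates with the pair `out`.
Step 1 stops the ACG method at the first iteration `j`, past the minimal number of iterations,
at which the inexact prox criterion holds.  If the residual test holds there, the
same ACG call is resumed until the first iteration `i ≥ j` whose triple satisfies the inexact prox
criterion with `ε_i ≤ εhat * lam`, where `εhat = ρ² / (32 (M + 1/lam))`; otherwise a new outer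
iteration starts at `x_k = z_j`. -/
inductive AIPPRun (f : E → ℝ) (h : E → EReal) (M lam σ ρ : ℝ) : E → E × E → Prop
  | finish (xp : E) (j i : ℕ)
      (hj : IsLeast {j : ℕ | minIter M lam ≤ j ∧
        InexactProx f h lam σ xp (aippACG f h M lam xp j).z (aippACG f h M lam xp j).u
          (aippACG f h M lam xp j).ε} j)
      (hres : ‖xp - (aippACG f h M lam xp j).z + (aippACG f h M lam xp j).u‖
        ≤ lam * (ρ / 4) / 5)
      (hi : IsLeast {i : ℕ | j ≤ i ∧
        InexactProx f h lam σ xp (aippACG f h M lam xp i).z (aippACG f h M lam xp i).u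
          (aippACG f h M lam xp i).ε ∧
        (aippACG f h M lam xp i).ε ≤ ρ ^ 2 / (32 * (M + 1 / lam)) * lam} i) :
      AIPPRun f h M lam σ ρ xp (aippOutput f h M lam (aippACG f h M lam xp i).z)
  | next (xp : E) (j : ℕ) (out : E × E)
      (hj : IsLeast {j : ℕ | minIter M lam ≤ j ∧
        InexactProx f h lam σ xp (aippACG f h M lam xp j).z (aippACG f h M lam xp j).u
          (aippACG f h M lam xp j).ε} j)
      (hres : ¬ ‖xp - (aippACG f h M lam xp j).z + (aippACG f h M lam xp j).u‖
        ≤ lam * (ρ / 4) / 5)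
      (hnext : AIPPRun f h M lam σ ρ (aippACG f h M lam xp j).z out) :
      AIPPRun f h M lam σ ρ xp out

end AIPP

/-! ### The min-max problem -/

/-- The data of the problem `min_{x ∈ X} max_{y ∈ Y} Φ(x, y) + h(x)`. -/
structure Problem (E : Type u) (F : Type v) where
  X : Set E
  Ω : Set E
  Y : Set F
  Φ : E → F → ℝ
  h : E → EReal
  m : ℝ
  Lx : ℝ
  Ly : ℝ

namespace Problem

variable {E : Type u} [NormedAddCommGroup E] [InnerProductSpace ℝ E] [FiniteDimensional ℝ E]
  {F : Type v} [NormedAddCommGroup F] [InnerProductSpace ℝ F]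

/-- `∇ₓΦ(x, y)`. -/
def gradX (P : Problem E F) (x : E) (y : F) : E := gradient (fun x' => P.Φ x' y) x

/-- `p(x) = max_{y ∈ Y} Φ(x, y)`. -/
def p (P : Problem E F) (x : E) : ℝ := sSup ((fun y => P.Φ x y) '' P.Y)

/-- `p̂ = p + h`. -/
def phat (P : Problem E F) (x : E) : EReal := (P.p x : EReal) + P.h x

open Classical in
/-- The standing assumptions. -/
structure Assumptions (P : Problem E F) : Prop where
  convex_X : Convex ℝ P.X
  nonempty_X : P.X.Nonempty
  convex_Y : Convex ℝ P.Y
  nonempty_Y : P.Y.Nonempty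
  compact_Y : IsCompact P.Y
  open_Ω : IsOpen P.Ω
  X_subset_Ω : P.X ⊆ P.Ω
  continuousOn_Φ : ContinuousOn (fun q : E × F => P.Φ q.1 q.2) (P.Ω ×ˢ P.Y)
  differentiable_Φ : ∀ x ∈ P.Ω, ∀ y ∈ P.Y, DifferentiableAt ℝ (fun x' => P.Φ x' y) x
  continuousOn_gradX : ContinuousOn (fun q : E × F => P.gradX q.1 q.2) (P.Ω ×ˢ P.Y)
  h_mem : P.h ∈ ConvBar P.X
  neg_Φ_mem : ∀ x ∈ P.Ω,
    (fun y => if y ∈ P.Y then ((-P.Φ x y : ℝ) : EReal) else ⊤) ∈ ConvBar P.Y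
  Lx_pos : 0 < P.Lx
  Ly_pos : 0 < P.Ly
  m_pos : 0 < P.m
  m_le_Lx : P.m ≤ P.Lx
  lower_curv : ∀ x ∈ P.X, ∀ x' ∈ P.X, ∀ y ∈ P.Y,
    -(P.m / 2) * ‖x - x'‖ ^ 2 ≤
      P.Φ x y - (P.Φ x' y + inner ℝ (P.gradX x' y) (x - x'))
  lipschitz : ∀ x ∈ P.X, ∀ x' ∈ P.X, ∀ y ∈ P.Y, ∀ y' ∈ P.Y,
    ‖P.gradX x y - P.gradX x' y'‖ ≤ P.Lx * ‖x - x'‖ + P.Ly * ‖y - y'‖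
  finite_inf : ∃ c : ℝ, (⨅ x ∈ P.X, P.phat x) = (c : EReal)

/-- The diameter `D_y` of `Y`. -/
def Dy (P : Problem E F) : ℝ := Metric.diam P.Y

/-- The smoothed function `p_ξ(x) = max_{y ∈ Y} { Φ(x, y) - ‖y - y₀‖² / (2 ξ) }`. -/
def pSmooth (P : Problem E F) (y₀ : F) (ξ : ℝ) (x : E) : ℝ :=
  sSup ((fun y => P.Φ x y - 1 / (2 * ξ) * ‖y - y₀‖ ^ 2) '' P.Y)

/-- `x` is within `δ` of a `δ`-directional stationary point. -/
def NearDirStationary (P : Problem E F) (δ : ℝ) (x : E) : Prop :=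
  ∃ xh ∈ P.X, ‖xh - x‖ ≤ δ ∧ ∃ D : E → EReal, (∀ d, HasDirDeriv P.phat xh d (D d)) ∧
    ((-δ : ℝ) : EReal) ≤ ⨅ d ∈ {d : E | ‖d‖ ≤ 1}, D d

end Problem

/-- `L_ξ = L_y Q_ξ + L_x`, where `Q_ξ = ξ L_y + √(ξ (L_x + m))`. -/
def Lxi (m Lx Ly ξ : ℝ) : ℝ := Ly * (ξ * Ly + √(ξ * (Lx + m))) + Lx

/-- `Ω_ξ = 1 + (√ξ L_y + √L_x) / √m`. -/
def Omegaxi (m Lx Ly ξ : ℝ) : ℝ := 1 + (√ξ * Ly + √Lx) / √m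

section Scheme

variable {E : Type u} [NormedAddCommGroup E] [InnerProductSpace ℝ E] [FiniteDimensional ℝ E]
  {F : Type v} [NormedAddCommGroup F] [InnerProductSpace ℝ F]

/-- The AIPP-S scheme with smoothing constant `ξ`, initial point `(x₀, y₀)` and tolerance `ρ`
terminates with the pair `out`: it is the AIPP method with `(p_ξ, h)`, `M = L_ξ`,
`lam = 1 / (4 m)` and `σ = 1 / 2`. -/
def AIPPSRun (P : Problem E F) (ξ : ℝ) (x₀ : E) (y₀ : F) (ρ : ℝ) (out : E × E) : Prop :=
  AIPPRun (P.pSmooth y₀ ξ) P.h (Lxi P.m P.Lx P.Ly ξ) (1 / (4 * P.m)) (1 / 2) ρ x₀ out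

/-- The bound on the number of oracle calls, up to an absolute constant; `lam = 1 / (4 m)`. -/
def Problem.oracleBound (P : Problem E F) (x₀ : E) (ξ δ : ℝ) : ℝ :=
  let lam := 1 / (4 * P.m)
  Omegaxi P.m P.Lx P.Ly ξ *
    ((Rfun P.phat x₀ lam).toReal / (lam ^ 2 * δ ^ 2) + P.Dy ^ 2 / (lam * ξ * δ ^ 2)
      + logOnePlus (Omegaxi P.m P.Lx P.Ly ξ))

end Scheme

/-! ### Oracle model

A program has access to `Φ` and `h` only through five oracles; real and vector arithmetic and
comparisons of reals are free.  Its cost is the total number of individual oracle evaluations.  -/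

/-- Programs with oracles for `Φ(x, y)`, `∇ₓΦ(x, y)`, `h(x)`, for the exact solution of
`min_{x ∈ X} { lam h(x) + ‖x - x₀‖² / 2 }` and of `max_{y ∈ Y} { lam Φ(x₀, y) - ‖y - y₀‖² / 2 }`. -/
inductive Prog (E : Type u) (F : Type v) (α : Type w) : Type (max u v w)
  | ret (a : α) : Prog E F α
  | evalPhi (x : E) (y : F) (k : ℝ → Prog E F α) : Prog E F α
  | evalGrad (x : E) (y : F) (k : E → Prog E F α) : Prog E F α
  | evalH (x : E) (k : ℝ → Prog E F α) : Prog E F α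
  | resH (lam : ℝ) (x₀ : E) (k : E → Prog E F α) : Prog E F α
  | resPhi (lam : ℝ) (x₀ : E) (y₀ : F) (k : F → Prog E F α) : Prog E F α

/-- Answers to the oracle questions. -/
structure Oracle (E : Type u) (F : Type v) where
  phi : E → F → ℝ
  grad : E → F → E
  hval : E → ℝ
  resH : ℝ → E → E
  resPhi : ℝ → E → F → F

/-- The result of a program. -/
def Prog.result {E : Type u} {F : Type v} {α : Type w} (O : Oracle E F) : Prog E F α → α
  | .ret a => a
  | .evalPhi x y k => (k (O.phi x y)).result O
  | .evalGrad x y k => (k (O.grad x y)).result O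
  | .evalH x k => (k (O.hval x)).result O
  | .resH lam x₀ k => (k (O.resH lam x₀)).result O
  | .resPhi lam x₀ y₀ k => (k (O.resPhi lam x₀ y₀)).result O

/-- The number of oracle evaluations made by a program. -/
def Prog.cost {E : Type u} {F : Type v} {α : Type w} (O : Oracle E F) : Prog E F α → ℕ
  | .ret _ => 0
  | .evalPhi x y k => (k (O.phi x y)).cost O + 1
  | .evalGrad x y k => (k (O.grad x y)).cost O + 1
  | .evalH x k => (k (O.hval x)).cost O + 1
  | .resH lam x₀ k => (k (O.resH lam x₀)).cost O + 1
  | .resPhi lam x₀ y₀ k => (k (O.resPhi lam x₀ y₀)).cost O + 1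

/-- Iterating a program `step` on states of type `S` until it returns an output:
`Halts O step s b T` says that from the state `s` the iteration ends with the output `b` after
exactly `T` oracle evaluations. -/
inductive Halts {E : Type u} {F : Type v} {S B : Type w} (O : Oracle E F)
    (step : S → Prog E F (S ⊕ B)) : S → B → ℕ → Prop
  | done (s : S) (b : B) (hs : (step s).result O = Sum.inr b) :
      Halts O step s b ((step s).cost O)
  | more (s s' : S) (b : B) (T : ℕ) (hs : (step s).result O = Sum.inl s')
      (hT : Halts O step s' b T) : Halts O step s b ((step s).cost O + T)

section Machine

variable {E : Type u} [NormedAddCommGroup E] [InnerProductSpace ℝ E] [FiniteDimensional ℝ E]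
  {F : Type v} [NormedAddCommGroup F] [InnerProductSpace ℝ F]

/-- The exact oracles of a problem. -/
def Problem.oracle (P : Problem E F) : Oracle E F where
  phi := P.Φ
  grad := P.gradX
  hval x := (P.h x).toReal
  resH lam x₀ := argminOn P.X fun x : E =>
    (lam : EReal) * P.h x + ((1 / 2 * ‖x - x₀‖ ^ 2 : ℝ) : EReal)
  resPhi lam x₀ y₀ := argmaxOn P.Y fun y : F => lam * P.Φ x₀ y - 1 / 2 * ‖y - y₀‖ ^ 2

/-- Memory of the implementation: whether step 3 has been entered, the prox-centre `xp = x_{k-1}`,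
the index `j` of the current ACG iterate, `A_j`, `y_j`, `z_j` and the affine function
`Γ_j = icpt + ⟨slope, ·⟩`. -/
structure Mem (E : Type u) where
  refining : Bool
  xp : E
  j : ℕ
  A : ℝ
  y : E
  z : E
  icpt : ℝ
  slope : E

/-- The memory at the start of an outer iteration with prox-centre `xp`. -/
def Mem.init (xp : E) : Mem E :=
  { refining := false, xp := xp, j := 0, A := 0, y := xp, z := xp, icpt := 0, slope := 0 }

/-- Computation of `∇p_ξ(x)` as `∇ₓΦ(x, y_ξ(x))`. -/
def gradProg {α : Type w} (ξ : ℝ) (y₀ : F) (x : E) (k : E → Prog E F α) : Prog E F α :=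
  .resPhi ξ x y₀ fun yx => .evalGrad x yx k

/-- Computation of `p_ξ(x)` as `Φ(x, y_ξ(x)) - ‖y_ξ(x) - y₀‖² / (2 ξ)`. -/
def valProg {α : Type w} (ξ : ℝ) (y₀ : F) (x : E) (k : ℝ → Prog E F α) : Prog E F α :=
  .resPhi ξ x y₀ fun yx => .evalPhi x yx fun v => k (v - 1 / (2 * ξ) * ‖yx - y₀‖ ^ 2)

/-- Step 4 of the AIPP method: one composite gradient step from `x`. -/
def outputProg (M lam ξ : ℝ) (y₀ : F) (x : E) : Prog E F (Mem E ⊕ E × E) :=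
  let Mlam := M + 1 / lam
  gradProg ξ y₀ x fun g =>
  .resH (1 / Mlam) (x - (1 / Mlam) • g) fun xb =>
  gradProg ξ y₀ xb fun gb =>
  .ret (Sum.inr (xb, Mlam • (x - xb) + gb - g))

open Classical in
/-- The implementation of the AIPP-S scheme with inputs `(m, Lx, Ly)`, `ξ`, `y₀`, `ρ`: each step
is one ACG iteration, followed by the tests of the AIPP method. -/
def aippsStep (m Lx Ly ξ : ℝ) (y₀ : F) (ρ : ℝ) (s : Mem E) : Prog E F (Mem E ⊕ E × E) :=
  let M := Lxi m Lx Ly ξ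
  let lam := 1 / (4 * m)
  let A' := acgA (1 / 2) (lam * M + 1 / 2) s.A
  let zt := (s.A / A') • s.z + ((A' - s.A) / A') • s.y
  valProg ξ y₀ zt fun v =>
  gradProg ξ y₀ zt fun g =>
  let G := lam • g + (1 / 2 : ℝ) • (zt - s.xp)
  let icpt' := s.A / A' * s.icpt +
    (A' - s.A) / A' * (lam * v + 1 / 4 * ‖zt - s.xp‖ ^ 2 - inner ℝ G zt)
  let slope' := (s.A / A') • s.slope + ((A' - s.A) / A') • G
  let c := 1 / 2 + 1 / A'
  .resH (lam / c) (s.xp - (1 / c) • slope') fun y' =>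
  let z' := (s.A / A') • s.z + ((A' - s.A) / A') • y'
  let u' := (1 / A') • (s.xp - y')
  valProg ξ y₀ z' fun v' =>
  .evalH z' fun hz =>
  .evalH y' fun hy =>
  let ε' := (lam * v' + 1 / 4 * ‖z' - s.xp‖ ^ 2) + (lam * hz + 1 / 4 * ‖z' - s.xp‖ ^ 2)
    - (icpt' + inner ℝ slope' y') - (lam * hy + 1 / 4 * ‖y' - s.xp‖ ^ 2)
    - inner ℝ u' (z' - y')
  let res := ‖s.xp - z' + u'‖
  let hpe : Prop := ‖u'‖ ^ 2 + 2 * ε' ≤ 1 / 2 * res ^ 2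
  let stepOneDone : Prop := s.refining = false ∧ minIter M lam ≤ s.j + 1 ∧ hpe
  let small : Prop := res ≤ lam * (ρ / 4) / 5
  let refining' : Bool := decide (s.refining = true ∨ (stepOneDone ∧ small))
  if refining' = true ∧ hpe ∧ ε' ≤ ρ ^ 2 / (32 * (M + 1 / lam)) * lam then
    outputProg M lam ξ y₀ z'
  else if stepOneDone ∧ ¬ small then
    .ret (Sum.inl (Mem.init z'))
  else
    .ret (Sum.inl { refining := refining', xp := s.xp, j := s.j + 1, A := A', y := y', z := z',
                    icpt := icpt', slope := slope' })

/-- The oracle implementation of the AIPP-S scheme, run with the oracles of `P`, outputs `out`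
after exactly `T` oracle evaluations. -/
def AIPPSOracleRun (P : Problem E F) (ξ : ℝ) (x₀ : E) (y₀ : F) (ρ : ℝ) (out : E × E)
    (T : ℕ) : Prop :=
  Halts P.oracle (aippsStep P.m P.Lx P.Ly ξ y₀ ρ) (Mem.init x₀) out T

end Machine

end AIPPS

end

/-! Smoothing. Subtracting the quadratic in `y` makes the inner maximizer `y_ξ(x)` unique, and the
maximum grows quadratically around it. Uniqueness and compactness give continuity of `y_ξ`, hence
Danskin's formula (`hasGradientAt_pSmooth`). Adding the growth inequalities at two maximizers gives
`y_ξ` the Lipschitz constant `ξ L_y + √(ξ (L_x + m))` (`ySmooth_lipschitz`), so `∇p_ξ` is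
`L_ξ`-Lipschitz, while the lower curvature `m` is inherited. With `λ = 1/(4m)` every proximal
subproblem is therefore strongly convex, and the ACG method applies to it.

Inner iterations. An estimate-sequence induction (`inv_next`) shows that the error of the `j`-th ACG
iterate is controlled by `1/A_j`, and `A_j` grows quadratically at first and geometrically
thereafter. At the prescribed minimal index `A_j ≥ 18`; then `u` and `ε` are small relative to the
step `z - x_{k-1}`, so the prox criterion holds automatically and the call stops exactly there
(`isLeast_minIter`). A further number of iterations of order `√(λM+1) log(λM+1)` brings `A_j` above
`λM + 1`, which is enough for the refined tolerance (`refineIter_mem`).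

Outer iterations. A residual above `λρ/20` forces `λ(p_ξ + h)` to drop by at least `(λρ)²/1600`
(`decrease`). After the first outer iteration the remaining gap is bounded by a multiple of `R(p̂;
λ)` plus the smoothing error (`exists_gap`), which bounds the number of outer iterations. Since
`√(2λM+1) ≤ Ω_ξ`, and since the machine performs one ACG iteration per step with at most 14 oracle
evaluations, the stated complexity follows.

Stationarity. The final composite gradient step yields `u ∈ ∇p_ξ(x) + ∂h(x)` with `‖u‖ ≤ ρ`
(`norm_output_le`). As `p_ξ` and `p` differ by at most `D_y²/(2ξ)`, the minimizer of `p̂ + m‖· - x‖²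
- ⟨u, ·⟩` lies close to `x`, and its optimality bounds the directional derivatives of `p̂` from
below (`nearDirStationary`). -/

set_option linter.unusedSectionVars false

noncomputable section

namespace AIPPS

open Filter Topology

/-! ### Closed convex functions: linear minorants, existence of minimizers, growth around a
minimizer. -/

section ConvexAnalysis

variable {E : Type u} [NormedAddCommGroup E] [InnerProductSpace ℝ E]

namespace ConvBar

variable {X : Set E} {h : E → EReal}

theorem eq_top (hh : h ∈ ConvBar X) {x : E} (hx : x ∉ X) : h x = ⊤ := by
  obtain ⟨-, -, hd, -, -⟩ := hh
  by_contra hne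
  exact hx (hd ▸ (lt_top_iff_ne_top.2 hne : x ∈ {z | h z < ⊤}))

theorem eq_coe (hh : h ∈ ConvBar X) {x : E} (hx : x ∈ X) : h x = ((h x).toReal : EReal) := by
  obtain ⟨-, hb, hd, -, -⟩ := hh
  have hlt : h x < ⊤ := by rw [← hd] at hx; exact hx
  exact (EReal.coe_toReal hlt.ne (hb x)).symm

theorem convexOn (hh : h ∈ ConvBar X) (hX : Convex ℝ X) :
    ConvexOn ℝ X fun x => (h x).toReal := by
  refine ⟨hX, fun x hx y hy a b ha hb hab => ?_⟩
  have hc := hh.2.2.2.2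
  have h1 : (x, (h x).toReal) ∈ {q : E × ℝ | h q.1 ≤ (q.2 : EReal)} := (eq_coe hh hx).le
  have h2 : (y, (h y).toReal) ∈ {q : E × ℝ | h q.1 ≤ (q.2 : EReal)} := (eq_coe hh hy).le
  have h3 := hc h1 h2 ha hb hab
  have h4 : h (a • x + b • y) ≤ ((a • (h x).toReal + b • (h y).toReal : ℝ) : EReal) := h3
  rw [eq_coe hh (hX hx hy ha hb hab)] at h4
  exact EReal.coe_le_coe_iff.1 h4

/-- A closed proper convex function on a finite dimensional space has at most linear decay. -/
theorem exists_linear_lower_bound [FiniteDimensional ℝ E] (hh : h ∈ ConvBar X)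
    (hX : Convex ℝ X) {x₀ : E} (hx₀ : x₀ ∈ X) :
    ∃ c : ℝ, 0 ≤ c ∧ ∀ x ∈ X, -c - c * ‖x - x₀‖ ≤ (h x).toReal := by
  have hlsc : LowerSemicontinuous h := hh.2.2.2.1
  have hne : (Metric.closedBall x₀ 1).Nonempty := ⟨x₀, by simp⟩
  -- The minimum over the compact unit ball is finite, being at most `h x₀`; it bounds `h` from
  -- below near `x₀`.
  obtain ⟨z, -, hz⟩ := (hlsc.lowerSemicontinuousOn _).exists_isMinOn hne
    (isCompact_closedBall x₀ 1)
  have hz0 := hh.2.1 z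
  set H : E → ℝ := fun x => (h x).toReal with hH
  obtain ⟨r, hr⟩ : ∃ r : ℝ, ∀ x ∈ X, ‖x - x₀‖ ≤ 1 → r ≤ H x := by
    have hzx : h z ≤ h x₀ := hz (by simp)
    have hzt : h z ≠ ⊤ := by
      rw [eq_coe hh hx₀] at hzx
      exact (lt_of_le_of_lt hzx (EReal.coe_lt_top _)).ne
    refine ⟨(h z).toReal, fun x hx hn => ?_⟩
    have : h z ≤ h x := hz (by simpa [dist_eq_norm] using hn)
    exact EReal.toReal_le_toReal this hz0 (by rw [eq_coe hh hx]; exact EReal.coe_ne_top _)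
  have hconv := convexOn hh hX
  refine ⟨|r| + |H x₀|, by positivity, fun x hx => ?_⟩
  have hr1 := neg_abs_le r
  have h01 := neg_abs_le (H x₀)
  have h02 := le_abs_self (H x₀)
  have hn0 := norm_nonneg (x - x₀)
  rcases le_or_gt ‖x - x₀‖ 1 with hn | hn
  · have := hr x hx hn
    show _ ≤ H x
    nlinarith [abs_nonneg r, abs_nonneg (H x₀)]
  · set s := ‖x - x₀‖ with hs
    have hs0 : 0 < s := by linarith
    -- A far point is pulled back along the segment to distance 1 from `x₀`; convexity turns the
    -- bound there into one linear in `s`.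
    have hmem : (1 - s⁻¹) • x₀ + s⁻¹ • x ∈ X :=
      hX hx₀ hx (by rw [sub_nonneg]; exact inv_le_one_of_one_le₀ hn.le) (by positivity) (by ring)
    have hle := hconv.2 hx₀ hx
      (show 0 ≤ 1 - s⁻¹ by rw [sub_nonneg]; exact inv_le_one_of_one_le₀ hn.le)
      (show 0 ≤ s⁻¹ by positivity) (by ring)
    have hnorm : ‖(1 - s⁻¹) • x₀ + s⁻¹ • x - x₀‖ ≤ 1 := by
      have : (1 - s⁻¹) • x₀ + s⁻¹ • x - x₀ = s⁻¹ • (x - x₀) := by module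
      rw [this, norm_smul, ← hs, norm_inv, Real.norm_of_nonneg hs0.le, inv_mul_cancel₀ hs0.ne']
    have h3 := (hr _ hmem hnorm).trans hle
    simp only [smul_eq_mul] at h3
    change r ≤ (1 - s⁻¹) * H x₀ + s⁻¹ * H x at h3
    show _ ≤ H x
    have h4 := mul_le_mul_of_nonneg_left h3 hs0.le
    have h5 : s * ((1 - s⁻¹) * H x₀ + s⁻¹ * H x) = (s - 1) * H x₀ + H x := by
      field_simp
    rw [h5] at h4
    nlinarith [abs_nonneg r, abs_nonneg (H x₀)]

/-- Existence of minimizers of `g + h` for `g` lower semicontinuous with quadratic growth. -/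
theorem exists_min [FiniteDimensional ℝ E] (hh : h ∈ ConvBar X)
    (hX : Convex ℝ X) {x₀ : E} (hx₀ : x₀ ∈ X) {g : E → ℝ} (hg : LowerSemicontinuousOn g X)
    {a b κ : ℝ} (hκ : 0 < κ)
    (hgb : ∀ x ∈ X, a - b * ‖x - x₀‖ + κ * ‖x - x₀‖ ^ 2 ≤ g x) :
    ∃ w ∈ X, ∀ x ∈ X, g w + (h w).toReal ≤ g x + (h x).toReal := by
  classical
  have hlsc : LowerSemicontinuous h := hh.2.2.2.1
  obtain ⟨c, hc0, hc⟩ := exists_linear_lower_bound hh hX hx₀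
  set H : E → ℝ := fun x => (h x).toReal with hH
  let F : E → EReal := fun x => if x ∈ X then ((g x + H x : ℝ) : EReal) else ⊤
  have hF : LowerSemicontinuous F := by
    intro x y hy
    obtain ⟨r, hyr, hrF⟩ := EReal.lt_iff_exists_real_btwn.1 hy
    by_cases hx : x ∈ X
    · simp only [F, if_pos hx] at hrF
      have hr : r < g x + H x := EReal.coe_lt_coe_iff.1 hrF
      have h1 : ∀ᶠ x' in 𝓝 x, x' ∈ X → g x - (g x + H x - r) / 2 < g x' :=
        eventually_nhdsWithin_iff.1 (hg x hx _ (by linarith))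
      have h2 : ∀ᶠ x' in 𝓝 x, ((H x - (g x + H x - r) / 2 : ℝ) : EReal) < h x' :=
        hlsc x _ (by
          show _ < h x
          rw [eq_coe hh hx]
          exact EReal.coe_lt_coe_iff.2 (by simp only [hH] at hr ⊢; linarith))
      filter_upwards [h1, h2] with x' h1 h2
      by_cases hx' : x' ∈ X
      · simp only [F, if_pos hx']
        refine hyr.trans (EReal.coe_lt_coe_iff.2 ?_)
        rw [eq_coe hh hx'] at h2
        have h3 : H x - (g x + H x - r) / 2 < H x' := EReal.coe_lt_coe_iff.1 h2
        have := h1 hx'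
        linarith
      · simp only [F, if_neg hx']
        exact lt_of_lt_of_le hyr le_top
    -- Outside `X` the value is `⊤`: nearby, `h` exceeds any level, while `g` stays above the
    -- continuous function `q`, so the sum is large too. No continuity of `g` at such points is
    -- needed.
    · let q : E → ℝ := fun x => a - b * ‖x - x₀‖ + κ * ‖x - x₀‖ ^ 2
      have hq : Continuous q := by fun_prop
      have h1 : ∀ᶠ x' in 𝓝 x, q x - 1 < q x' :=
        hq.continuousAt.eventually_const_lt (by linarith)
      have h2 : ∀ᶠ x' in 𝓝 x, ((r - q x + 1 : ℝ) : EReal) < h x' :=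
        hlsc x _ (by show _ < h x; rw [eq_top hh hx]; exact EReal.coe_lt_top _)
      filter_upwards [h1, h2] with x' h1 h2
      by_cases hx' : x' ∈ X
      · simp only [F, if_pos hx']
        refine hyr.trans (EReal.coe_lt_coe_iff.2 ?_)
        rw [eq_coe hh hx'] at h2
        have h3 : r - q x + 1 < H x' := EReal.coe_lt_coe_iff.1 h2
        have h4 : q x' ≤ g x' := hgb x' hx'
        linarith
      · simp only [F, if_neg hx']
        exact lt_of_lt_of_le hyr le_top
  set V : ℝ := g x₀ + H x₀
  -- `K` collects all the linear losses of `g` and `h` and the value at `x₀`; since `κ R = κ + K`,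
  -- the quadratic term beats them outside the ball of radius `R`.
  set K : ℝ := |a| + |b| + 2 * c + |V| with hK
  set R : ℝ := 1 + K / κ with hR
  have hK0 : 0 ≤ K := by positivity
  have hR1 : 1 ≤ R := by
    have : 0 ≤ K / κ := by positivity
    linarith
  obtain ⟨w, hwB, hw⟩ := (hF.lowerSemicontinuousOn _).exists_isMinOn
    (⟨x₀, by simp; linarith⟩ : (Metric.closedBall x₀ R).Nonempty) (isCompact_closedBall x₀ R)
  have hw0 : F w ≤ F x₀ := hw (by simp; linarith)
  have hwX : w ∈ X := by
    by_contra hwX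
    simp only [F, if_neg hwX, if_pos hx₀] at hw0
    exact absurd hw0 (not_le.2 (EReal.coe_lt_top _))
  simp only [F, if_pos hwX, if_pos hx₀, EReal.coe_le_coe_iff] at hw0
  refine ⟨w, hwX, fun x hx => ?_⟩
  rcases le_or_gt ‖x - x₀‖ R with hxR | hxR
  · have h1 : F w ≤ F x := hw (by simpa [dist_eq_norm] using hxR)
    simpa only [F, if_pos hwX, if_pos hx, EReal.coe_le_coe_iff] using h1
  · have h1 := hgb x hx
    have h2 : -c - c * ‖x - x₀‖ ≤ H x := hc x hx
    set s := ‖x - x₀‖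
    have h3 : κ * R = κ + K := by rw [hR]; field_simp
    have h4 : κ * R * s ≤ κ * s ^ 2 := by
      have : κ * s * R ≤ κ * s * s := mul_le_mul_of_nonneg_left hxR.le (by nlinarith)
      nlinarith
    rw [h3] at h4
    have h5 : V ≤ |V| := le_abs_self V
    have h6 : -|a| ≤ a := neg_abs_le a
    have h7 : b * s ≤ |b| * s := mul_le_mul_of_nonneg_right (le_abs_self b) (by linarith)
    have h8 : |a| + c + |V| ≤ (|a| + c + |V|) * s :=
      le_mul_of_one_le_right (by positivity) (by linarith)
    have h9 : 0 ≤ κ * s := mul_nonneg hκ.le (by linarith)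
    show g w + H w ≤ g x + H x
    have hexp : (κ + K) * s = κ * s + (|a| + c + |V|) * s + |b| * s + c * s := by
      rw [hK]; ring
    linarith

end ConvBar

theorem convexOn_inner_add (s : E) {X : Set E} (hX : Convex ℝ X) :
    ConvexOn ℝ X fun x => inner ℝ s x :=
  ⟨hX, fun x _ y _ a b _ _ _ => by simp [inner_add_right, inner_smul_right]⟩

/-- The growth of a strongly convex function away from its minimizer. -/
theorem StrongConvexOn.add_sq_le {X : Set E} {c : ℝ} {G : E → ℝ} (hG : StrongConvexOn X c G)
    {w : E} (hw : w ∈ X) (hmin : ∀ x ∈ X, G w ≤ G x) {x : E} (hx : x ∈ X) :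
    G w + c / 2 * ‖x - w‖ ^ 2 ≤ G x := by
  -- Minimality of `w` is compared with strong convexity at the point a fraction `t` of the way to
  -- `x`; dividing by `t` and letting `t → 0` gives the full modulus.
  have key : ∀ t : ℝ, 0 < t → t ≤ 1 → G w + (1 - t) * (c / 2 * ‖x - w‖ ^ 2) ≤ G x := by
    intro t ht ht1
    have h1 := hG.2 hx hw ht.le (show 0 ≤ 1 - t by linarith) (by ring)
    have h2 := hmin _ (hG.1 hx hw ht.le (show 0 ≤ 1 - t by linarith) (by ring))
    simp only [smul_eq_mul] at h1
    have h3 : t * (G w + (1 - t) * (c / 2 * ‖x - w‖ ^ 2)) ≤ t * G x := by nlinarith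
    exact le_of_mul_le_mul_left h3 ht
  have hcont : Tendsto (fun t : ℝ => G w + (1 - t) * (c / 2 * ‖x - w‖ ^ 2)) (𝓝[>] 0)
      (𝓝 (G w + (1 - 0) * (c / 2 * ‖x - w‖ ^ 2))) := by
    apply Tendsto.mono_left _ nhdsWithin_le_nhds
    exact (by fun_prop : Continuous fun t : ℝ => G w + (1 - t) * (c / 2 * ‖x - w‖ ^ 2)).tendsto 0
  have hev : ∀ᶠ t : ℝ in 𝓝[>] 0, G w + (1 - t) * (c / 2 * ‖x - w‖ ^ 2) ≤ G x := by
    filter_upwards [Ioo_mem_nhdsGT (zero_lt_one' ℝ)] with t ht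
    exact key t ht.1 ht.2.le
  have := le_of_tendsto hcont hev
  simpa using this

theorem StrongConvexOn.unique {X : Set E} {c : ℝ} (hc : 0 < c) {G : E → ℝ}
    (hG : StrongConvexOn X c G)
    {w x : E} (hw : w ∈ X) (hmin : ∀ x ∈ X, G w ≤ G x) (hx : x ∈ X)
    (hmin' : ∀ x' ∈ X, G x ≤ G x') : x = w := by
  have h1 := StrongConvexOn.add_sq_le hG hw hmin hx
  have h2 := hmin' w hw
  have h3 : c / 2 * ‖x - w‖ ^ 2 ≤ 0 := by linarith
  have h4 : ‖x - w‖ ^ 2 ≤ 0 := by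
    by_contra! h
    have : 0 < c / 2 * ‖x - w‖ ^ 2 := by positivity
    linarith
  have h5 : ‖x - w‖ = 0 := by nlinarith [norm_nonneg (x - w)]
  exact sub_eq_zero.1 (norm_eq_zero.1 h5)

/-- Adding a quadratic with linear part to a convex function. -/
theorem strongConvexOn_add_quadratic {X : Set E} {H : E → ℝ} (hH : ConvexOn ℝ X H) (c d : ℝ)
    (s a : E) : StrongConvexOn X c fun x => H x + inner ℝ s x + c / 2 * ‖x - a‖ ^ 2 + d := by
  rw [strongConvexOn_iff_convex]
  have h1 : ConvexOn ℝ X fun x => H x + inner ℝ (s - c • a) x + (c / 2 * ‖a‖ ^ 2 + d) :=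
    (hH.add (convexOn_inner_add _ hH.1)).add (convexOn_const _ hH.1)
  convert h1 using 2 with x
  rw [norm_sub_sq_real, inner_sub_left, inner_smul_left, real_inner_comm x a]
  simp
  ring

end ConvexAnalysis

/-! ### Extended-valued argmins reduced to real-valued minimization over the domain. -/

section Argmin

/-- A point minimizing over the domain minimizes globally an extended-valued function. -/
theorem isMinOn_univ_iff {E : Type u} {X : Set E} {F : E → EReal} {G : E → ℝ} (hX : X.Nonempty)
    (hF : ∀ x ∈ X, F x = (G x : EReal)) (hF' : ∀ x ∉ X, F x = ⊤) (w : E) :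
    IsMinOn F Set.univ w ↔ w ∈ X ∧ ∀ x ∈ X, G w ≤ G x := by
  constructor
  · intro h
    have hw : w ∈ X := by
      obtain ⟨x, hx⟩ := hX
      by_contra hw
      have h1 : F w ≤ F x := h (Set.mem_univ x)
      rw [hF' w hw, hF x hx] at h1
      exact absurd h1 (not_le.2 (EReal.coe_lt_top _))
    refine ⟨hw, fun x hx => ?_⟩
    have h1 : F w ≤ F x := h (Set.mem_univ x)
    rw [hF w hw, hF x hx] at h1
    exact EReal.coe_le_coe_iff.1 h1
  · rintro ⟨hw, h⟩ x -
    show F w ≤ F x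
    by_cases hx : x ∈ X
    · rw [hF w hw, hF x hx]
      exact EReal.coe_le_coe_iff.2 (h x hx)
    · rw [hF' x hx]; exact le_top

theorem argminOn_univ_spec {E : Type u} [Nonempty E] {X : Set E} {F : E → EReal} {G : E → ℝ}
    (hF : ∀ x ∈ X, F x = (G x : EReal)) (hF' : ∀ x ∉ X, F x = ⊤)
    (hex : ∃ w ∈ X, ∀ x ∈ X, G w ≤ G x) :
    argminOn Set.univ F ∈ X ∧ ∀ x ∈ X, G (argminOn Set.univ F) ≤ G x := by
  obtain ⟨w, hw, hmin⟩ := hex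
  have hne : X.Nonempty := ⟨w, hw⟩
  have h := Classical.epsilon_spec (p := fun x => x ∈ Set.univ ∧ IsMinOn F Set.univ x)
    ⟨w, Set.mem_univ w, (isMinOn_univ_iff hne hF hF' w).2 ⟨hw, hmin⟩⟩
  exact (isMinOn_univ_iff hne hF hF' _).1 h.2

theorem argminOn_spec {E : Type u} [Nonempty E] {X : Set E} {F : E → EReal} {G : E → ℝ}
    (hF : ∀ x ∈ X, F x = (G x : EReal)) (hex : ∃ w ∈ X, ∀ x ∈ X, G w ≤ G x) :
    argminOn X F ∈ X ∧ ∀ x ∈ X, G (argminOn X F) ≤ G x := by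
  obtain ⟨w, hw, hmin⟩ := hex
  have h : argminOn X F ∈ X ∧ IsMinOn F X (argminOn X F) :=
    Classical.epsilon_spec (p := fun x => x ∈ X ∧ IsMinOn F X x)
    ⟨w, hw, fun x hx => by
      show F w ≤ F x
      rw [hF w hw, hF x hx]; exact EReal.coe_le_coe_iff.2 (hmin x hx)⟩
  refine ⟨h.1, fun x hx => ?_⟩
  have h1 : F (argminOn X F) ≤ F x := h.2 hx
  rw [hF _ h.1, hF x hx] at h1
  exact EReal.coe_le_coe_iff.1 h1

end Argmin

/-! ### Estimate-sequence analysis of the ACG method. -/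

section ACGAnalysis

/-- The increment `a = A' - A` is the positive root of `L a² = (μA + 1)(A + a)`. This relation is
all that the convergence proof uses about the step sizes. -/
theorem acgA_spec {μ L A : ℝ} (hμ : 0 ≤ μ) (hL : 0 < L) (hA : 0 ≤ A) :
    A < acgA μ L A ∧ L * (acgA μ L A - A) ^ 2 = (μ * A + 1) * acgA μ L A := by
  have hb : 0 < μ * A + 1 := by positivity
  set b := μ * A + 1
  have hr : 0 ≤ b ^ 2 + 4 * L * b * A := by positivity
  have hs := Real.sq_sqrt hr
  have hs0 := Real.sqrt_nonneg (b ^ 2 + 4 * L * b * A)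
  have he : acgA μ L A = A + (b + √(b ^ 2 + 4 * L * b * A)) / (2 * L) := rfl
  set r := √(b ^ 2 + 4 * L * b * A)
  rw [he]
  refine ⟨by have : 0 < (b + r) / (2 * L) := by positivity
             linarith, ?_⟩
  field_simp
  nlinarith

/-- Since `A' ≤ L (A' - A)²`, the number `t = √(4LA')` satisfies `4LA ≤ t² - 2t < (t - 1)²`: the
quantity `√(4LA)` increases by at least 1. -/
theorem acgA_sqrt_growth {μ L A : ℝ} (hμ : 0 ≤ μ) (hL : 0 < L) (hA : 0 ≤ A) {j : ℝ} (hj : 0 ≤ j)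
    (h : j ^ 2 ≤ 4 * L * A) : (j + 1) ^ 2 ≤ 4 * L * acgA μ L A := by
  obtain ⟨h1, h2⟩ := acgA_spec hμ hL hA
  set A' := acgA μ L A
  have hA' : 0 < A' := by linarith
  set t := √(4 * L * A')
  have ht : t ^ 2 = 4 * L * A' := Real.sq_sqrt (by positivity)
  have ht0 : 0 < t := Real.sqrt_pos.2 (by positivity)
  have h3 : A' ≤ L * (A' - A) ^ 2 := by
    rw [h2]; nlinarith [mul_nonneg hμ hA, mul_nonneg (mul_nonneg hμ hA) hA'.le]
  have h4 : t ≤ 2 * L * (A' - A) := by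
    apply le_of_sq_le_sq _ (by nlinarith)
    rw [ht]; nlinarith
  have h5 : j ^ 2 ≤ t ^ 2 - 2 * t := by rw [ht]; nlinarith
  have h6 : 2 ≤ t := by nlinarith [sq_nonneg j]
  rw [← ht]
  apply pow_le_pow_left₀ (by linarith)
  by_contra! hlt
  nlinarith

/-- An increment below `rA` would give `L (A' - A)² < μA² ≤ μAA'`, contradicting the quadratic
relation for the step sizes. -/
theorem acgA_geometric_growth {μ L A : ℝ} (hμ : 0 ≤ μ) (hL : 0 < L) (hA : 0 ≤ A) {r : ℝ}
    (hrL : L * r ^ 2 ≤ μ) : (1 + r) * A ≤ acgA μ L A := by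
  obtain ⟨h1, h2⟩ := acgA_spec hμ hL hA
  set A' := acgA μ L A
  by_contra! hlt
  have h3 : A' - A < r * A := by linarith
  have h4 : (A' - A) ^ 2 < (r * A) ^ 2 := by
    apply pow_lt_pow_left₀ h3 (by linarith) (by norm_num)
  have h5 : L * (A' - A) ^ 2 < L * (r * A) ^ 2 := mul_lt_mul_of_pos_left h4 hL
  have h6 : L * (r * A) ^ 2 ≤ μ * A ^ 2 := by nlinarith [sq_nonneg A]
  have h7 : μ * A * A ≤ μ * A * A' := mul_le_mul_of_nonneg_left h1.le (mul_nonneg hμ hA)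
  nlinarith

variable {E : Type u} [NormedAddCommGroup E] [InnerProductSpace ℝ E] [FiniteDimensional ℝ E]

/-- Hypotheses under which the ACG method is analysed: `ψn = H + μ/2 ‖· - z₀‖²` on `X` with `H`
convex, and `ψs` is convex and `L`-smooth on `X`. -/
structure ACGData (X : Set E) (ψs : E → ℝ) (ψn : E → EReal) (H : E → ℝ) (μ L : ℝ) (z₀ : E) :
    Prop where
  z₀_mem : z₀ ∈ X
  μ_nonneg : 0 ≤ μ
  L_pos : 0 < L
  convex_H : ConvexOn ℝ X H
  ψn_coe : ∀ x ∈ X, ψn x = ((H x + μ / 2 * ‖x - z₀‖ ^ 2 : ℝ) : EReal)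
  ψn_top : ∀ x ∉ X, ψn x = ⊤
  exists_min : ∀ (s : E) (c : ℝ), 0 < c → ∃ w ∈ X, ∀ x ∈ X,
    H w + inner ℝ s w + c / 2 * ‖w - z₀‖ ^ 2 ≤ H x + inner ℝ s x + c / 2 * ‖x - z₀‖ ^ 2
  lower : ∀ x ∈ X, ∀ x' ∈ X, ψs x' + inner ℝ (gradient ψs x') (x - x') ≤ ψs x
  upper : ∀ x ∈ X, ∀ x' ∈ X,
    ψs x ≤ ψs x' + inner ℝ (gradient ψs x') (x - x') + L / 2 * ‖x - x'‖ ^ 2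

/-- The invariant of the ACG iterates. -/
structure ACGInv (X : Set E) (ψs : E → ℝ) (N : E → ℝ) (μ : ℝ) (z₀ : E) (s : ACGIterate E) :
    Prop where
  A_nonneg : 0 ≤ s.A
  y_mem : s.y ∈ X
  z_mem : s.z ∈ X
  affine : ∃ (g : E) (d : ℝ), ∀ x, s.Γ x = d + inner ℝ g x
  minorant : ∀ x ∈ X, s.A * s.Γ x ≤ s.A * ψs x
  value : s.A * (ψs s.z + N s.z) ≤ s.A * (s.Γ s.y + N s.y) + 1 / 2 * ‖s.y - z₀‖ ^ 2
  growth : ∀ x ∈ X, s.A * (s.Γ s.y + N s.y) + 1 / 2 * ‖s.y - z₀‖ ^ 2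
    + (1 + μ * s.A) / 2 * ‖x - s.y‖ ^ 2 ≤ s.A * (s.Γ x + N x) + 1 / 2 * ‖x - z₀‖ ^ 2

variable {X : Set E} {ψs : E → ℝ} {ψn : E → EReal} {H : E → ℝ} {μ L : ℝ} {z₀ : E}

/-- Minimization of an affine function plus `ψn` plus a multiple of `‖· - z₀‖²`. -/
theorem ACGData.argmin_spec (hd : ACGData X ψs ψn H μ L z₀) {Γ : E → ℝ} {g : E} {d : ℝ}
    (hΓ : ∀ x, Γ x = d + inner ℝ g x) {A : ℝ} (hA : 0 < A) :
    let w := argminOn Set.univ fun y : E =>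
      (Γ y : EReal) + ψn y + ((1 / (2 * A) * ‖y - z₀‖ ^ 2 : ℝ) : EReal)
    w ∈ X ∧ ∀ x ∈ X, A * (Γ w + (H w + μ / 2 * ‖w - z₀‖ ^ 2)) + 1 / 2 * ‖w - z₀‖ ^ 2
      + (1 + μ * A) / 2 * ‖x - w‖ ^ 2 ≤
        A * (Γ x + (H x + μ / 2 * ‖x - z₀‖ ^ 2)) + 1 / 2 * ‖x - z₀‖ ^ 2 := by
  intro w
  -- `μ` comes from the quadratic part of `ψn` and `1/A` from the proximal term, both centred at
  -- `z₀`; multiplying by `A` turns the modulus `c` into `1 + μA`.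
  set c := μ + 1 / A with hc
  have hc0 : 0 < c := by have := hd.μ_nonneg; positivity
  set G : E → ℝ := fun x => H x + inner ℝ g x + c / 2 * ‖x - z₀‖ ^ 2 + d with hG
  have hsc : StrongConvexOn X c G := strongConvexOn_add_quadratic hd.convex_H c d g z₀
  have hF : ∀ x ∈ X, (Γ x : EReal) + ψn x + ((1 / (2 * A) * ‖x - z₀‖ ^ 2 : ℝ) : EReal)
      = (G x : EReal) := by
    intro x hx
    rw [hd.ψn_coe x hx, ← EReal.coe_add, ← EReal.coe_add]
    congr 1
    rw [hG, hΓ, hc]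
    field_simp
    ring
  have hF' : ∀ x ∉ X, (Γ x : EReal) + ψn x + ((1 / (2 * A) * ‖x - z₀‖ ^ 2 : ℝ) : EReal) = ⊤ := by
    intro x hx
    rw [hd.ψn_top x hx, EReal.coe_add_top, EReal.top_add_coe]
  obtain ⟨hw, hmin⟩ := argminOn_univ_spec (G := G) hF hF' (by
    obtain ⟨w, hw, hm⟩ := hd.exists_min g c hc0
    exact ⟨w, hw, fun x hx => by simpa [hG] using hm x hx⟩)
  refine ⟨hw, fun x hx => ?_⟩
  have h1 := StrongConvexOn.add_sq_le hsc hw hmin hx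
  change G w + c / 2 * ‖x - w‖ ^ 2 ≤ G x at h1
  have h2 := mul_le_mul_of_nonneg_left h1 hA.le
  simp only [hG] at h2
  rw [hΓ, hΓ]
  have hcA : A * c = 1 + μ * A := by rw [hc]; field_simp; ring
  calc _ = A * (H w + inner ℝ g w + c / 2 * ‖w - z₀‖ ^ 2 + d + c / 2 * ‖x - w‖ ^ 2) := by
        linear_combination (-(‖w - z₀‖ ^ 2) / 2 - ‖x - w‖ ^ 2 / 2) * hcA
    _ ≤ A * (H x + inner ℝ g x + c / 2 * ‖x - z₀‖ ^ 2 + d) := h2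
    _ = _ := by linear_combination (‖x - z₀‖ ^ 2 / 2) * hcA

theorem ACGData.convexOn_N (hd : ACGData X ψs ψn H μ L z₀) :
    ConvexOn ℝ X fun x => H x + μ / 2 * ‖x - z₀‖ ^ 2 := by
  have h := strongConvexOn_add_quadratic hd.convex_H μ 0 0 z₀
  have h2 := strongConvexOn_zero.1 (h.mono hd.μ_nonneg)
  simpa using h2

/-- The minorant and growth properties pass to a convex combination of models and its minimizer. For
the value bound, `ψs` is bounded above at the new `z` and below at the old `z` by its linearization
at the extrapolated point, and the upper error `L/2 ‖z' - zt‖²` is paid for by the growth of the old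
model between `y` and `y'`. -/
theorem ACGData.inv_next (hd : ACGData X ψs ψn H μ L z₀) {s : ACGIterate E}
    (hs : ACGInv X ψs (fun x => H x + μ / 2 * ‖x - z₀‖ ^ 2) μ z₀ s) :
    ACGInv X ψs (fun x => H x + μ / 2 * ‖x - z₀‖ ^ 2) μ z₀ (acgNext μ L ψs ψn z₀ s) := by
  obtain ⟨hA1, hA2⟩ := acgA_spec hd.μ_nonneg hd.L_pos hs.A_nonneg
  have hX : Convex ℝ X := hd.convex_H.1
  set s' := acgNext μ L ψs ψn z₀ s with hs'
  have hsA : s'.A = acgA μ L s.A := rfl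
  rw [← hsA] at hA1 hA2
  have hA0 := hs.A_nonneg
  have hA'0 : 0 < s'.A := by linarith
  set zt := (s.A / s'.A) • s.z + ((s'.A - s.A) / s'.A) • s.y with hzt
  have hΓ : ∀ x, s'.Γ x = s.A / s'.A * s.Γ x +
    (s'.A - s.A) / s'.A * (ψs zt + inner ℝ (gradient ψs zt) (x - zt)) := fun _ => rfl
  have hz : s'.z = (s.A / s'.A) • s.z + ((s'.A - s.A) / s'.A) • s'.y := rfl
  have hyd : s'.y = argminOn Set.univ fun y : E =>
      (s'.Γ y : EReal) + ψn y + ((1 / (2 * s'.A) * ‖y - z₀‖ ^ 2 : ℝ) : EReal) := rfl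
  clear_value s'
  set A := s.A
  set A' := s'.A
  have hw1 : 0 ≤ A / A' := by positivity
  have hw2 : 0 ≤ (A' - A) / A' := div_nonneg (by linarith) hA'0.le
  have hw3 : A / A' + (A' - A) / A' = 1 := by field_simp; ring
  have hztX : zt ∈ X := hX hs.z_mem hs.y_mem hw1 hw2 hw3
  obtain ⟨g, d, hgd⟩ := hs.affine
  have haff : ∀ x, s'.Γ x =
      (A / A' * d + (A' - A) / A' * (ψs zt - inner ℝ (gradient ψs zt) zt)) +
        inner ℝ ((A / A') • g + ((A' - A) / A') • gradient ψs zt) x := by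
    intro x
    rw [hΓ, hgd, inner_add_left, inner_smul_left, inner_smul_left, inner_sub_right]
    simp
    ring
  obtain ⟨hyX, hgrow⟩ := hd.argmin_spec haff hA'0
  rw [← hyd] at hyX hgrow
  have hzX : s'.z ∈ X := hz ▸ hX hs.z_mem hyX hw1 hw2 hw3
  have hAΓ : ∀ x, A' * s'.Γ x = A * s.Γ x +
      (A' - A) * (ψs zt + inner ℝ (gradient ψs zt) (x - zt)) := by
    intro x; rw [hΓ]; field_simp
  refine ⟨hA'0.le, hyX, hzX, ⟨_, _, haff⟩, fun x hx => ?_, ?_, hgrow⟩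
  · rw [hAΓ]
    have h1 := hs.minorant x hx
    have h2 := mul_le_mul_of_nonneg_left (hd.lower x hx zt hztX) (by linarith : 0 ≤ A' - A)
    change A * s.Γ x ≤ A * ψs x at h1
    linarith
  · have h1 := hs.value
    have h2 := hs.growth s'.y hyX
    have h3 := mul_le_mul_of_nonneg_left (hd.lower s.z hs.z_mem zt hztX) hA0
    have h4 := hd.upper s'.z hzX zt hztX
    have h5 := hd.convexOn_N.2 hs.z_mem hyX hw1 hw2 hw3
    rw [← hz] at h5
    simp only [smul_eq_mul] at h1 h2 h5 ⊢
    set N : E → ℝ := fun x => H x + μ / 2 * ‖x - z₀‖ ^ 2 with hN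
    change A * (ψs s.z + N s.z) ≤ A * (s.Γ s.y + N s.y) + 1 / 2 * ‖s.y - z₀‖ ^ 2 at h1
    change A * (s.Γ s.y + N s.y) + 1 / 2 * ‖s.y - z₀‖ ^ 2 + (1 + μ * A) / 2 * ‖s'.y - s.y‖ ^ 2
      ≤ A * (s.Γ s'.y + N s'.y) + 1 / 2 * ‖s'.y - z₀‖ ^ 2 at h2
    change N s'.z ≤ A / A' * N s.z + (A' - A) / A' * N s'.y at h5
    change A' * (ψs s'.z + N s'.z) ≤ A' * (s'.Γ s'.y + N s'.y) + 1 / 2 * ‖s'.y - z₀‖ ^ 2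
    have h6 : A' * N s'.z ≤ A * N s.z + (A' - A) * N s'.y := by
      have := mul_le_mul_of_nonneg_left h5 hA'0.le
      calc _ ≤ _ := this
        _ = _ := by field_simp
    have hdiff : s'.z - zt = ((A' - A) / A') • (s'.y - s.y) := by
      rw [hz, hzt]; module
    -- The exact balance behind the choice of `A'`: by its quadratic equation, the smoothness error
    -- equals the growth term of the previous model.
    have h7 : A' * (L / 2 * ‖s'.z - zt‖ ^ 2) = (1 + μ * A) / 2 * ‖s'.y - s.y‖ ^ 2 := by
      rw [hdiff, norm_smul, Real.norm_of_nonneg hw2, mul_pow]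
      have : A' * (L / 2 * (((A' - A) / A') ^ 2 * ‖s'.y - s.y‖ ^ 2)) =
        (L * (A' - A) ^ 2) / A' / 2 * ‖s'.y - s.y‖ ^ 2 := by field_simp
      rw [this, hA2]; field_simp; ring
    have h8 : A' * inner ℝ (gradient ψs zt) (s'.z - zt) =
        A * inner ℝ (gradient ψs zt) (s.z - zt)
          + (A' - A) * inner ℝ (gradient ψs zt) (s'.y - zt) := by
      have : s'.z - zt = (A / A') • (s.z - zt) + ((A' - A) / A') • (s'.y - zt) := by
        rw [hz]
        have : zt = (A / A' + (A' - A) / A') • zt := by rw [hw3, one_smul]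
        nth_rewrite 1 [this]
        module
      rw [this, inner_add_right, inner_smul_right, inner_smul_right]
      field_simp
    have h9 := mul_le_mul_of_nonneg_left h4 hA'0.le
    have h10 := hAΓ s'.y
    nlinarith

theorem ACGData.inv_seq (hd : ACGData X ψs ψn H μ L z₀) (j : ℕ) :
    ACGInv X ψs (fun x => H x + μ / 2 * ‖x - z₀‖ ^ 2) μ z₀ (acgSeq μ L ψs ψn z₀ j) := by
  induction j with
  | zero =>
    refine ⟨le_rfl, hd.z₀_mem, hd.z₀_mem, ⟨0, 0, fun x => ?_⟩, fun x _ => ?_, ?_, fun x _ => ?_⟩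
    · simp [acgSeq]
    · simp [acgSeq]
    · simp [acgSeq]
    · simp [acgSeq]
  | succ j ih => exact hd.inv_next ih

theorem ACGData.A_pos (hd : ACGData X ψs ψn H μ L z₀) (j : ℕ) :
    0 < (acgSeq μ L ψs ψn z₀ (j + 1)).A :=
  lt_of_le_of_lt (hd.inv_seq j).A_nonneg
    (acgA_spec hd.μ_nonneg hd.L_pos (hd.inv_seq j).A_nonneg).1

theorem ACGData.A_pos' (hd : ACGData X ψs ψn H μ L z₀) {j : ℕ} (hj : 1 ≤ j) :
    0 < (acgSeq μ L ψs ψn z₀ j).A := by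
  obtain ⟨i, rfl⟩ : ∃ i, j = i + 1 := ⟨j - 1, by omega⟩
  exact hd.A_pos i

theorem ACGData.sq_le_A (hd : ACGData X ψs ψn H μ L z₀) (j : ℕ) :
    (j : ℝ) ^ 2 ≤ 4 * L * (acgSeq μ L ψs ψn z₀ j).A := by
  induction j with
  | zero => simp [acgSeq]
  | succ j ih =>
    push_cast
    exact acgA_sqrt_growth hd.μ_nonneg hd.L_pos (hd.inv_seq j).A_nonneg j.cast_nonneg ih

theorem ACGData.geometric_le_A (hd : ACGData X ψs ψn H μ L z₀) {r : ℝ} (hr : 0 ≤ r)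
    (hrL : L * r ^ 2 ≤ μ) (j n : ℕ) :
    (1 + r) ^ n * (acgSeq μ L ψs ψn z₀ j).A ≤ (acgSeq μ L ψs ψn z₀ (j + n)).A := by
  induction n with
  | zero => simp
  | succ n ih =>
    have h1 : (1 + r) * (acgSeq μ L ψs ψn z₀ (j + n)).A ≤ (acgSeq μ L ψs ψn z₀ (j + (n + 1))).A :=
      acgA_geometric_growth hd.μ_nonneg hd.L_pos (hd.inv_seq _).A_nonneg hrL
    have h2 := mul_le_mul_of_nonneg_left ih (by linarith : 0 ≤ 1 + r)
    calc _ = (1 + r) * ((1 + r) ^ n * (acgSeq μ L ψs ψn z₀ j).A) := by ring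
      _ ≤ _ := h2.trans h1

theorem acgSeq_u {j : ℕ} (hj : 1 ≤ j) : (acgSeq μ L ψs ψn z₀ j).u =
    (1 / (acgSeq μ L ψs ψn z₀ j).A) • (z₀ - (acgSeq μ L ψs ψn z₀ j).y) := by
  obtain ⟨i, rfl⟩ : ∃ i, j = i + 1 := ⟨j - 1, by omega⟩
  rfl

theorem acgSeq_ε {j : ℕ} (hj : 1 ≤ j) : (acgSeq μ L ψs ψn z₀ j).ε =
    (ψs (acgSeq μ L ψs ψn z₀ j).z + (ψn (acgSeq μ L ψs ψn z₀ j).z).toReal)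
      - (acgSeq μ L ψs ψn z₀ j).Γ (acgSeq μ L ψs ψn z₀ j).y
      - (ψn (acgSeq μ L ψs ψn z₀ j).y).toReal
      - inner ℝ (acgSeq μ L ψs ψn z₀ j).u
        ((acgSeq μ L ψs ψn z₀ j).z - (acgSeq μ L ψs ψn z₀ j).y) := by
  obtain ⟨i, rfl⟩ : ∃ i, j = i + 1 := ⟨j - 1, by omega⟩
  rfl

theorem ACGData.ε_eq (hd : ACGData X ψs ψn H μ L z₀) {j : ℕ} (hj : 1 ≤ j) :
    (acgSeq μ L ψs ψn z₀ j).ε =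
    (ψs (acgSeq μ L ψs ψn z₀ j).z + (H (acgSeq μ L ψs ψn z₀ j).z
        + μ / 2 * ‖(acgSeq μ L ψs ψn z₀ j).z - z₀‖ ^ 2))
      - (acgSeq μ L ψs ψn z₀ j).Γ (acgSeq μ L ψs ψn z₀ j).y
      - (H (acgSeq μ L ψs ψn z₀ j).y + μ / 2 * ‖(acgSeq μ L ψs ψn z₀ j).y - z₀‖ ^ 2)
      - inner ℝ (acgSeq μ L ψs ψn z₀ j).u
        ((acgSeq μ L ψs ψn z₀ j).z - (acgSeq μ L ψs ψn z₀ j).y) := by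
  rw [acgSeq_ε hj, hd.ψn_coe _ (hd.inv_seq j).z_mem, hd.ψn_coe _ (hd.inv_seq j).y_mem]
  rfl

/-- The optimality estimate for the ACG iterates. -/
theorem ACGData.value_le (hd : ACGData X ψs ψn H μ L z₀) (j : ℕ) {x : E} (hx : x ∈ X) :
    (acgSeq μ L ψs ψn z₀ j).A * (ψs (acgSeq μ L ψs ψn z₀ j).z + (H (acgSeq μ L ψs ψn z₀ j).z
        + μ / 2 * ‖(acgSeq μ L ψs ψn z₀ j).z - z₀‖ ^ 2))
      + (1 + μ * (acgSeq μ L ψs ψn z₀ j).A) / 2 * ‖x - (acgSeq μ L ψs ψn z₀ j).y‖ ^ 2 ≤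
    (acgSeq μ L ψs ψn z₀ j).A * (ψs x + (H x + μ / 2 * ‖x - z₀‖ ^ 2))
      + 1 / 2 * ‖x - z₀‖ ^ 2 := by
  have hi := hd.inv_seq j
  have h1 := hi.minorant x hx
  have h2 := hi.value
  have h3 := hi.growth x hx
  linarith

/-- The inexactness of the ACG iterates is controlled by `A_j`. -/
theorem ACGData.ε_le (hd : ACGData X ψs ψn H μ L z₀) {j : ℕ} (hj : 1 ≤ j) :
    2 * (acgSeq μ L ψs ψn z₀ j).A * (acgSeq μ L ψs ψn z₀ j).ε ≤
      ‖(acgSeq μ L ψs ψn z₀ j).z - z₀‖ ^ 2 := by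
  have hi := hd.inv_seq j
  have hA := hd.A_pos' hj
  rw [hd.ε_eq hj, acgSeq_u hj]
  have h2 := hi.value
  set s := acgSeq μ L ψs ψn z₀ j
  rw [inner_smul_left]
  -- As `A u = z₀ - y`, the inner product in `ε` completes the proximal term to `‖z - z₀‖²`, up to
  -- the favourable term `‖z - y‖²`.
  have h4 : ‖s.z - z₀‖ ^ 2 = ‖s.z - s.y‖ ^ 2 + ‖s.y - z₀‖ ^ 2
      - 2 * inner ℝ (z₀ - s.y) (s.z - s.y) := by
    have : s.z - z₀ = (s.z - s.y) - (z₀ - s.y) := by abel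
    rw [this, norm_sub_sq_real, norm_sub_rev z₀ s.y, real_inner_comm]
    ring
  have h5 : s.A * ((starRingEnd ℝ) (1 / s.A) * inner ℝ (z₀ - s.y) (s.z - s.y)) =
      inner ℝ (z₀ - s.y) (s.z - s.y) := by
    simp only [conj_trivial]; field_simp
  nlinarith [sq_nonneg ‖s.z - s.y‖]

/-- Optimality of `y` makes `u` a subgradient at `y` of the model plus `ψn`, and the model minorizes
`ψs`. Moving the base point of this inequality from `y` to `z` costs exactly the defect `ε`. -/
theorem ACGData.subgradient (hd : ACGData X ψs ψn H μ L z₀) {j : ℕ} (hj : 1 ≤ j) {x : E}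
    (hx : x ∈ X) :
    ψs (acgSeq μ L ψs ψn z₀ j).z + (H (acgSeq μ L ψs ψn z₀ j).z
        + μ / 2 * ‖(acgSeq μ L ψs ψn z₀ j).z - z₀‖ ^ 2)
      + (inner ℝ (acgSeq μ L ψs ψn z₀ j).u (x - (acgSeq μ L ψs ψn z₀ j).z)
        - (acgSeq μ L ψs ψn z₀ j).ε)
    ≤ ψs x + (H x + μ / 2 * ‖x - z₀‖ ^ 2) := by
  have hi := hd.inv_seq j
  have hA := hd.A_pos' hj
  rw [hd.ε_eq hj, acgSeq_u hj]
  have h1 := hi.minorant x hx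
  have h2 := hi.growth x hx
  have hμ := hd.μ_nonneg
  set s := acgSeq μ L ψs ψn z₀ j
  rw [inner_smul_left, inner_smul_left]
  simp only [conj_trivial]
  have h4 : ‖x - z₀‖ ^ 2 = ‖x - s.y‖ ^ 2 + ‖s.y - z₀‖ ^ 2
      - 2 * inner ℝ (z₀ - s.y) (x - s.y) := by
    have : x - z₀ = (x - s.y) - (z₀ - s.y) := by abel
    rw [this, norm_sub_sq_real, norm_sub_rev z₀ s.y, real_inner_comm]
    ring
  have h5 : x - s.y = (x - s.z) + (s.z - s.y) := by abel
  have h6 : inner ℝ (z₀ - s.y) (x - s.y) =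
      inner ℝ (z₀ - s.y) (x - s.z) + inner ℝ (z₀ - s.y) (s.z - s.y) := by
    rw [h5, inner_add_right]
  have h7 : 0 ≤ μ * s.A * ‖x - s.y‖ ^ 2 := by positivity
  have key : inner ℝ (z₀ - s.y) (x - s.z) + inner ℝ (z₀ - s.y) (s.z - s.y) ≤
      s.A * (ψs x + (H x + μ / 2 * ‖x - z₀‖ ^ 2)
        - (s.Γ s.y + (H s.y + μ / 2 * ‖s.y - z₀‖ ^ 2))) := by
    rw [← h6]; nlinarith
  have key2 : 1 / s.A * (inner ℝ (z₀ - s.y) (x - s.z) + inner ℝ (z₀ - s.y) (s.z - s.y)) ≤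
      (ψs x + (H x + μ / 2 * ‖x - z₀‖ ^ 2)
        - (s.Γ s.y + (H s.y + μ / 2 * ‖s.y - z₀‖ ^ 2))) := by
    rw [one_div, inv_mul_le_iff₀ hA]; exact key
  linarith

theorem ACGData.ε_nonneg (hd : ACGData X ψs ψn H μ L z₀) {j : ℕ} (hj : 1 ≤ j) :
    0 ≤ (acgSeq μ L ψs ψn z₀ j).ε := by
  have := hd.subgradient hj (hd.inv_seq j).z_mem
  simp at this
  linarith

end ACGAnalysis

/-! ### The descent lemma. -/

section Smooth

variable {E : Type u} [NormedAddCommGroup E] [InnerProductSpace ℝ E] [FiniteDimensional ℝ E]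

/-- The descent lemma on a convex set. -/
theorem descent_lemma {X : Set E} (hX : Convex ℝ X) {f : E → ℝ} {M : ℝ}
    (hf : ∀ x ∈ X, DifferentiableAt ℝ f x)
    (hM : ∀ x ∈ X, ∀ x' ∈ X, ‖gradient f x - gradient f x'‖ ≤ M * ‖x - x'‖)
    {x x' : E} (hx : x ∈ X) (hx' : x' ∈ X) :
    f x ≤ f x' + inner ℝ (gradient f x') (x - x') + M / 2 * ‖x - x'‖ ^ 2 := by
  set d := x - x' with hd
  set g := gradient f x'
  -- The deviation from the quadratic upper model along the segment; the Lipschitz bound makes its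
  -- derivative nonpositive.
  let F : ℝ → ℝ := fun t => f (x' + t • d) - t * inner ℝ g d - M / 2 * ‖d‖ ^ 2 * t ^ 2
  have hmem : ∀ t ∈ Set.Icc (0 : ℝ) 1, x' + t • d ∈ X := by
    intro t ht
    have : x' + t • d = (1 - t) • x' + t • x := by rw [hd]; module
    rw [this]
    exact hX hx' hx (by linarith [ht.2]) ht.1 (by ring)
  have hder : ∀ t ∈ Set.Icc (0 : ℝ) 1, HasDerivAt F
      (inner ℝ (gradient f (x' + t • d)) d - inner ℝ g d - M * ‖d‖ ^ 2 * t) t := by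
    intro t ht
    have h1 : HasDerivAt (fun t : ℝ => x' + t • d) d t := by
      simpa using ((hasDerivAt_id t).smul_const d).const_add x'
    have h2 := (hf _ (hmem t ht)).hasFDerivAt.comp_hasDerivAt t h1
    have h3 : fderiv ℝ f (x' + t • d) d = inner ℝ (gradient f (x' + t • d)) d := by
      rw [inner_gradient_left]
    rw [h3] at h2
    have h4 := (h2.sub ((hasDerivAt_id t).mul_const (inner ℝ g d))).sub
      (((hasDerivAt_id t).pow 2).const_mul (M / 2 * ‖d‖ ^ 2))
    refine h4.congr_deriv ?_
    simp
    ring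
  have hanti : AntitoneOn F (Set.Icc 0 1) := by
    apply antitoneOn_of_deriv_nonpos (convex_Icc 0 1)
    · exact fun t ht => (hder t ht).continuousAt.continuousWithinAt
    · exact fun t ht => (hder t (interior_subset ht)).differentiableAt.differentiableWithinAt
    · intro t ht
      have ht' := interior_subset ht
      rw [(hder t ht').deriv, ← inner_sub_left]
      have h1 := real_inner_le_norm (gradient f (x' + t • d) - g) d
      have h2 := hM _ (hmem t ht') x' hx'
      have h3 : ‖x' + t • d - x'‖ = t * ‖d‖ := by
        rw [add_sub_cancel_left, norm_smul, Real.norm_of_nonneg ht'.1]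
      rw [h3] at h2
      have h4 := mul_le_mul_of_nonneg_right h2 (norm_nonneg d)
      nlinarith
  have h := hanti (Set.left_mem_Icc.2 zero_le_one) (Set.right_mem_Icc.2 zero_le_one) zero_le_one
  have hx1 : x' + (1 : ℝ) • d = x := by rw [hd]; module
  simp only [F, hx1] at h
  simp at h
  linarith

end Smooth

/-! ### Weak convexity from quadratic supports. -/

section WeakConvexity

variable {E : Type u} [NormedAddCommGroup E] [InnerProductSpace ℝ E]

theorem convexComb_sq (x y : E) {a b : ℝ} (hab : a + b = 1) :
    a * ‖x - (a • x + b • y)‖ ^ 2 + b * ‖y - (a • x + b • y)‖ ^ 2 = a * b * ‖x - y‖ ^ 2 := by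
  obtain rfl : b = 1 - a := by linarith
  have h1 : x - (a • x + (1 - a) • y) = (1 - a) • (x - y) := by module
  have h2 : y - (a • x + (1 - a) • y) = (-a) • (x - y) := by module
  rw [h1, h2, norm_smul, norm_smul, mul_pow, mul_pow, Real.norm_eq_abs, Real.norm_eq_abs,
    sq_abs, sq_abs]
  ring

theorem convexComb_inner (g x y : E) {a b : ℝ} (hab : a + b = 1) :
    a * inner ℝ g (x - (a • x + b • y)) + b * inner ℝ g (y - (a • x + b • y)) = 0 := by
  obtain rfl : b = 1 - a := by linarith
  have h1 : x - (a • x + (1 - a) • y) = (1 - a) • (x - y) := by module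
  have h2 : y - (a • x + (1 - a) • y) = (-a) • (x - y) := by module
  rw [h1, h2, inner_smul_right, inner_smul_right]
  ring

/-- A function with quadratic lower supports at all points is weakly convex. -/
theorem strongConvexOn_of_support {X : Set E} (hX : Convex ℝ X) {f : E → ℝ} {c : ℝ}
    (h : ∀ z ∈ X, ∃ g : E, ∀ x ∈ X, f z + inner ℝ g (x - z) + c / 2 * ‖x - z‖ ^ 2 ≤ f x) :
    StrongConvexOn X c f := by
  refine ⟨hX, fun x hx y hy a b ha hb hab => ?_⟩
  obtain ⟨g, hg⟩ := h _ (hX hx hy ha hb hab)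
  have h1 := mul_le_mul_of_nonneg_left (hg x hx) ha
  have h2 := mul_le_mul_of_nonneg_left (hg y hy) hb
  have h3 := convexComb_sq x y hab
  have h4 := convexComb_inner g x y hab
  simp only [smul_eq_mul]
  set z := a • x + b • y
  obtain rfl : b = 1 - a := by linarith
  have h5 : c / 2 * (a * ‖x - z‖ ^ 2 + (1 - a) * ‖y - z‖ ^ 2) =
      c / 2 * (a * (1 - a) * ‖x - y‖ ^ 2) := by rw [h3]
  linarith

end WeakConvexity

/-! ### The smoothed function `p_ξ`: Danskin's theorem, curvature, and comparison with `p`. -/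

namespace Problem

variable {E : Type u} [NormedAddCommGroup E] [InnerProductSpace ℝ E] [FiniteDimensional ℝ E]
  {F : Type v} [NormedAddCommGroup F] [InnerProductSpace ℝ F]

/-- The maximizer `y_ξ(x)` in the definition of `p_ξ(x)`. -/
def ySmooth (P : Problem E F) (y₀ : F) (ξ : ℝ) (x : E) : F := P.oracle.resPhi ξ x y₀

namespace Assumptions

variable {P : Problem E F} {y₀ : F} {ξ : ℝ} {x x' : E}

theorem continuousOn_Φ_right (hP : P.Assumptions) (hx : x ∈ P.Ω) :
    ContinuousOn (fun y => P.Φ x y) P.Y :=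
  hP.continuousOn_Φ.comp (f := fun y : F => (x, y)) (by fun_prop) fun _ hy => ⟨hx, hy⟩

theorem convexOn_neg_Φ (hP : P.Assumptions) (hx : x ∈ P.Ω) :
    ConvexOn ℝ P.Y fun y => -P.Φ x y := by
  refine (ConvBar.convexOn (hP.neg_Φ_mem x hx) hP.convex_Y).congr fun y hy => ?_
  simp [hy]

/-- The defining property of `y_ξ(x)`, with the growth coming from strong concavity. -/
theorem ySmooth_spec (hP : P.Assumptions) (hξ : 0 < ξ) (hx : x ∈ P.Ω) :
    P.ySmooth y₀ ξ x ∈ P.Y ∧ ∀ y ∈ P.Y,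
      P.Φ x y - 1 / (2 * ξ) * ‖y - y₀‖ ^ 2 + 1 / (2 * ξ) * ‖y - P.ySmooth y₀ ξ x‖ ^ 2 ≤
        P.Φ x (P.ySmooth y₀ ξ x) - 1 / (2 * ξ) * ‖P.ySmooth y₀ ξ x - y₀‖ ^ 2 := by
  have hc : ContinuousOn (fun y : F => ξ * P.Φ x y - 1 / 2 * ‖y - y₀‖ ^ 2) P.Y := by
    have := hP.continuousOn_Φ_right hx
    fun_prop
  obtain ⟨w, hw, hmax⟩ := hP.compact_Y.exists_isMaxOn hP.nonempty_Y hc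
  have h : P.ySmooth y₀ ξ x ∈ P.Y ∧
      IsMaxOn (fun y : F => ξ * P.Φ x y - 1 / 2 * ‖y - y₀‖ ^ 2) P.Y (P.ySmooth y₀ ξ x) :=
    Classical.epsilon_spec (p := fun y' => y' ∈ P.Y ∧
      IsMaxOn (fun y : F => ξ * P.Φ x y - 1 / 2 * ‖y - y₀‖ ^ 2) P.Y y') ⟨w, hw, hmax⟩
  refine ⟨h.1, fun y hy => ?_⟩
  set yx := P.ySmooth y₀ ξ x
  -- The oracle maximizes `ξ` times the objective defining `p_ξ`, so the maximizer is the same;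
  -- undoing the scaling leaves the modulus `1/ξ`.
  have hsc := strongConvexOn_add_quadratic (hP.convexOn_neg_Φ hx) (1 / ξ) 0 0 y₀
  have hscale : ∀ y, -P.Φ x y + inner ℝ (0 : F) y + 1 / ξ / 2 * ‖y - y₀‖ ^ 2 + 0 =
      -((1 / ξ) * (ξ * P.Φ x y - 1 / 2 * ‖y - y₀‖ ^ 2)) := by
    intro y; rw [inner_zero_left]; field_simp; ring
  have h1 := StrongConvexOn.add_sq_le hsc h.1 (fun y' hy' => by
    rw [hscale, hscale]
    have h2 : ξ * P.Φ x y' - 1 / 2 * ‖y' - y₀‖ ^ 2 ≤ ξ * P.Φ x yx - 1 / 2 * ‖yx - y₀‖ ^ 2 :=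
      h.2 hy'
    exact neg_le_neg (mul_le_mul_of_nonneg_left h2 (by positivity))) hy
  simp only [inner_zero_left] at h1
  have h3 : 1 / ξ / 2 = 1 / (2 * ξ) := by field_simp
  rw [h3] at h1
  linarith

theorem ySmooth_mem (hP : P.Assumptions) (hξ : 0 < ξ) (hx : x ∈ P.Ω) : P.ySmooth y₀ ξ x ∈ P.Y :=
  (hP.ySmooth_spec hξ hx).1

theorem isGreatest_pSmooth (hP : P.Assumptions) (hξ : 0 < ξ) (hx : x ∈ P.Ω) :
    IsGreatest ((fun y => P.Φ x y - 1 / (2 * ξ) * ‖y - y₀‖ ^ 2) '' P.Y)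
      (P.Φ x (P.ySmooth y₀ ξ x) - 1 / (2 * ξ) * ‖P.ySmooth y₀ ξ x - y₀‖ ^ 2) := by
  obtain ⟨h1, h2⟩ := hP.ySmooth_spec (y₀ := y₀) hξ hx
  refine ⟨⟨_, h1, rfl⟩, ?_⟩
  rintro _ ⟨y, hy, rfl⟩
  have h3 : 0 ≤ 1 / (2 * ξ) * ‖y - P.ySmooth y₀ ξ x‖ ^ 2 := by positivity
  have := h2 y hy
  simp only
  linarith

theorem pSmooth_eq (hP : P.Assumptions) (hξ : 0 < ξ) (hx : x ∈ P.Ω) : P.pSmooth y₀ ξ x =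
    P.Φ x (P.ySmooth y₀ ξ x) - 1 / (2 * ξ) * ‖P.ySmooth y₀ ξ x - y₀‖ ^ 2 :=
  (hP.isGreatest_pSmooth hξ hx).csSup_eq

theorem le_pSmooth (hP : P.Assumptions) (hξ : 0 < ξ) (hx : x ∈ P.Ω) {y : F} (hy : y ∈ P.Y) :
    P.Φ x y - 1 / (2 * ξ) * ‖y - y₀‖ ^ 2 ≤ P.pSmooth y₀ ξ x := by
  rw [hP.pSmooth_eq hξ hx]
  exact (hP.isGreatest_pSmooth hξ hx).2 ⟨y, hy, rfl⟩

/-- By compactness of `Y`, `Φ x'` tends to `Φ x` uniformly on `Y` as `x' → x`. The quadratic growth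
at the two maximizers bounds `‖y' - y‖²/ξ` by the sum of two such differences. -/
theorem continuousAt_ySmooth (hP : P.Assumptions) (hξ : 0 < ξ) (hx : x ∈ P.Ω) :
    ContinuousAt (P.ySmooth y₀ ξ) x := by
  have hunif : ∀ ε > 0, ∀ᶠ x' in 𝓝 x, ∀ y ∈ P.Y, x' ∈ P.Ω → |P.Φ x' y - P.Φ x y| < ε := by
    intro ε hε
    have key : ∀ᶠ x' in 𝓝 x, ∀ y ∈ P.Y, y ∈ P.Y → x' ∈ P.Ω → |P.Φ x' y - P.Φ x y| < ε := by
      apply hP.compact_Y.eventually_forall_of_forall_eventually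
        (P := fun x' y => y ∈ P.Y → x' ∈ P.Ω → |P.Φ x' y - P.Φ x y| < ε)
      intro y hy
      have hc : ContinuousOn (fun q : E × F => |P.Φ q.1 q.2 - P.Φ x q.2|) (P.Ω ×ˢ P.Y) := by
        apply ContinuousOn.abs
        apply hP.continuousOn_Φ.sub
        exact (hP.continuousOn_Φ_right hx).comp continuousOn_snd fun q hq => hq.2
      have h1 := (hc (x, y) ⟨hx, hy⟩).eventually_lt_const (u := ε) (by simpa using hε)
      filter_upwards [eventually_nhdsWithin_iff.1 h1] with q hq h2 h3
      exact hq ⟨h3, h2⟩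
    filter_upwards [key] with x' h y hy hx'
    exact h y hy hy hx'
  rw [Metric.continuousAt_iff']
  intro ε hε
  filter_upwards [hunif (ε ^ 2 / (2 * ξ)) (by positivity), hP.open_Ω.mem_nhds hx] with x' h hx'
  obtain ⟨hy1, h1⟩ := hP.ySmooth_spec (y₀ := y₀) hξ hx
  obtain ⟨hy2, h2⟩ := hP.ySmooth_spec (y₀ := y₀) hξ hx'
  have h3 := h1 _ hy2
  have h4 := h2 _ hy1
  set y := P.ySmooth y₀ ξ x
  set y' := P.ySmooth y₀ ξ x'
  have h5 := abs_lt.1 (h y hy1 hx')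
  have h6 := abs_lt.1 (h y' hy2 hx')
  rw [norm_sub_rev y y'] at h4
  rw [dist_eq_norm]
  apply lt_of_pow_lt_pow_left₀ 2 hε.le
  have h7 : 1 / (2 * ξ) * ‖y' - y‖ ^ 2 < ε ^ 2 / (2 * ξ) := by linarith
  have h8 : 0 < 1 / (2 * ξ) := by positivity
  have h9 : 1 / (2 * ξ) * ‖y' - y‖ ^ 2 < 1 / (2 * ξ) * ε ^ 2 := by
    calc _ < _ := h7
      _ = _ := by ring
  exact lt_of_mul_lt_mul_left h9 h8.le

/-- Danskin's theorem for the smoothed function. -/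
theorem hasGradientAt_pSmooth (hP : P.Assumptions) (hξ : 0 < ξ) (hx : x ∈ P.Ω) :
    HasGradientAt (P.pSmooth y₀ ξ) (P.gradX x (P.ySmooth y₀ ξ x)) x := by
  rw [hasGradientAt_iff_isLittleO, Asymptotics.isLittleO_iff]
  intro ε hε
  set yx := P.ySmooth y₀ ξ x with hyx
  set g := P.gradX x yx with hg
  have hyY : yx ∈ P.Y := hP.ySmooth_mem hξ hx
  have hev : ∀ᶠ q in 𝓝 (x, yx), q ∈ P.Ω ×ˢ P.Y → ‖P.gradX q.1 q.2 - g‖ < ε := by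
    have hc : ContinuousOn (fun q : E × F => ‖P.gradX q.1 q.2 - g‖) (P.Ω ×ˢ P.Y) :=
      (hP.continuousOn_gradX.sub continuousOn_const).norm
    exact eventually_nhdsWithin_iff.1
      ((hc (x, yx) ⟨hx, hyY⟩).eventually_lt_const (u := ε) (by simpa [hg] using hε))
  rw [nhds_prod_eq, eventually_prod_iff] at hev
  obtain ⟨pa, hpa, pb, hpb, hab⟩ := hev
  obtain ⟨r, hr, hball⟩ := Metric.mem_nhds_iff.1 (inter_mem hpa (hP.open_Ω.mem_nhds hx))
  -- First-order expansion of `Φ(·, y)` with the single slope `g`, uniform over `y` near `y_ξ(x)`;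
  -- the mean value inequality needs `∇ₓΦ` continuous jointly in both variables.
  have hmv : ∀ x' ∈ Metric.ball x r, ∀ y ∈ P.Y, pb y →
      |P.Φ x' y - P.Φ x y - inner ℝ g (x' - x)| ≤ ε * ‖x' - x‖ := by
    intro x' hx' y hy hby
    have := (convex_ball x r).norm_image_sub_le_of_norm_fderiv_le' (𝕜 := ℝ)
      (f := fun x' => P.Φ x' y) (C := ε) (φ := InnerProductSpace.toDual ℝ E g)
      (fun z hz => hP.differentiable_Φ z (hball hz).2 y hy) (fun z hz => by
        have h1 : fderiv ℝ (fun x' => P.Φ x' y) z = InnerProductSpace.toDual ℝ E (P.gradX z y) := by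
          rw [gradX, toDual_gradient]
        rw [h1, ← map_sub, LinearIsometryEquiv.norm_map]
        exact (hab (hball hz).1 hby ⟨(hball hz).2, hy⟩).le)
      (Metric.mem_ball_self hr) hx'
    simpa using this
  have hpb' : ∀ᶠ x' in 𝓝 x, pb (P.ySmooth y₀ ξ x') :=
    (hP.continuousAt_ySmooth hξ hx).eventually hpb
  filter_upwards [Metric.ball_mem_nhds x hr, hpb'] with x' hx' hb
  have hx'Ω := (hball hx').2
  have h1 := abs_le.1 (hmv x' hx' yx hyY hpb.self_of_nhds)
  have h2 := abs_le.1 (hmv x' hx' _ (hP.ySmooth_mem hξ hx'Ω) hb)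
  have h3 := hP.le_pSmooth (y₀ := y₀) hξ hx'Ω hyY
  have h4 := hP.le_pSmooth (y₀ := y₀) hξ hx (hP.ySmooth_mem (y₀ := y₀) hξ hx'Ω)
  have h5 := hP.pSmooth_eq (y₀ := y₀) hξ hx
  have h6 := hP.pSmooth_eq (y₀ := y₀) hξ hx'Ω
  rw [← hyx] at h5
  rw [Real.norm_eq_abs]
  -- The increment of `p_ξ` lies between those of `Φ(·, y_ξ(x))` and `Φ(·, y_ξ(x'))`, and both
  -- maximizers are in the uniform neighbourhood.
  exact abs_le.2 ⟨by linarith, by linarith⟩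

theorem gradient_pSmooth (hP : P.Assumptions) (hξ : 0 < ξ) (hx : x ∈ P.Ω) :
    gradient (P.pSmooth y₀ ξ) x = P.gradX x (P.ySmooth y₀ ξ x) :=
  (hP.hasGradientAt_pSmooth hξ hx).gradient

/-- Freezing the maximizer of the base point `x'` gives a function below `p_ξ`, touching it at `x'`
with the same gradient, and its lower curvature is `m`. -/
theorem pSmooth_lower (hP : P.Assumptions) (hξ : 0 < ξ) (hx : x ∈ P.X) (hx' : x' ∈ P.X) :
    P.pSmooth y₀ ξ x' + inner ℝ (gradient (P.pSmooth y₀ ξ) x') (x - x')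
      - P.m / 2 * ‖x - x'‖ ^ 2 ≤ P.pSmooth y₀ ξ x := by
  have hΩ := hP.X_subset_Ω hx
  have hΩ' := hP.X_subset_Ω hx'
  have hy := hP.ySmooth_mem (y₀ := y₀) hξ hΩ'
  have h1 := hP.le_pSmooth (y₀ := y₀) hξ hΩ hy
  have h2 := hP.lower_curv x hx x' hx' _ hy
  rw [hP.gradient_pSmooth hξ hΩ', hP.pSmooth_eq hξ hΩ']
  linarith

theorem Φ_upper (hP : P.Assumptions) (hx : x ∈ P.X) (hx' : x' ∈ P.X) {y : F} (hy : y ∈ P.Y) :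
    P.Φ x y ≤ P.Φ x' y + inner ℝ (P.gradX x' y) (x - x') + P.Lx / 2 * ‖x - x'‖ ^ 2 :=
  descent_lemma hP.convex_X (f := fun x => P.Φ x y)
    (fun z hz => hP.differentiable_Φ z (hP.X_subset_Ω hz) y hy)
    (fun z hz z' hz' => by
      show ‖P.gradX z y - P.gradX z' y‖ ≤ _
      simpa using hP.lipschitz z hz z' hz' y hy y hy) hx hx'

/-- Adding the growth inequalities at both maximizers cancels the proximal terms and leaves a mixed
second difference of `Φ`. Bounding it by the descent lemma at one `y` and by the lower curvature at
the other gives `t² ≤ ξ L_y d t + ξ (L_x + m) d²`, which is then solved for `t`. -/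
theorem ySmooth_lipschitz (hP : P.Assumptions) (hξ : 0 < ξ) (hx : x ∈ P.X) (hx' : x' ∈ P.X) :
    ‖P.ySmooth y₀ ξ x - P.ySmooth y₀ ξ x'‖ ≤
      (ξ * P.Ly + √(ξ * (P.Lx + P.m))) * ‖x - x'‖ := by
  have hΩ := hP.X_subset_Ω hx
  have hΩ' := hP.X_subset_Ω hx'
  obtain ⟨hy1, h1⟩ := hP.ySmooth_spec (y₀ := y₀) hξ hΩ
  obtain ⟨hy2, h2⟩ := hP.ySmooth_spec (y₀ := y₀) hξ hΩ'
  have h3 := h1 _ hy2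
  have h4 := h2 _ hy1
  set y := P.ySmooth y₀ ξ x
  set y' := P.ySmooth y₀ ξ x'
  rw [norm_sub_rev y' y] at h3
  have h5 := hP.Φ_upper hx hx' hy1
  have h6 := hP.lower_curv x hx x' hx' y' hy2
  have h7 := hP.lipschitz x' hx' x' hx' y hy1 y' hy2
  rw [sub_self, norm_zero, mul_zero, zero_add] at h7
  have h8 := real_inner_le_norm (P.gradX x' y - P.gradX x' y') (x - x')
  rw [inner_sub_left] at h8
  set d := ‖x - x'‖
  set t := ‖y - y'‖
  have hd : 0 ≤ d := norm_nonneg _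
  have h9 := mul_le_mul_of_nonneg_right h7 hd
  have hLm : 0 ≤ P.Lx + P.m := by linarith [hP.Lx_pos, hP.m_pos]
  have h10 : 1 / ξ * t ^ 2 ≤ P.Ly * t * d + (P.Lx + P.m) / 2 * d ^ 2 := by
    have : 1 / ξ * t ^ 2 = 1 / (2 * ξ) * t ^ 2 + 1 / (2 * ξ) * t ^ 2 := by field_simp; norm_num
    rw [this]; linarith
  have h11 : t ^ 2 ≤ ξ * P.Ly * d * t + ξ * (P.Lx + P.m) * d ^ 2 := by
    have h := mul_le_mul_of_nonneg_left h10 hξ.le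
    have e : ξ * (1 / ξ * t ^ 2) = t ^ 2 := by field_simp
    rw [e] at h
    have : 0 ≤ ξ * (P.Lx + P.m) * d ^ 2 := by positivity
    linarith
  set q := √(ξ * (P.Lx + P.m))
  have hq : q ^ 2 = ξ * (P.Lx + P.m) := Real.sq_sqrt (by positivity)
  have hq0 : 0 ≤ q := Real.sqrt_nonneg _
  have hL : 0 ≤ ξ * P.Ly := (mul_pos hξ hP.Ly_pos).le
  by_contra! hlt
  have ha : 0 ≤ ξ * P.Ly * d := by positivity
  have hb : 0 ≤ q * d := by positivity
  have ht : q * d < t - ξ * P.Ly * d := by linarith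
  have h12 : q * d < t := by linarith
  rw [← hq] at h11
  nlinarith [mul_lt_mul'' ht h12 hb hb]

theorem gradient_pSmooth_lipschitz (hP : P.Assumptions) (hξ : 0 < ξ) (hx : x ∈ P.X)
    (hx' : x' ∈ P.X) :
    ‖gradient (P.pSmooth y₀ ξ) x - gradient (P.pSmooth y₀ ξ) x'‖ ≤
      Lxi P.m P.Lx P.Ly ξ * ‖x - x'‖ := by
  have hΩ := hP.X_subset_Ω hx
  have hΩ' := hP.X_subset_Ω hx'
  rw [hP.gradient_pSmooth hξ hΩ, hP.gradient_pSmooth hξ hΩ']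
  have h1 := hP.lipschitz x hx x' hx' _ (hP.ySmooth_mem (y₀ := y₀) hξ hΩ) _
    (hP.ySmooth_mem (y₀ := y₀) hξ hΩ')
  have h2 := mul_le_mul_of_nonneg_left (hP.ySmooth_lipschitz (y₀ := y₀) hξ hx hx') hP.Ly_pos.le
  rw [Lxi]
  linarith

theorem pSmooth_upper (hP : P.Assumptions) (hξ : 0 < ξ) (hx : x ∈ P.X) (hx' : x' ∈ P.X) :
    P.pSmooth y₀ ξ x ≤ P.pSmooth y₀ ξ x' + inner ℝ (gradient (P.pSmooth y₀ ξ) x') (x - x')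
      + Lxi P.m P.Lx P.Ly ξ / 2 * ‖x - x'‖ ^ 2 :=
  descent_lemma hP.convex_X
    (fun _ hz => (hP.hasGradientAt_pSmooth hξ (hP.X_subset_Ω hz)).differentiableAt)
    (fun _ hz _ hz' => hP.gradient_pSmooth_lipschitz hξ hz hz') hx hx'

theorem exists_isGreatest_p (hP : P.Assumptions) (hx : x ∈ P.Ω) :
    ∃ y ∈ P.Y, P.p x = P.Φ x y ∧ ∀ y' ∈ P.Y, P.Φ x y' ≤ P.p x := by
  obtain ⟨y, hy, hmax⟩ := hP.compact_Y.exists_isMaxOn hP.nonempty_Y (hP.continuousOn_Φ_right hx)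
  have hg : IsGreatest ((fun y => P.Φ x y) '' P.Y) (P.Φ x y) := by
    refine ⟨⟨y, hy, rfl⟩, ?_⟩
    rintro _ ⟨y', hy', rfl⟩
    exact hmax hy'
  have he : P.p x = P.Φ x y := hg.csSup_eq
  refine ⟨y, hy, he, fun y' hy' => ?_⟩
  rw [he]
  exact hmax hy'

theorem pSmooth_le_p (hP : P.Assumptions) (hξ : 0 < ξ) (hx : x ∈ P.Ω) :
    P.pSmooth y₀ ξ x ≤ P.p x := by
  obtain ⟨-, -, -, h⟩ := hP.exists_isGreatest_p hx
  rw [hP.pSmooth_eq hξ hx]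
  have h1 := h _ (hP.ySmooth_mem (y₀ := y₀) hξ hx)
  have h2 : 0 ≤ 1 / (2 * ξ) * ‖P.ySmooth y₀ ξ x - y₀‖ ^ 2 := by positivity
  linarith

theorem p_le_pSmooth_add (hP : P.Assumptions) (hξ : 0 < ξ) (hy₀ : y₀ ∈ P.Y) (hx : x ∈ P.Ω) :
    P.p x ≤ P.pSmooth y₀ ξ x + P.Dy ^ 2 / (2 * ξ) := by
  obtain ⟨y, hy, he, -⟩ := hP.exists_isGreatest_p hx
  have h1 := hP.le_pSmooth (y₀ := y₀) hξ hx hy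
  have h2 : ‖y - y₀‖ ≤ P.Dy := by
    rw [← dist_eq_norm]
    exact Metric.dist_le_diam_of_mem hP.compact_Y.isBounded hy hy₀
  have h3 : 1 / (2 * ξ) * ‖y - y₀‖ ^ 2 ≤ 1 / (2 * ξ) * P.Dy ^ 2 := by gcongr
  have h4 : P.Dy ^ 2 / (2 * ξ) = 1 / (2 * ξ) * P.Dy ^ 2 := by ring
  rw [he, h4]
  linarith

theorem lowerSemicontinuousOn_p (hP : P.Assumptions) : LowerSemicontinuousOn P.p P.X := by
  intro x hx c hc
  have hΩ := hP.X_subset_Ω hx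
  obtain ⟨y, hy, he, -⟩ := hP.exists_isGreatest_p hΩ
  have hcont : ContinuousAt (fun x' => P.Φ x' y) x := (hP.differentiable_Φ x hΩ y hy).continuousAt
  have hc' : c < P.Φ x y := he ▸ hc
  apply eventually_nhdsWithin_of_eventually_nhds
  filter_upwards [hcont.eventually_const_lt hc', hP.open_Ω.mem_nhds hΩ] with x' h hx'
  obtain ⟨-, -, -, h2⟩ := hP.exists_isGreatest_p hx'
  exact h.trans_le (h2 y hy)

/-- Any maximizer `y` at `x` provides the slope `∇ₓΦ(x, y)`: `p` dominates `Φ(·, y)` and agrees with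
it at `x`. -/
theorem p_support (hP : P.Assumptions) (hx : x ∈ P.X) :
    ∃ g : E, ∀ x' ∈ P.X, P.p x + inner ℝ g (x' - x) + -P.m / 2 * ‖x' - x‖ ^ 2 ≤ P.p x' := by
  obtain ⟨y, hy, he, -⟩ := hP.exists_isGreatest_p (hP.X_subset_Ω hx)
  refine ⟨P.gradX x y, fun x' hx' => ?_⟩
  obtain ⟨-, -, -, h2⟩ := hP.exists_isGreatest_p (hP.X_subset_Ω hx')
  have h3 := hP.lower_curv x' hx' x hx y hy
  have h4 := h2 y hy
  rw [he]
  linarith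

theorem strongConvexOn_p (hP : P.Assumptions) : StrongConvexOn P.X (-P.m) P.p :=
  strongConvexOn_of_support hP.convex_X fun _ hz => hP.p_support hz

end Assumptions

end Problem

/-! ### One outer iteration of AIPP, and the final composite gradient step. -/

section AIPPAnalysis

variable {E : Type u} [NormedAddCommGroup E] [InnerProductSpace ℝ E] [FiniteDimensional ℝ E]

/-- Hypotheses under which the AIPP method is analysed. -/
structure AIPPData (X : Set E) (f : E → ℝ) (h : E → EReal) (M lam : ℝ) : Prop where
  h_mem : h ∈ ConvBar X
  convex_X : Convex ℝ X
  lam_pos : 0 < lam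
  M_pos : 0 < M
  differentiable : ∀ x ∈ X, DifferentiableAt ℝ f x
  lower : ∀ x ∈ X, ∀ x' ∈ X,
    f x' + inner ℝ (gradient f x') (x - x') - 1 / (8 * lam) * ‖x - x'‖ ^ 2 ≤ f x
  upper : ∀ x ∈ X, ∀ x' ∈ X,
    f x ≤ f x' + inner ℝ (gradient f x') (x - x') + M / 2 * ‖x - x'‖ ^ 2
  lipschitz : ∀ x ∈ X, ∀ x' ∈ X, ‖gradient f x - gradient f x'‖ ≤ M * ‖x - x'‖

/-- The objective of a proximal subproblem, on the domain of `h`. -/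
def proxObj (f : E → ℝ) (h : E → EReal) (lam : ℝ) (xp x : E) : ℝ :=
  lam * (f x + (h x).toReal) + 1 / 2 * ‖x - xp‖ ^ 2

variable {X : Set E} {f : E → ℝ} {h : E → EReal} {M lam ρ : ℝ} {xp x : E}

theorem hasGradientAt_add_sq {f : E → ℝ} {x : E} (hf : DifferentiableAt ℝ f x) (lam : ℝ) (xp : E) :
    HasGradientAt (fun x => lam * f x + 1 / 4 * ‖x - xp‖ ^ 2)
      (lam • gradient f x + (1 / 2 : ℝ) • (x - xp)) x := by
  rw [hasGradientAt_iff_hasFDerivAt]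
  have h1 := hf.hasGradientAt.hasFDerivAt.const_mul lam
  have h2 := (((hasFDerivAt_id x).sub_const xp).norm_sq).const_mul (1 / 4)
  refine (h1.add h2).congr_fderiv ?_
  ext v
  simp
  ring

theorem sq_norm_sub_expand (x x' a : E) :
    ‖x - a‖ ^ 2 = ‖x' - a‖ ^ 2 + 2 * inner ℝ (x' - a) (x - x') + ‖x - x'‖ ^ 2 := by
  have : x - a = (x' - a) + (x - x') := by abel
  rw [this, norm_add_sq_real]

/-- A number of ACG iterations that suffices for an outer iteration, including refinement. -/
def refineIter (M lam : ℝ) : ℕ :=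
  minIter M lam + ⌈2 * √(2 * lam * M + 1) * Real.log (lam * M + 1)⌉₊

namespace AIPPData

theorem coe_eq (hd : AIPPData X f h M lam) (hx : x ∈ X) (c : ℝ) :
    (lam : EReal) * h x + (c : EReal) = ((lam * (h x).toReal + c : ℝ) : EReal) := by
  rw [ConvBar.eq_coe hd.h_mem hx, ← EReal.coe_mul, ← EReal.coe_add]
  rfl

theorem top_eq (hd : AIPPData X f h M lam) (hx : x ∉ X) (c : ℝ) :
    (lam : EReal) * h x + (c : EReal) = ⊤ := by
  rw [ConvBar.eq_top hd.h_mem hx, EReal.coe_mul_top_of_pos hd.lam_pos, EReal.top_add_coe]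

/-- The linear term and the coefficient `c` are left free, so that the same statement serves the ACG
subproblems and the final composite gradient step. -/
theorem exists_min (hd : AIPPData X f h M lam) (hxp : xp ∈ X) (s : E) {c : ℝ} (hc : 0 < c) :
    ∃ w ∈ X, ∀ x ∈ X, lam * (h w).toReal + inner ℝ s w + c / 2 * ‖w - xp‖ ^ 2 ≤
      lam * (h x).toReal + inner ℝ s x + c / 2 * ‖x - xp‖ ^ 2 := by
  have hl := hd.lam_pos
  have hcont : Continuous fun x : E => 1 / lam * (inner ℝ s x + c / 2 * ‖x - xp‖ ^ 2) := by
    fun_prop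
  obtain ⟨w, hw, hmin⟩ := ConvBar.exists_min hd.h_mem hd.convex_X hxp
    (g := fun x => 1 / lam * (inner ℝ s x + c / 2 * ‖x - xp‖ ^ 2))
    (a := 1 / lam * inner ℝ s xp) (b := 1 / lam * ‖s‖) (κ := 1 / lam * (c / 2))
    (hcont.lowerSemicontinuous.lowerSemicontinuousOn _) (by positivity) (fun x _ => by
      have h1 : inner ℝ s x = inner ℝ s xp + inner ℝ s (x - xp) := by
        rw [← inner_add_right]; congr 1; abel
      have h2 := (abs_le.1 (abs_real_inner_le_norm s (x - xp))).1
      have h3 : inner ℝ s xp - ‖s‖ * ‖x - xp‖ + c / 2 * ‖x - xp‖ ^ 2 ≤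
        inner ℝ s x + c / 2 * ‖x - xp‖ ^ 2 := by rw [h1]; linarith
      have h4 := mul_le_mul_of_nonneg_left h3 (by positivity : 0 ≤ 1 / lam)
      linarith)
  refine ⟨w, hw, fun x hx => ?_⟩
  have h1 := mul_le_mul_of_nonneg_left (hmin x hx) hl.le
  have e : ∀ x, lam * (1 / lam * (inner ℝ s x + c / 2 * ‖x - xp‖ ^ 2) + (h x).toReal) =
      lam * (h x).toReal + inner ℝ s x + c / 2 * ‖x - xp‖ ^ 2 := by
    intro x; field_simp; ring
  rwa [e, e] at h1

/-- Half of the proximal term goes into each of `ψs` and `ψn`. In `ψs` the quarter square absorbs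
the concavity of `λf`, which is at most an eighth of a square, and raises the smoothness constant to
`λM + 1/2`; in `ψn` it supplies `μ = 1/2`. -/
theorem acgData (hd : AIPPData X f h M lam) (hxp : xp ∈ X) :
    ACGData X (fun x => lam * f x + 1 / 4 * ‖x - xp‖ ^ 2)
      (fun x => (lam : EReal) * h x + ((1 / 4 * ‖x - xp‖ ^ 2 : ℝ) : EReal))
      (fun x => lam * (h x).toReal) (1 / 2) (lam * M + 1 / 2) xp where
  z₀_mem := hxp
  μ_nonneg := by norm_num
  L_pos := by have := mul_pos hd.lam_pos hd.M_pos; linarith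
  convex_H := (ConvBar.convexOn hd.h_mem hd.convex_X).smul hd.lam_pos.le
  ψn_coe x hx := by
    rw [hd.coe_eq hx]; norm_num
  ψn_top x hx := hd.top_eq hx _
  exists_min s c hc := hd.exists_min hxp s hc
  lower x hx x' hx' := by
    rw [(hasGradientAt_add_sq (hd.differentiable x' hx') lam xp).gradient, inner_add_left,
      inner_smul_left, inner_smul_left, sq_norm_sub_expand x x' xp]
    have h1 := mul_le_mul_of_nonneg_left (hd.lower x hx x' hx') hd.lam_pos.le
    have hl := hd.lam_pos
    have e : lam * (1 / (8 * lam) * ‖x - x'‖ ^ 2) = 1 / 8 * ‖x - x'‖ ^ 2 := by field_simp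
    simp only [conj_trivial]
    nlinarith [sq_nonneg ‖x - x'‖]
  upper x hx x' hx' := by
    rw [(hasGradientAt_add_sq (hd.differentiable x' hx') lam xp).gradient, inner_add_left,
      inner_smul_left, inner_smul_left, sq_norm_sub_expand x x' xp]
    have h1 := mul_le_mul_of_nonneg_left (hd.upper x hx x' hx') hd.lam_pos.le
    simp only [conj_trivial]
    linarith

/-- What the analysis of the outer iterations uses about an ACG iterate. -/
structure ProxIterate (X : Set E) (f : E → ℝ) (h : E → EReal) (lam : ℝ) (xp : E)
    (s : ACGIterate E) : Prop where
  A_pos : 0 < s.A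
  y_mem : s.y ∈ X
  z_mem : s.z ∈ X
  u_eq : s.u = (1 / s.A) • (xp - s.y)
  ε_nonneg : 0 ≤ s.ε
  ε_le : 2 * s.A * s.ε ≤ ‖s.z - xp‖ ^ 2
  subgradient : ∀ x ∈ X, proxObj f h lam xp s.z + (inner ℝ s.u (x - s.z) - s.ε) ≤
    proxObj f h lam xp x
  value_le : ∀ x ∈ X, s.A * proxObj f h lam xp s.z + (1 + 1 / 2 * s.A) / 2 * ‖x - s.y‖ ^ 2 ≤
    s.A * proxObj f h lam xp x + 1 / 2 * ‖x - xp‖ ^ 2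

theorem proxIterate (hd : AIPPData X f h M lam) (hxp : xp ∈ X) {j : ℕ} (hj : 1 ≤ j) :
    ProxIterate X f h lam xp (aippACG f h M lam xp j) := by
  have ha := hd.acgData hxp
  have e : ∀ x, lam * f x + 1 / 4 * ‖x - xp‖ ^ 2 +
      (lam * (h x).toReal + 1 / 2 / 2 * ‖x - xp‖ ^ 2) = proxObj f h lam xp x := by
    intro x; rw [proxObj]; ring
  refine ⟨ha.A_pos' hj, (ha.inv_seq j).y_mem, (ha.inv_seq j).z_mem, acgSeq_u hj,
    ha.ε_nonneg hj, ha.ε_le hj, fun x hx => ?_, fun x hx => ?_⟩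
  · have := ha.subgradient hj hx
    rwa [e, e] at this
  · have := ha.value_le j hx
    rwa [e, e] at this

theorem minIter_pos (hd : AIPPData X f h M lam) : 1 ≤ minIter M lam := by
  rw [minIter, Nat.one_le_ceil_iff]
  have := mul_pos hd.lam_pos hd.M_pos
  have : 0 < √(2 * lam * M + 1) := Real.sqrt_pos.2 (by linarith)
  linarith

/-- From `j² ≤ 4LA` with `4L = 2(2λM + 1)` and `j² ≥ 36(2λM + 1)`; this is what the factor 6 in the
minimal iteration count provides. -/
theorem eighteen_le_A (hd : AIPPData X f h M lam) (hxp : xp ∈ X) {j : ℕ}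
    (hj : minIter M lam ≤ j) : 18 ≤ (aippACG f h M lam xp j).A := by
  have h1 := (hd.acgData hxp).sq_le_A j
  change (j : ℝ) ^ 2 ≤ 4 * (lam * M + 1 / 2) * (aippACG f h M lam xp j).A at h1
  have hp := mul_pos hd.lam_pos hd.M_pos
  have h2 : 6 * √(2 * lam * M + 1) ≤ j := by
    calc _ ≤ ((minIter M lam : ℕ) : ℝ) := Nat.le_ceil _
      _ ≤ j := by exact_mod_cast hj
  have h3 : (6 * √(2 * lam * M + 1)) ^ 2 ≤ (j : ℝ) ^ 2 := pow_le_pow_left₀ (by positivity) h2 2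
  rw [mul_pow, Real.sq_sqrt (by linarith)] at h3
  by_contra! hlt
  nlinarith

end AIPPData

namespace AIPPData.ProxIterate

variable {s t : ACGIterate E}

/-- The optimality estimate tested at `x = z` itself: the values cancel and `(1 + A/2)‖z - y‖² ≤ ‖z
- xp‖²`, where `1 + A/2 ≥ 10`. -/
theorem norm_z_sub_y_le (hs : ProxIterate X f h lam xp s) (hA : 18 ≤ s.A) :
    ‖s.z - s.y‖ ≤ 1 / 3 * ‖s.z - xp‖ := by
  have h1 := hs.value_le _ hs.z_mem
  apply le_of_sq_le_sq _ (by positivity)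
  nlinarith [sq_nonneg ‖s.z - s.y‖, sq_nonneg ‖s.z - xp‖]

theorem norm_u_le (hs : ProxIterate X f h lam xp s) (hA : 18 ≤ s.A) :
    ‖s.u‖ ≤ 2 / 27 * ‖s.z - xp‖ := by
  have h1 := hs.norm_z_sub_y_le hA
  have h2 : ‖xp - s.y‖ ≤ ‖s.z - xp‖ + ‖s.z - s.y‖ := by
    have : xp - s.y = -(s.z - xp) + (s.z - s.y) := by abel
    rw [this]
    exact (norm_add_le _ _).trans (by rw [norm_neg])
  have hA0 := hs.A_pos
  rw [hs.u_eq, norm_smul, Real.norm_of_nonneg (by positivity)]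
  have h3 : 1 / s.A ≤ 1 / 18 := one_div_le_one_div_of_le (by norm_num) hA
  calc _ ≤ 1 / 18 * (4 / 3 * ‖s.z - xp‖) :=
        mul_le_mul h3 (by linarith) (norm_nonneg _) (by norm_num)
    _ = _ := by ring

theorem le_residual (hs : ProxIterate X f h lam xp s) (hA : 18 ≤ s.A) :
    25 / 27 * ‖s.z - xp‖ ≤ ‖xp - s.z + s.u‖ := by
  have h1 := hs.norm_u_le hA
  have h2 : ‖s.z - xp‖ ≤ ‖xp - s.z + s.u‖ + ‖s.u‖ := by
    have : s.z - xp = -(xp - s.z + s.u) + s.u := by abel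
    rw [this]
    exact (norm_add_le _ _).trans (by rw [norm_neg])
  linarith

theorem residual_le (hs : ProxIterate X f h lam xp s) (hA : 18 ≤ s.A) :
    ‖xp - s.z + s.u‖ ≤ 29 / 27 * ‖s.z - xp‖ := by
  have h1 := hs.norm_u_le hA
  have h2 := norm_add_le (xp - s.z) s.u
  rw [norm_sub_rev xp s.z] at h2
  linarith

/-- In units of `‖z - xp‖²`, the left side is at most `(2/27)² + 1/18` and the right side at least
`(25/27)²/2`. -/
theorem criterion (hs : ProxIterate X f h lam xp s) (hA : 18 ≤ s.A) :
    ‖s.u‖ ^ 2 + 2 * s.ε ≤ 1 / 2 * ‖xp - s.z + s.u‖ ^ 2 := by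
  have h1 := pow_le_pow_left₀ (norm_nonneg _) (hs.norm_u_le hA) 2
  have h2 := pow_le_pow_left₀ (by positivity) (hs.le_residual hA) 2
  have h3 := hs.ε_le
  have h4 : 36 * s.ε ≤ ‖s.z - xp‖ ^ 2 := by nlinarith [hs.ε_nonneg]
  nlinarith [sq_nonneg ‖s.z - xp‖]

theorem inexactProx (hd : AIPPData X f h M lam) (hs : ProxIterate X f h lam xp s)
    (hA : 18 ≤ s.A) : InexactProx f h lam (1 / 2) xp s.z s.u s.ε := by
  refine ⟨hs.ε_nonneg, fun x => ?_, hs.criterion hA⟩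
  have e : ∀ x ∈ X, (lam : EReal) * ((f x : EReal) + h x) +
      ((1 / 2 * ‖x - xp‖ ^ 2 : ℝ) : EReal) = (proxObj f h lam xp x : EReal) := by
    intro x hx
    rw [ConvBar.eq_coe hd.h_mem hx, ← EReal.coe_add, ← EReal.coe_mul, ← EReal.coe_add]
    rfl
  simp only
  rw [e _ hs.z_mem]
  by_cases hx : x ∈ X
  · rw [e x hx, ← EReal.coe_add]
    exact EReal.coe_le_coe_iff.2 (hs.subgradient x hx)
  · rw [ConvBar.eq_top hd.h_mem hx, EReal.coe_add_top, EReal.coe_mul_top_of_pos hd.lam_pos,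
      EReal.top_add_coe]
    exact le_top

/-- Two sufficiently late ACG iterates have comparable distances to the prox-centre. -/
theorem norm_z_sub_le (hs : ProxIterate X f h lam xp s) (hA : 18 ≤ s.A)
    (ht : ProxIterate X f h lam xp t) (hA' : 18 ≤ t.A) :
    ‖t.z - xp‖ ≤ 5 / 2 * ‖s.z - xp‖ := by
  have h1 := hs.value_le _ ht.z_mem
  have h2 := ht.value_le _ hs.z_mem
  have h3 := hs.norm_z_sub_y_le hA
  set D := ‖s.z - xp‖
  set D' := ‖t.z - xp‖
  have hD : 0 ≤ D := norm_nonneg _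
  have hD' : 0 ≤ D' := norm_nonneg _
  -- Each iterate is tested against the other's optimality estimate, divided by `A ≥ 18`. Adding
  -- `h5` and `h6` eliminates the objective values.
  have h5 : proxObj f h lam xp s.z + 1 / 4 * ‖t.z - s.y‖ ^ 2 ≤
      proxObj f h lam xp t.z + 1 / 36 * D' ^ 2 := by
    by_contra! hlt
    have := mul_lt_mul_of_pos_left hlt hs.A_pos
    nlinarith [sq_nonneg ‖t.z - s.y‖, sq_nonneg D']
  have h6 : proxObj f h lam xp t.z ≤ proxObj f h lam xp s.z + 1 / 36 * D ^ 2 := by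
    by_contra! hlt
    have := mul_lt_mul_of_pos_left hlt ht.A_pos
    have h7 : 0 ≤ (1 + 1 / 2 * t.A) / 2 * ‖s.z - t.y‖ ^ 2 := by
      have := ht.A_pos; positivity
    nlinarith [sq_nonneg D]
  have h7 : ‖t.z - s.y‖ ^ 2 ≤ (1 / 3 * (D + D')) ^ 2 := by nlinarith
  have h8 : ‖t.z - s.y‖ ≤ 1 / 3 * (D + D') := le_of_sq_le_sq h7 (by positivity)
  have h9 : D' ≤ ‖t.z - s.y‖ + ‖s.z - s.y‖ + D := by
    have : t.z - xp = (t.z - s.y) + -(s.z - s.y) + (s.z - xp) := by abel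
    calc D' = ‖(t.z - s.y) + -(s.z - s.y) + (s.z - xp)‖ := by rw [← this]
      _ ≤ ‖(t.z - s.y) + -(s.z - s.y)‖ + D := norm_add_le _ _
      _ ≤ _ := by
        have := norm_add_le (t.z - s.y) (-(s.z - s.y))
        rw [norm_neg] at this
        linarith
  linarith

/-- Testing the `ε`-subgradient inequality at `xp` and completing the square gives a decrease of
half the squared residual, up to `‖u‖²/2 + ε`; the criterion bounds that by a quarter of the squared
residual. -/
theorem descent (hs : ProxIterate X f h lam xp s) (hA : 18 ≤ s.A) (hxp : xp ∈ X) :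
    lam * (f s.z + (h s.z).toReal) + 1 / 4 * ‖xp - s.z + s.u‖ ^ 2 ≤
      lam * (f xp + (h xp).toReal) := by
  have h1 := hs.subgradient xp hxp
  have h2 := hs.criterion hA
  simp only [proxObj, sub_self, norm_zero] at h1
  have h3 : ‖xp - s.z + s.u‖ ^ 2 = ‖s.z - xp‖ ^ 2 + 2 * inner ℝ s.u (xp - s.z) + ‖s.u‖ ^ 2 := by
    rw [norm_add_sq_real, norm_sub_rev xp s.z, real_inner_comm]
  nlinarith

theorem value_le_of_mem (hs : ProxIterate X f h lam xp s) (hA : 18 ≤ s.A) (hx : x ∈ X) :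
    lam * (f s.z + (h s.z).toReal) ≤
      lam * (f x + (h x).toReal) + 19 / 36 * ‖x - xp‖ ^ 2 := by
  have h1 := hs.value_le x hx
  have h5 : proxObj f h lam xp s.z ≤ proxObj f h lam xp x + 1 / 36 * ‖x - xp‖ ^ 2 := by
    by_contra! hlt
    have := mul_lt_mul_of_pos_left hlt hs.A_pos
    have h7 : 0 ≤ (1 + 1 / 2 * s.A) / 2 * ‖x - s.y‖ ^ 2 := by
      have := hs.A_pos; positivity
    nlinarith [sq_nonneg ‖x - xp‖]
  simp only [proxObj] at h5
  nlinarith [sq_nonneg ‖s.z - xp‖]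

end AIPPData.ProxIterate

namespace AIPPData

/-- The criterion already holds at the minimal index, so the first stopping time of every ACG call
is known exactly. -/
theorem isLeast_minIter (hd : AIPPData X f h M lam) (hxp : xp ∈ X) :
    IsLeast {j : ℕ | minIter M lam ≤ j ∧
      InexactProx f h lam (1 / 2) xp (aippACG f h M lam xp j).z (aippACG f h M lam xp j).u
        (aippACG f h M lam xp j).ε} (minIter M lam) :=
  ⟨⟨le_rfl, (hd.proxIterate hxp hd.minIter_pos).inexactProx hd (hd.eighteen_le_A hxp le_rfl)⟩,
    fun _ hj => hj.1⟩

theorem le_A_refineIter (hd : AIPPData X f h M lam) (hxp : xp ∈ X) :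
    lam * M + 1 ≤ (aippACG f h M lam xp (refineIter M lam)).A := by
  have hp := mul_pos hd.lam_pos hd.M_pos
  set s := √(2 * lam * M + 1) with hs
  have hs2 : s ^ 2 = 2 * lam * M + 1 := Real.sq_sqrt (by linarith)
  have hs1 : 1 ≤ s := by
    rw [hs, Real.one_le_sqrt]; linarith
  have hs0 : 0 < s := by linarith
  -- The rate `r = 1/s` is the largest allowed: `L r² = (λM + 1/2)/(2λM + 1) = 1/2 = μ`.
  have hgrow := (hd.acgData hxp).geometric_le_A (r := 1 / s) (by positivity) (by
    rw [div_pow, one_pow, hs2]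
    have : 2 * lam * M + 1 ≠ 0 := by linarith
    field_simp
    linarith) (minIter M lam) ⌈2 * s * Real.log (lam * M + 1)⌉₊
  have hA := hd.eighteen_le_A hxp le_rfl
  change _ * (aippACG f h M lam xp (minIter M lam)).A ≤
    (aippACG f h M lam xp (refineIter M lam)).A at hgrow
  set n := ⌈2 * s * Real.log (lam * M + 1)⌉₊
  have hn : 2 * s * Real.log (lam * M + 1) ≤ n := Nat.le_ceil _
  have hpow : lam * M + 1 ≤ (1 + 1 / s) ^ n := by
    have hr : 0 < 1 + 1 / s := by positivity
    rw [← Real.log_le_log_iff (by linarith) (by positivity), Real.log_pow]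
    -- `log(1 + 1/s) ≥ 1/(s + 1) ≥ 1/(2s)` because `s ≥ 1`; hence the factor 2 in the number of
    -- refinement iterations.
    have h1 : 1 / (2 * s) ≤ Real.log (1 + 1 / s) := by
      have h2 := Real.one_sub_inv_le_log_of_pos hr
      have h3 : 1 - (1 + 1 / s)⁻¹ = 1 / (s + 1) := by field_simp; ring
      rw [h3] at h2
      exact (one_div_le_one_div_of_le (by linarith) (by linarith)).trans h2
    have h4 : Real.log (lam * M + 1) = 2 * s * Real.log (lam * M + 1) * (1 / (2 * s)) := by
      field_simp
    rw [h4]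
    exact mul_le_mul hn h1 (by positivity) (by positivity)
  nlinarith [pow_pos (by positivity : 0 < 1 + 1 / s) n]

/-- The residual at the first stop controls all later iterates of the same call: `27/200 =
(1/20)(27/25)(5/2)`, and then `(29/27)(27/200) ≤ 3/16`. -/
theorem residual_small (hd : AIPPData X f h M lam) (hxp : xp ∈ X)
    (hres : ‖xp - (aippACG f h M lam xp (minIter M lam)).z +
      (aippACG f h M lam xp (minIter M lam)).u‖ ≤ lam * (ρ / 4) / 5)
    {i : ℕ} (hi : minIter M lam ≤ i) :
    ‖(aippACG f h M lam xp i).z - xp‖ ≤ 27 / 200 * (lam * ρ) ∧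
    ‖xp - (aippACG f h M lam xp i).z + (aippACG f h M lam xp i).u‖ ≤ 3 / 16 * (lam * ρ) := by
  have hA := hd.eighteen_le_A hxp (le_refl (minIter M lam))
  have hA' := hd.eighteen_le_A hxp hi
  have hs := hd.proxIterate hxp hd.minIter_pos
  have ht := hd.proxIterate hxp (hd.minIter_pos.trans hi)
  have h1 := hs.norm_z_sub_le hA ht hA'
  have h2 := hs.le_residual hA
  have h3 := ht.residual_le hA'
  have h4 := norm_nonneg ((aippACG f h M lam xp i).z - xp)
  constructor <;> linarith

theorem refineIter_mem (hd : AIPPData X f h M lam) (hxp : xp ∈ X)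
    (hres : ‖xp - (aippACG f h M lam xp (minIter M lam)).z +
      (aippACG f h M lam xp (minIter M lam)).u‖ ≤ lam * (ρ / 4) / 5) :
    refineIter M lam ∈ {i : ℕ | minIter M lam ≤ i ∧
      InexactProx f h lam (1 / 2) xp (aippACG f h M lam xp i).z (aippACG f h M lam xp i).u
        (aippACG f h M lam xp i).ε ∧
      (aippACG f h M lam xp i).ε ≤ ρ ^ 2 / (32 * (M + 1 / lam)) * lam} := by
  have hi : minIter M lam ≤ refineIter M lam := Nat.le_add_right _ _
  have ht := hd.proxIterate hxp (hd.minIter_pos.trans hi)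
  refine ⟨hi, ht.inexactProx hd (hd.eighteen_le_A hxp hi), ?_⟩
  have h1 := (hd.residual_small hxp hres hi).1
  have h2 := ht.ε_le
  have h3 := hd.le_A_refineIter hxp
  have h0 := ht.ε_nonneg
  set s := aippACG f h M lam xp (refineIter M lam)
  have hl := hd.lam_pos
  have hM := hd.M_pos
  have h4 := pow_le_pow_left₀ (norm_nonneg _) h1 2
  have e : ρ ^ 2 / (32 * (M + 1 / lam)) * lam = (lam * ρ) ^ 2 / (32 * (lam * M + 1)) := by
    field_simp
  rw [e, le_div_iff₀ (by positivity)]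
  nlinarith [sq_nonneg (lam * ρ)]

/-- The composite gradient step at a point `z`. -/
theorem output_spec (hd : AIPPData X f h M lam) {z : E} (hz : z ∈ X) :
    (aippOutput f h M lam z).1 ∈ X ∧ ∀ x ∈ X,
      (h (aippOutput f h M lam z).1).toReal
        + inner ℝ (gradient f z) ((aippOutput f h M lam z).1 - z)
        + (M + 1 / lam) / 2 * ‖(aippOutput f h M lam z).1 - z‖ ^ 2
        + (M + 1 / lam) / 2 * ‖x - (aippOutput f h M lam z).1‖ ^ 2 ≤
      (h x).toReal + inner ℝ (gradient f z) (x - z) + (M + 1 / lam) / 2 * ‖x - z‖ ^ 2 := by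
  have hl := hd.lam_pos
  have hM := hd.M_pos
  set c := M + 1 / lam with hc
  have hc0 : 0 < c := by positivity
  set g := gradient f z with hg
  have hx : (aippOutput f h M lam z).1 = argminOn Set.univ fun x' : E =>
    ((inner ℝ g (x' - z) : ℝ) : EReal) + h x' + ((c / 2 * ‖x' - z‖ ^ 2 : ℝ) : EReal) := rfl
  set xb := (aippOutput f h M lam z).1
  set G : E → ℝ := fun x => (h x).toReal + inner ℝ g x + c / 2 * ‖x - z‖ ^ 2 + -inner ℝ g z with hG
  have hsc : StrongConvexOn X c G :=
    strongConvexOn_add_quadratic (ConvBar.convexOn hd.h_mem hd.convex_X) c _ g z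
  have hGe : ∀ x, G x = (h x).toReal + inner ℝ g (x - z) + c / 2 * ‖x - z‖ ^ 2 := by
    intro x; rw [hG, inner_sub_right]; ring
  obtain ⟨w, hw, hm⟩ := hd.exists_min hz (lam • g) (mul_pos hl hc0)
  obtain ⟨hxb, hmin⟩ := argminOn_univ_spec (X := X) (G := G)
    (F := fun x' : E =>
      ((inner ℝ g (x' - z) : ℝ) : EReal) + h x' + ((c / 2 * ‖x' - z‖ ^ 2 : ℝ) : EReal))
    (fun x hx => by
      rw [ConvBar.eq_coe hd.h_mem hx, ← EReal.coe_add, ← EReal.coe_add, hGe]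
      congr 1; simp; ring)
    (fun x hx => by
      rw [ConvBar.eq_top hd.h_mem hx, EReal.coe_add_top, EReal.top_add_coe])
    ⟨w, hw, fun x hx => by
      have h1 := hm x hx
      rw [inner_smul_left, inner_smul_left] at h1
      simp only [conj_trivial] at h1
      have h2 : lam * G w ≤ lam * G x := by simp only [hG]; linarith
      exact le_of_mul_le_mul_left h2 hl⟩
  rw [← hx] at hxb hmin
  refine ⟨hxb, fun x hx => ?_⟩
  have h1 := StrongConvexOn.add_sq_le hsc hxb hmin hx
  rwa [hGe, hGe] at h1

/-- The growth term of the composite step cancels the second-order part of `‖x - z‖²` expanded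
around the new point, leaving a genuine subgradient inequality for `h`. -/
theorem output_subgradient (hd : AIPPData X f h M lam) {z : E} (hz : z ∈ X) (hx : x ∈ X) :
    (h (aippOutput f h M lam z).1).toReal
      + inner ℝ ((aippOutput f h M lam z).2 - gradient f (aippOutput f h M lam z).1)
        (x - (aippOutput f h M lam z).1) ≤ (h x).toReal := by
  have h1 := (hd.output_spec hz).2 x hx
  have hu : (aippOutput f h M lam z).2 = (M + 1 / lam) • (z - (aippOutput f h M lam z).1)
    + gradient f (aippOutput f h M lam z).1 - gradient f z := rfl
  rw [hu]
  set xb := (aippOutput f h M lam z).1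
  set c := M + 1 / lam
  have e1 : c • (z - xb) + gradient f xb - gradient f z - gradient f xb =
    -(c • (xb - z)) - gradient f z := by module
  have e2 : inner ℝ (gradient f z) (x - z) =
      inner ℝ (gradient f z) (x - xb) + inner ℝ (gradient f z) (xb - z) := by
    rw [← inner_add_right]; congr 1; abel
  rw [sq_norm_sub_expand x xb z, e2] at h1
  rw [e1, inner_sub_left, inner_neg_left, inner_smul_left]
  simp only [conj_trivial]
  linarith

/-- The composite step decreases a quadratic upper model of `f + h`, whereas the `ε`-subgradient
inequality at `z` limits how much the proximal objective can decrease. Together they bound the step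
length `t` in terms of the residual and `ε`, and the norm of the output is at most `(c + M)t ≤ 2ct`.
-/
theorem norm_output_le (hd : AIPPData X f h M lam) (hρ : 0 < ρ) {s : ACGIterate E}
    (hs : ProxIterate X f h lam xp s)
    (hres : ‖xp - s.z + s.u‖ ≤ 3 / 16 * (lam * ρ))
    (hε : s.ε ≤ ρ ^ 2 / (32 * (M + 1 / lam)) * lam) :
    ‖(aippOutput f h M lam s.z).2‖ ≤ ρ := by
  obtain ⟨hxb, h1⟩ := hd.output_spec hs.z_mem
  have h2 := h1 _ hs.z_mem
  have h3 := hs.subgradient _ hxb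
  have h4 := hd.upper _ hxb _ hs.z_mem
  have h5 := hd.lipschitz _ hxb _ hs.z_mem
  have hu : (aippOutput f h M lam s.z).2 = (M + 1 / lam) • (s.z - (aippOutput f h M lam s.z).1)
    + gradient f (aippOutput f h M lam s.z).1 - gradient f s.z := rfl
  rw [hu]
  set xb := (aippOutput f h M lam s.z).1
  have hl := hd.lam_pos
  have hM := hd.M_pos
  set c := M + 1 / lam with hc
  have hc0 : 0 < c := by positivity
  have hcl : lam * c = lam * M + 1 := by rw [hc]; field_simp
  rw [norm_sub_rev s.z xb, sub_self, norm_zero, inner_zero_right] at h2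
  simp only [proxObj] at h3
  rw [sq_norm_sub_expand xb s.z xp] at h3
  have h6 : -(‖xp - s.z + s.u‖ * ‖xb - s.z‖) ≤
      inner ℝ s.u (xb - s.z) - inner ℝ (s.z - xp) (xb - s.z) := by
    rw [← inner_sub_left]
    have h7 := (abs_le.1 (abs_real_inner_le_norm (s.u - (s.z - xp)) (xb - s.z))).1
    have : s.u - (s.z - xp) = xp - s.z + s.u := by abel
    rw [this] at h7 ⊢
    exact h7
  set t := ‖xb - s.z‖ with ht
  set r := ‖xp - s.z + s.u‖
  have ht0 : 0 ≤ t := norm_nonneg _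
  have h7 : (lam * c) / 2 * t ^ 2 ≤ r * t + s.ε := by
    rw [hcl]
    have h8 := mul_le_mul_of_nonneg_left h2 hl.le
    have h9 := mul_le_mul_of_nonneg_left h4 hl.le
    have h10 : lam * (c / 2 * t ^ 2) = (lam * M + 1) / 2 * t ^ 2 := by rw [← hcl]; ring
    nlinarith
  have h8 : (c * t) ^ 2 ≤ 3 / 8 * ρ * (c * t) + ρ ^ 2 / 16 := by
    have h9 : lam * c / 2 * t ^ 2 ≤ 3 / 16 * (lam * ρ) * t + ρ ^ 2 / (32 * c) * lam :=
      h7.trans (add_le_add (mul_le_mul_of_nonneg_right hres ht0) hε)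
    have h10 := mul_le_mul_of_nonneg_left h9 (by positivity : 0 ≤ 2 * c / lam)
    have e1 : 2 * c / lam * (lam * c / 2 * t ^ 2) = (c * t) ^ 2 := by field_simp
    have e2 : 2 * c / lam * (3 / 16 * (lam * ρ) * t + ρ ^ 2 / (32 * c) * lam) =
      3 / 8 * ρ * (c * t) + ρ ^ 2 / 16 := by field_simp; ring
    rwa [e1, e2] at h10
  -- `ρ/2` is exactly the positive root of `X² = 3/8 ρX + ρ²/16`.
  have h9 : c * t ≤ ρ / 2 := by
    by_contra! hlt
    nlinarith
  have h10 : ‖c • (s.z - xb) + gradient f xb - gradient f s.z‖ ≤ c * t + M * t := by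
    rw [add_sub_assoc]
    refine (norm_add_le _ _).trans (add_le_add ?_ h5)
    rw [norm_smul, Real.norm_of_nonneg hc0.le, norm_sub_rev]
  have h11 : M * t ≤ c * t := by
    apply mul_le_mul_of_nonneg_right _ ht0
    rw [hc]; have : 0 < 1 / lam := by positivity
    linarith
  linarith

end AIPPData

end AIPPAnalysis

/-! ### One step of the oracle implementation: cost, and agreement with the ACG iteration. -/

section MachineAnalysis

variable {E : Type u} [NormedAddCommGroup E] [InnerProductSpace ℝ E] [FiniteDimensional ℝ E]
  {F : Type v} [NormedAddCommGroup F] [InnerProductSpace ℝ F]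
  {P : Problem E F} {y₀ : F} {ξ ρ : ℝ} {x xp : E}

theorem Problem.Assumptions.Lxi_pos (hP : P.Assumptions) (hξ : 0 < ξ) :
    0 < Lxi P.m P.Lx P.Ly ξ := by
  have h1 := hP.Lx_pos
  have h2 := hP.Ly_pos
  have h3 : 0 ≤ √(ξ * (P.Lx + P.m)) := Real.sqrt_nonneg _
  rw [Lxi]
  positivity

theorem Problem.Assumptions.aippData (hP : P.Assumptions) (hξ : 0 < ξ) :
    AIPPData P.X (P.pSmooth y₀ ξ) P.h (Lxi P.m P.Lx P.Ly ξ) (1 / (4 * P.m)) where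
  h_mem := hP.h_mem
  convex_X := hP.convex_X
  lam_pos := by have := hP.m_pos; positivity
  M_pos := hP.Lxi_pos hξ
  differentiable x hx := (hP.hasGradientAt_pSmooth hξ (hP.X_subset_Ω hx)).differentiableAt
  lower x hx x' hx' := by
    have hm := hP.m_pos
    -- For `λ = 1/(4m)` the concavity allowance `1/(8λ)` is precisely `m/2`.
    have e : 1 / (8 * (1 / (4 * P.m))) = P.m / 2 := by field_simp; norm_num
    rw [e]
    exact hP.pSmooth_lower hξ hx hx'
  upper x hx x' hx' := hP.pSmooth_upper hξ hx hx'
  lipschitz x hx x' hx' := hP.gradient_pSmooth_lipschitz hξ hx hx'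

theorem Problem.Assumptions.result_valProg (hP : P.Assumptions) (hξ : 0 < ξ) (hx : x ∈ P.X)
    {α : Type w} (k : ℝ → Prog E F α) :
    (valProg ξ y₀ x k).result P.oracle = (k (P.pSmooth y₀ ξ x)).result P.oracle := by
  rw [hP.pSmooth_eq hξ (hP.X_subset_Ω hx)]
  rfl

theorem Problem.Assumptions.result_gradProg (hP : P.Assumptions) (hξ : 0 < ξ) (hx : x ∈ P.X)
    {α : Type w} (k : E → Prog E F α) :
    (gradProg ξ y₀ x k).result P.oracle =
      (k (gradient (P.pSmooth y₀ ξ) x)).result P.oracle := by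
  rw [hP.gradient_pSmooth hξ (hP.X_subset_Ω hx)]
  rfl

/-- The prox oracle solves a linearly perturbed proximal problem. -/
theorem Problem.Assumptions.resH_eq (hP : P.Assumptions) {l c : ℝ} (hl : 0 < l) (hc : 0 < c)
    {s a w : E} (hw : w ∈ P.X)
    (hmin : ∀ x ∈ P.X, l * (P.h w).toReal + inner ℝ s w + c / 2 * ‖w - a‖ ^ 2 ≤
      l * (P.h x).toReal + inner ℝ s x + c / 2 * ‖x - a‖ ^ 2) :
    P.oracle.resH (l / c) (a - (1 / c) • s) = w := by
  set G : E → ℝ := fun x => l * (P.h x).toReal + inner ℝ s x + c / 2 * ‖x - a‖ ^ 2 + 0 with hG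
  set κ : ℝ := 1 / 2 * ‖(1 / c) • s‖ ^ 2 - 1 / c * inner ℝ s a
  have hsc : StrongConvexOn P.X c G :=
    strongConvexOn_add_quadratic ((ConvBar.convexOn hP.h_mem hP.convex_X).smul hl.le) c 0 s a
  have hF : ∀ x ∈ P.X, ((l / c : ℝ) : EReal) * P.h x +
      ((1 / 2 * ‖x - (a - (1 / c) • s)‖ ^ 2 : ℝ) : EReal) = ((1 / c * G x + κ : ℝ) : EReal) := by
    intro x hx
    rw [ConvBar.eq_coe hP.h_mem hx, ← EReal.coe_mul, ← EReal.coe_add]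
    congr 1
    have e : x - (a - (1 / c) • s) = (x - a) + (1 / c) • s := by abel
    rw [e, norm_add_sq_real, inner_smul_right, inner_sub_left, real_inner_comm s x,
      real_inner_comm s a]
    simp only [hG, κ]
    field_simp
    ring
  obtain ⟨h1, h2⟩ := argminOn_spec (X := P.X) (F := fun x : E => ((l / c : ℝ) : EReal) * P.h x +
      ((1 / 2 * ‖x - (a - (1 / c) • s)‖ ^ 2 : ℝ) : EReal)) (G := fun x => 1 / c * G x + κ) hF
    ⟨w, hw, fun x hx => by
      have := hmin x hx
      have h3 : G w ≤ G x := by simp only [hG]; linarith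
      have h4 := mul_le_mul_of_nonneg_left h3 (by positivity : 0 ≤ 1 / c)
      linarith⟩
  change P.oracle.resH (l / c) (a - (1 / c) • s) ∈ P.X at h1
  change ∀ x ∈ P.X, 1 / c * G (P.oracle.resH (l / c) (a - (1 / c) • s)) + κ ≤ 1 / c * G x + κ at h2
  refine StrongConvexOn.unique hc hsc hw (fun x hx => ?_) h1 fun x hx => ?_
  · have := hmin x hx
    simp only [hG]; linarith
  · exact le_of_mul_le_mul_left (by linarith [h2 x hx]) (by positivity : 0 < 1 / c)

theorem Problem.Assumptions.result_outputProg (hP : P.Assumptions) (hξ : 0 < ξ) (hx : x ∈ P.X) :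
    (outputProg (Lxi P.m P.Lx P.Ly ξ) (1 / (4 * P.m)) ξ y₀ x).result P.oracle =
      Sum.inr (aippOutput (P.pSmooth y₀ ξ) P.h (Lxi P.m P.Lx P.Ly ξ) (1 / (4 * P.m)) x) := by
  have hd := hP.aippData (y₀ := y₀) hξ
  obtain ⟨hxb, h1⟩ := hd.output_spec hx
  set M := Lxi P.m P.Lx P.Ly ξ
  set lam := 1 / (4 * P.m)
  have hl := hd.lam_pos
  have hM := hd.M_pos
  have hc : 0 < M + 1 / lam := by positivity
  set f := P.pSmooth y₀ ξ
  have hres : P.oracle.resH (1 / (M + 1 / lam)) (x - (1 / (M + 1 / lam)) • gradient f x) =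
      (aippOutput f P.h M lam x).1 := by
    refine hP.resH_eq one_pos hc hxb fun x' hx' => ?_
    have h2 := h1 x' hx'
    rw [inner_sub_right, inner_sub_right] at h2
    have h3 : 0 ≤ (M + 1 / lam) / 2 * ‖x' - (aippOutput f P.h M lam x).1‖ ^ 2 := by positivity
    linarith
  rw [outputProg, hP.result_gradProg hξ hx, Prog.result, hres, hP.result_gradProg hξ hxb]
  rfl


/-- The memory holding an ACG iterate. -/
def memOf (refining : Bool) (xp : E) (j : ℕ) (s : ACGIterate E) (icpt : ℝ) (slope : E) : Mem E :=
  { refining := refining, xp := xp, j := j, A := s.A, y := s.y, z := s.z, icpt := icpt,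
    slope := slope }

open Classical in
/-- The tests at the end of a step of the implementation. -/
def stepDecision (M lam ξ : ℝ) (y₀ : F) (ρ : ℝ) (s : Mem E) (A' icpt' : ℝ)
    (slope' y' z' u' : E) (ε' : ℝ) : Prog E F (Mem E ⊕ E × E) :=
  let res := ‖s.xp - z' + u'‖
  let hpe : Prop := ‖u'‖ ^ 2 + 2 * ε' ≤ 1 / 2 * res ^ 2
  let stepOneDone : Prop := s.refining = false ∧ minIter M lam ≤ s.j + 1 ∧ hpe
  let small : Prop := res ≤ lam * (ρ / 4) / 5
  let refining' : Bool := decide (s.refining = true ∨ (stepOneDone ∧ small))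
  if refining' = true ∧ hpe ∧ ε' ≤ ρ ^ 2 / (32 * (M + 1 / lam)) * lam then
    outputProg M lam ξ y₀ z'
  else if stepOneDone ∧ ¬ small then
    .ret (Sum.inl (Mem.init z'))
  else
    .ret (Sum.inl { refining := refining', xp := s.xp, j := s.j + 1, A := A', y := y', z := z',
                    icpt := icpt', slope := slope' })

/-- The part of a step of the implementation after the computation of `y_{j+1}`. -/
def stepAfterProx (M lam ξ : ℝ) (y₀ : F) (ρ : ℝ) (s : Mem E) (A' icpt' : ℝ)
    (slope' y' : E) : Prog E F (Mem E ⊕ E × E) :=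
  let z' := (s.A / A') • s.z + ((A' - s.A) / A') • y'
  let u' := (1 / A') • (s.xp - y')
  valProg ξ y₀ z' fun v' =>
  .evalH z' fun hz =>
  .evalH y' fun hy =>
  stepDecision M lam ξ y₀ ρ s A' icpt' slope' y' z' u'
    ((lam * v' + 1 / 4 * ‖z' - s.xp‖ ^ 2) + (lam * hz + 1 / 4 * ‖z' - s.xp‖ ^ 2)
    - (icpt' + inner ℝ slope' y') - (lam * hy + 1 / 4 * ‖y' - s.xp‖ ^ 2)
    - inner ℝ u' (z' - y'))

/-- The part of a step of the implementation after the linearization of the smooth part. -/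
def stepAfterGrad (M lam ξ : ℝ) (y₀ : F) (ρ : ℝ) (s : Mem E) (A' : ℝ) (zt : E) (v : ℝ) (g : E) :
    Prog E F (Mem E ⊕ E × E) :=
  let G := lam • g + (1 / 2 : ℝ) • (zt - s.xp)
  let icpt' := s.A / A' * s.icpt +
    (A' - s.A) / A' * (lam * v + 1 / 4 * ‖zt - s.xp‖ ^ 2 - inner ℝ G zt)
  let slope' := (s.A / A') • s.slope + ((A' - s.A) / A') • G
  let c := 1 / 2 + 1 / A'
  .resH (lam / c) (s.xp - (1 / c) • slope') fun y' =>
  stepAfterProx M lam ξ y₀ ρ s A' icpt' slope' y'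

/-- The step cut after the linearization and after the proximal call, so that each piece can be
evaluated separately. -/
theorem aippsStep_eq (m Lx Ly ξ : ℝ) (y₀ : F) (ρ : ℝ) (s : Mem E) :
    aippsStep m Lx Ly ξ y₀ ρ s =
      let M := Lxi m Lx Ly ξ
      let lam := 1 / (4 * m)
      let A' := acgA (1 / 2) (lam * M + 1 / 2) s.A
      let zt := (s.A / A') • s.z + ((A' - s.A) / A') • s.y
      valProg ξ y₀ zt fun v => gradProg ξ y₀ zt fun g =>
        stepAfterGrad M lam ξ y₀ ρ s A' zt v g := rfl

theorem cost_outputProg (O : Oracle E F) (M lam : ℝ) :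
    (outputProg M lam ξ y₀ x).cost O = 5 := rfl

theorem cost_stepDecision_le (O : Oracle E F) (M lam : ℝ) (s : Mem E) (A' icpt' : ℝ)
    (slope' y' z' u' : E) (ε' : ℝ) :
    (stepDecision M lam ξ y₀ ρ s A' icpt' slope' y' z' u' ε').cost O ≤ 5 := by
  rw [stepDecision]
  split_ifs
  · exact (cost_outputProg O M lam).le
  · exact Nat.zero_le _
  · exact Nat.zero_le _

/-- A step of the implementation makes at most 14 oracle evaluations. -/
theorem cost_aippsStep_le (O : Oracle E F) (m Lx Ly : ℝ) (s : Mem E) :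
    (aippsStep m Lx Ly ξ y₀ ρ s).cost O ≤ 14 := by
  -- Nine evaluations precede the tests: two for each of two values and one gradient of `p_ξ`, one
  -- proximal solve, two values of `h`. The output adds at most five.
  have h : ∀ n : ℕ, n ≤ 5 → n + 1 + 1 + 1 + 1 + 1 + 1 + 1 + 1 + 1 ≤ 14 := by intro n hn; omega
  rw [aippsStep_eq]
  exact h _ (cost_stepDecision_le ..)

/-! ### The four outcomes of the tests: output, refine, restart, continue. -/

section Decision

variable {M lam A' icpt' ε' : ℝ} {s : Mem E} {slope' y' z' u' : E}

theorem stepDecision_output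
    (h1 : s.refining = true ∨ (s.refining = false ∧ minIter M lam ≤ s.j + 1 ∧
      ‖s.xp - z' + u'‖ ≤ lam * (ρ / 4) / 5))
    (h2 : ‖u'‖ ^ 2 + 2 * ε' ≤ 1 / 2 * ‖s.xp - z' + u'‖ ^ 2)
    (h3 : ε' ≤ ρ ^ 2 / (32 * (M + 1 / lam)) * lam) :
    stepDecision M lam ξ y₀ ρ s A' icpt' slope' y' z' u' ε' = outputProg M lam ξ y₀ z' := by
  rw [stepDecision]
  rw [if_pos]
  refine ⟨decide_eq_true ?_, h2, h3⟩
  tauto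

theorem stepDecision_refine
    (h1 : s.refining = true ∨ (s.refining = false ∧ minIter M lam ≤ s.j + 1 ∧
      ‖s.xp - z' + u'‖ ≤ lam * (ρ / 4) / 5))
    (h2 : ‖u'‖ ^ 2 + 2 * ε' ≤ 1 / 2 * ‖s.xp - z' + u'‖ ^ 2)
    (h3 : ¬ ε' ≤ ρ ^ 2 / (32 * (M + 1 / lam)) * lam) :
    (stepDecision M lam ξ y₀ ρ s A' icpt' slope' y' z' u' ε' : Prog E F _) =
      .ret (Sum.inl { refining := true, xp := s.xp, j := s.j + 1, A := A', y := y', z := z',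
                      icpt := icpt', slope := slope' }) := by
  rw [stepDecision]
  rw [if_neg (fun h => h3 h.2.2), if_neg, decide_eq_true]
  · tauto
  · rintro ⟨⟨h4, -, -⟩, h5⟩
    rcases h1 with h1 | h1
    · rw [h1] at h4; exact Bool.noConfusion h4
    · exact h5 h1.2.2

theorem stepDecision_restart (h0 : s.refining = false) (h1 : minIter M lam ≤ s.j + 1)
    (h2 : ‖u'‖ ^ 2 + 2 * ε' ≤ 1 / 2 * ‖s.xp - z' + u'‖ ^ 2)
    (h3 : ¬ ‖s.xp - z' + u'‖ ≤ lam * (ρ / 4) / 5) :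
    (stepDecision M lam ξ y₀ ρ s A' icpt' slope' y' z' u' ε' : Prog E F _) =
      .ret (Sum.inl (Mem.init z')) := by
  rw [stepDecision]
  rw [if_neg, if_pos ⟨⟨h0, h1, h2⟩, h3⟩]
  rintro ⟨h4, -⟩
  rcases of_decide_eq_true h4 with h5 | h5
  · rw [h0] at h5; exact Bool.noConfusion h5
  · exact h3 h5.2

theorem stepDecision_continue (h0 : s.refining = false) (h1 : s.j + 1 < minIter M lam) :
    (stepDecision M lam ξ y₀ ρ s A' icpt' slope' y' z' u' ε' : Prog E F _) =
      .ret (Sum.inl { refining := false, xp := s.xp, j := s.j + 1, A := A', y := y', z := z',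
                      icpt := icpt', slope := slope' }) := by
  have hn : ¬ (s.refining = true ∨ (s.refining = false ∧ minIter M lam ≤ s.j + 1 ∧
      ‖u'‖ ^ 2 + 2 * ε' ≤ 1 / 2 * ‖s.xp - z' + u'‖ ^ 2) ∧
      ‖s.xp - z' + u'‖ ≤ lam * (ρ / 4) / 5) := by
    rintro (h | h)
    · rw [h0] at h; exact Bool.noConfusion h
    · omega
  rw [stepDecision]
  rw [if_neg (fun h => hn (of_decide_eq_true h.1)), if_neg (fun h => by omega),
    decide_eq_false hn]

end Decision

/-- The implementation reproduces the ACG iterates. -/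
theorem Problem.Assumptions.result_aippsStep (hP : P.Assumptions) (hξ : 0 < ξ) (hxp : xp ∈ P.X)
    (refining : Bool) (j : ℕ) {M lam icpt : ℝ} {f : E → ℝ} {slope : E} {s s' : ACGIterate E}
    (hM : M = Lxi P.m P.Lx P.Ly ξ) (hlam : lam = 1 / (4 * P.m)) (hf : f = P.pSmooth y₀ ξ)
    (hs₀ : s = aippACG f P.h M lam xp j) (hs₀' : s' = aippACG f P.h M lam xp (j + 1))
    (hΓ : ∀ x, s.Γ x = icpt + inner ℝ slope x) :
    ∃ icpt' slope', (∀ x, s'.Γ x = icpt' + inner ℝ slope' x) ∧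
      (aippsStep P.m P.Lx P.Ly ξ y₀ ρ (memOf refining xp j s icpt slope)).result P.oracle =
        (stepDecision M lam ξ y₀ ρ (memOf refining xp j s icpt slope) s'.A icpt' slope' s'.y
          s'.z s'.u s'.ε).result P.oracle := by
  have hd : AIPPData P.X f P.h M lam := by subst hM hlam hf; exact hP.aippData (y₀ := y₀) hξ
  have ha := hd.acgData hxp
  have hs := ha.inv_seq j
  have hs' := ha.inv_seq (j + 1)
  have hA0 := ha.A_pos j
  have hlt := (acgA_spec ha.μ_nonneg ha.L_pos hs.A_nonneg).1
  have hgrow := hs'.growth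
  have hε := ha.ε_eq (Nat.le_add_left 1 j)
  change ACGInv _ _ _ _ _ (aippACG f P.h M lam xp j) at hs
  change ACGInv _ _ _ _ _ (aippACG f P.h M lam xp (j + 1)) at hs'
  change 0 < (aippACG f P.h M lam xp (j + 1)).A at hA0
  change (aippACG f P.h M lam xp j).A < (aippACG f P.h M lam xp (j + 1)).A at hlt
  have hsA : s'.A = acgA (1 / 2) (lam * M + 1 / 2) s.A := by rw [hs₀, hs₀']; rfl
  have hzdef : s'.z = (s.A / s'.A) • s.z + ((s'.A - s.A) / s'.A) • s'.y := by
    rw [hs₀, hs₀']; rfl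
  have hudef : s'.u = (1 / s'.A) • (xp - s'.y) := by rw [hs₀']; rfl
  have hΓdef : ∀ x, s'.Γ x = s.A / s'.A * s.Γ x + (s'.A - s.A) / s'.A *
      (lam * f ((s.A / s'.A) • s.z + ((s'.A - s.A) / s'.A) • s.y) +
        1 / 4 * ‖(s.A / s'.A) • s.z + ((s'.A - s.A) / s'.A) • s.y - xp‖ ^ 2 +
        inner ℝ (gradient (fun x => lam * f x + 1 / 4 * ‖x - xp‖ ^ 2)
          ((s.A / s'.A) • s.z + ((s'.A - s.A) / s'.A) • s.y))
          (x - ((s.A / s'.A) • s.z + ((s'.A - s.A) / s'.A) • s.y))) := by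
    intro x; rw [hs₀, hs₀']; rfl
  change (aippACG f P.h M lam xp (j + 1)).ε = (lam * f (aippACG f P.h M lam xp (j + 1)).z
      + 1 / 4 * ‖(aippACG f P.h M lam xp (j + 1)).z - xp‖ ^ 2
      + (lam * (P.h (aippACG f P.h M lam xp (j + 1)).z).toReal
      + 1 / 2 / 2 * ‖(aippACG f P.h M lam xp (j + 1)).z - xp‖ ^ 2))
      - (aippACG f P.h M lam xp (j + 1)).Γ (aippACG f P.h M lam xp (j + 1)).y
      - (lam * (P.h (aippACG f P.h M lam xp (j + 1)).y).toReal
      + 1 / 2 / 2 * ‖(aippACG f P.h M lam xp (j + 1)).y - xp‖ ^ 2)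
      - inner ℝ (aippACG f P.h M lam xp (j + 1)).u
        ((aippACG f P.h M lam xp (j + 1)).z - (aippACG f P.h M lam xp (j + 1)).y) at hε
  change ∀ x ∈ P.X, (aippACG f P.h M lam xp (j + 1)).A *
      ((aippACG f P.h M lam xp (j + 1)).Γ (aippACG f P.h M lam xp (j + 1)).y +
        (lam * (P.h (aippACG f P.h M lam xp (j + 1)).y).toReal
          + 1 / 2 / 2 * ‖(aippACG f P.h M lam xp (j + 1)).y - xp‖ ^ 2))
      + 1 / 2 * ‖(aippACG f P.h M lam xp (j + 1)).y - xp‖ ^ 2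
      + (1 + 1 / 2 * (aippACG f P.h M lam xp (j + 1)).A) / 2 *
        ‖x - (aippACG f P.h M lam xp (j + 1)).y‖ ^ 2 ≤
      (aippACG f P.h M lam xp (j + 1)).A * ((aippACG f P.h M lam xp (j + 1)).Γ x +
        (lam * (P.h x).toReal + 1 / 2 / 2 * ‖x - xp‖ ^ 2)) + 1 / 2 * ‖x - xp‖ ^ 2 at hgrow
  rw [← hs₀] at hs hlt
  rw [← hs₀'] at hs' hA0 hlt hε hgrow
  have hsA0 : 0 ≤ s.A := hs.A_nonneg
  clear hs₀ hs₀' ha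
  set zt := (s.A / s'.A) • s.z + ((s'.A - s.A) / s'.A) • s.y with hzt
  have hztX : zt ∈ P.X := hP.convex_X hs.z_mem hs.y_mem (by positivity)
    (div_nonneg (by linarith) hA0.le) (by field_simp; ring)
  obtain ⟨G, hG⟩ : ∃ G, G = lam • gradient f zt + (1 / 2 : ℝ) • (zt - xp) := ⟨_, rfl⟩
  have hgrad : gradient (fun x => lam * f x + 1 / 4 * ‖x - xp‖ ^ 2) zt = G := by
    rw [hG]; exact (hasGradientAt_add_sq (hd.differentiable zt hztX) lam xp).gradient
  obtain ⟨icpt', hicpt⟩ : ∃ icpt', icpt' = s.A / s'.A * icpt +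
    (s'.A - s.A) / s'.A * (lam * f zt + 1 / 4 * ‖zt - xp‖ ^ 2 - inner ℝ G zt) := ⟨_, rfl⟩
  obtain ⟨slope', hslope⟩ : ∃ slope', slope' = (s.A / s'.A) • slope +
    ((s'.A - s.A) / s'.A) • G := ⟨_, rfl⟩
  have hΓ' : ∀ x, s'.Γ x = icpt' + inner ℝ slope' x := by
    intro x
    rw [hΓdef, hgrad, hΓ, hicpt, hslope, inner_add_left, inner_smul_left, inner_smul_left,
      inner_sub_right]
    simp only [conj_trivial]
    ring
  refine ⟨icpt', slope', hΓ', ?_⟩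
  -- The ACG subproblem is `λh` plus an affine function plus a square centred at `xp` with
  -- coefficient `1/2 + 1/A'`; the growth property of the iterate identifies its minimizer.
  have hres : P.oracle.resH (lam / (1 / 2 + 1 / s'.A)) (xp - (1 / (1 / 2 + 1 / s'.A)) • slope') =
      s'.y := by
    refine hP.resH_eq hd.lam_pos (by positivity) hs'.y_mem fun x hx => ?_
    have h1 := hgrow x hx
    rw [hΓ', hΓ'] at h1
    have h2 : 0 ≤ (1 + 1 / 2 * s'.A) / 2 * ‖x - s'.y‖ ^ 2 := by positivity
    have e : ∀ x, s'.A * (lam * (P.h x).toReal + inner ℝ slope' x +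
        (1 / 2 + 1 / s'.A) / 2 * ‖x - xp‖ ^ 2) =
        s'.A * (icpt' + inner ℝ slope' x + (lam * (P.h x).toReal + 1 / 2 / 2 * ‖x - xp‖ ^ 2))
          + 1 / 2 * ‖x - xp‖ ^ 2 - s'.A * icpt' := by
      intro x; field_simp; ring
    refine le_of_mul_le_mul_left ?_ hA0
    rw [e, e]
    linarith
  have hεdef : (lam * f s'.z + 1 / 4 * ‖s'.z - xp‖ ^ 2)
      + (lam * (P.h s'.z).toReal + 1 / 4 * ‖s'.z - xp‖ ^ 2)
      - (icpt' + inner ℝ slope' s'.y) - (lam * (P.h s'.y).toReal + 1 / 4 * ‖s'.y - xp‖ ^ 2)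
      - inner ℝ s'.u (s'.z - s'.y) = s'.ε := by
    rw [hε, hΓ']; norm_num
  have h1 : (aippsStep P.m P.Lx P.Ly ξ y₀ ρ (memOf refining xp j s icpt slope)) =
      valProg ξ y₀ zt fun v => gradProg ξ y₀ zt fun g =>
        stepAfterGrad M lam ξ y₀ ρ (memOf refining xp j s icpt slope) s'.A zt v g := by
    rw [aippsStep_eq, hzt, hsA, hM, hlam]
    rfl
  have h2 : (stepAfterGrad M lam ξ y₀ ρ (memOf refining xp j s icpt slope) s'.A zt (f zt)
      (gradient f zt)).result P.oracle =
      (stepAfterProx M lam ξ y₀ ρ (memOf refining xp j s icpt slope) s'.A icpt' slope'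
        (P.oracle.resH (lam / (1 / 2 + 1 / s'.A))
          (xp - (1 / (1 / 2 + 1 / s'.A)) • slope'))).result P.oracle := by
    rw [hslope, hicpt, hG]; rfl
  have hv := hP.result_valProg (y₀ := y₀) hξ hztX (α := Mem E ⊕ E × E)
  have hg := hP.result_gradProg (y₀ := y₀) hξ hztX (α := Mem E ⊕ E × E)
  have hv' := hP.result_valProg (y₀ := y₀) hξ hs'.z_mem (α := Mem E ⊕ E × E)
  rw [← hf] at hv hg hv'
  rw [h1, hv, hg, h2, hres, stepAfterProx]
  change (valProg ξ y₀ ((s.A / s'.A) • s.z + ((s'.A - s.A) / s'.A) • s'.y) _).result _ = _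
  rw [← hzdef, hv']
  change (stepDecision M lam ξ y₀ ρ (memOf refining xp j s icpt slope) s'.A icpt' slope' s'.y
    ((s.A / s'.A) • s.z + ((s'.A - s.A) / s'.A) • s'.y) ((1 / s'.A) • (xp - s'.y))
    ((lam * f s'.z + 1 / 4 * ‖(s.A / s'.A) • s.z + ((s'.A - s.A) / s'.A) • s'.y - xp‖ ^ 2)
      + (lam * (P.h ((s.A / s'.A) • s.z + ((s'.A - s.A) / s'.A) • s'.y)).toReal
      + 1 / 4 * ‖(s.A / s'.A) • s.z + ((s'.A - s.A) / s'.A) • s'.y - xp‖ ^ 2)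
      - (icpt' + inner ℝ slope' s'.y) - (lam * (P.h s'.y).toReal + 1 / 4 * ‖s'.y - xp‖ ^ 2)
      - inner ℝ ((1 / s'.A) • (xp - s'.y))
        ((s.A / s'.A) • s.z + ((s'.A - s.A) / s'.A) • s'.y - s'.y))).result P.oracle = _
  rw [← hzdef, ← hudef, hεdef]

end MachineAnalysis

/-! ### Whole runs: lockstep with the machine, termination, number of outer iterations. -/

section RunAnalysis

variable {E : Type u} [NormedAddCommGroup E] [InnerProductSpace ℝ E] [FiniteDimensional ℝ E]
  {F : Type v} [NormedAddCommGroup F] [InnerProductSpace ℝ F]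

/-- The AIPP data `(f, M, lam)` are those of the AIPP-S scheme. -/
structure AIPPSSetup (P : Problem E F) (y₀ : F) (ξ M lam : ℝ) (f : E → ℝ) : Prop where
  assumptions : P.Assumptions
  ξ_pos : 0 < ξ
  M_eq : M = Lxi P.m P.Lx P.Ly ξ
  lam_eq : lam = 1 / (4 * P.m)
  f_eq : f = P.pSmooth y₀ ξ

/-- The implementation, started at `s`, outputs `b` after at most `N` oracle evaluations. -/
def HaltsWithin (P : Problem E F) (y₀ : F) (ξ ρ : ℝ) (s : Mem E) (b : E × E) (N : ℕ) : Prop :=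
  ∃ T ≤ N, Halts P.oracle (aippsStep P.m P.Lx P.Ly ξ y₀ ρ) s b T

variable {P : Problem E F} {y₀ : F} {ξ ρ M lam : ℝ} {f : E → ℝ} {xp : E} {b : E × E} {N : ℕ}

theorem HaltsWithin.mono {s : Mem E} {N' : ℕ} (h : HaltsWithin P y₀ ξ ρ s b N) (hN : N ≤ N') :
    HaltsWithin P y₀ ξ ρ s b N' := by
  obtain ⟨T, hT, hh⟩ := h
  exact ⟨T, hT.trans hN, hh⟩

theorem haltsWithin_done {s : Mem E}
    (hs : (aippsStep P.m P.Lx P.Ly ξ y₀ ρ s).result P.oracle = Sum.inr b) :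
    HaltsWithin P y₀ ξ ρ s b 14 :=
  ⟨_, cost_aippsStep_le _ _ _ _ _, Halts.done s b hs⟩

theorem HaltsWithin.step {s s' : Mem E}
    (hs : (aippsStep P.m P.Lx P.Ly ξ y₀ ρ s).result P.oracle = Sum.inl s')
    (h : HaltsWithin P y₀ ξ ρ s' b N) : HaltsWithin P y₀ ξ ρ s b (14 + N) := by
  obtain ⟨T, hT, hh⟩ := h
  exact ⟨_, add_le_add (cost_aippsStep_le _ _ _ _ _) hT, Halts.more s s' b T hs hh⟩

namespace AIPPSSetup

theorem aippData (hS : AIPPSSetup P y₀ ξ M lam f) : AIPPData P.X f P.h M lam := by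
  obtain ⟨hP, hξ, rfl, rfl, rfl⟩ := hS
  exact hP.aippData hξ

theorem criterion (hS : AIPPSSetup P y₀ ξ M lam f) (hxp : xp ∈ P.X) {j : ℕ}
    (hj : minIter M lam ≤ j) :
    ‖(aippACG f P.h M lam xp j).u‖ ^ 2 + 2 * (aippACG f P.h M lam xp j).ε ≤
      1 / 2 * ‖xp - (aippACG f P.h M lam xp j).z + (aippACG f P.h M lam xp j).u‖ ^ 2 :=
  (hS.aippData.proxIterate hxp (hS.aippData.minIter_pos.trans hj)).criterion
    (hS.aippData.eighteen_le_A hxp hj)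

theorem result_outputProg (hS : AIPPSSetup P y₀ ξ M lam f) {x : E} (hx : x ∈ P.X) :
    (outputProg M lam ξ y₀ x).result P.oracle = Sum.inr (aippOutput f P.h M lam x) := by
  obtain ⟨hP, hξ, rfl, rfl, rfl⟩ := hS
  exact hP.result_outputProg hξ hx

/-- Induction on the number of steps left. In refining mode the criterion always holds, so only the
tolerance on `ε` can fail, and minimality of `i` makes it fail before `i`. -/
theorem halts_refining (hS : AIPPSSetup P y₀ ξ M lam f) (hxp : xp ∈ P.X) {i : ℕ}
    (hi : IsLeast {i : ℕ | minIter M lam ≤ i ∧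
        InexactProx f P.h lam (1 / 2) xp (aippACG f P.h M lam xp i).z (aippACG f P.h M lam xp i).u
          (aippACG f P.h M lam xp i).ε ∧
        (aippACG f P.h M lam xp i).ε ≤ ρ ^ 2 / (32 * (M + 1 / lam)) * lam} i) (n : ℕ) :
    ∀ (j : ℕ) (icpt : ℝ) (slope : E), minIter M lam ≤ j → j + n + 1 = i →
      (∀ x, (aippACG f P.h M lam xp j).Γ x = icpt + inner ℝ slope x) →
      HaltsWithin P y₀ ξ ρ (memOf true xp j (aippACG f P.h M lam xp j) icpt slope)
        (aippOutput f P.h M lam (aippACG f P.h M lam xp i).z) (14 * (n + 1)) := by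
  induction n with
  | zero =>
    rintro j icpt slope hj rfl hΓ
    obtain ⟨icpt', slope', -, h⟩ := hS.assumptions.result_aippsStep (ρ := ρ) hS.ξ_pos hxp true j
      hS.M_eq hS.lam_eq hS.f_eq rfl rfl hΓ
    rw [stepDecision_output (Or.inl rfl) (hS.criterion hxp (by omega)) hi.1.2.2,
      hS.result_outputProg (hS.aippData.proxIterate hxp (by omega)).z_mem] at h
    exact haltsWithin_done h
  | succ n ih =>
    intro j icpt slope hj hji hΓ
    obtain ⟨icpt', slope', hΓ', h⟩ := hS.assumptions.result_aippsStep (ρ := ρ) hS.ξ_pos hxp true j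
      hS.M_eq hS.lam_eq hS.f_eq rfl rfl hΓ
    have hj' : minIter M lam ≤ j + 1 := by omega
    rw [stepDecision_refine (Or.inl rfl) (hS.criterion hxp hj') (fun hε => by
      have := hi.2 ⟨hj', (hS.aippData.proxIterate hxp (by omega)).inexactProx hS.aippData
        (hS.aippData.eighteen_le_A hxp hj'), hε⟩
      omega)] at h
    exact (HaltsWithin.step h (ih (j + 1) icpt' slope' hj' (by omega) hΓ')).mono (by omega)

theorem halts_of_last (hS : AIPPSSetup P y₀ ξ M lam f) (hxp : xp ∈ P.X)
    (hK : ∀ (j : ℕ) (icpt : ℝ) (slope : E), j + 1 = minIter M lam →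
      (∀ x, (aippACG f P.h M lam xp j).Γ x = icpt + inner ℝ slope x) →
      HaltsWithin P y₀ ξ ρ (memOf false xp j (aippACG f P.h M lam xp j) icpt slope) b N) (n : ℕ) :
    ∀ (j : ℕ) (icpt : ℝ) (slope : E), j + n + 1 = minIter M lam →
      (∀ x, (aippACG f P.h M lam xp j).Γ x = icpt + inner ℝ slope x) →
      HaltsWithin P y₀ ξ ρ (memOf false xp j (aippACG f P.h M lam xp j) icpt slope) b
        (14 * n + N) := by
  induction n with
  | zero => intro j icpt slope hj hΓ; simpa using hK j icpt slope hj hΓ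
  | succ n ih =>
    intro j icpt slope hj hΓ
    obtain ⟨icpt', slope', hΓ', h⟩ := hS.assumptions.result_aippsStep (ρ := ρ) hS.ξ_pos hxp false j
      hS.M_eq hS.lam_eq hS.f_eq rfl rfl hΓ
    rw [stepDecision_continue rfl (show j + 1 < minIter M lam by omega)] at h
    exact (HaltsWithin.step h (ih (j + 1) icpt' slope' (by omega) hΓ')).mono (by omega)

theorem halts_init (hS : AIPPSSetup P y₀ ξ M lam f) (hxp : xp ∈ P.X)
    (hK : ∀ (j : ℕ) (icpt : ℝ) (slope : E), j + 1 = minIter M lam →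
      (∀ x, (aippACG f P.h M lam xp j).Γ x = icpt + inner ℝ slope x) →
      HaltsWithin P y₀ ξ ρ (memOf false xp j (aippACG f P.h M lam xp j) icpt slope) b N) :
    HaltsWithin P y₀ ξ ρ (Mem.init xp) b (14 * (minIter M lam - 1) + N) := by
  have := hS.aippData.minIter_pos
  exact hS.halts_of_last hxp hK (minIter M lam - 1) 0 0 0 (by omega)
    (fun x => by rw [inner_zero_left]; exact (add_zero _).symm)

/-- The step reaching the minimal index may already meet the refined tolerance, in which case the
machine outputs at once; otherwise it enters refining mode. Either way there is one machine step per
ACG iteration, the output included. -/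
theorem halts_finish (hS : AIPPSSetup P y₀ ξ M lam f) (hxp : xp ∈ P.X) {i : ℕ}
    (hres : ‖xp - (aippACG f P.h M lam xp (minIter M lam)).z +
      (aippACG f P.h M lam xp (minIter M lam)).u‖ ≤ lam * (ρ / 4) / 5)
    (hi : IsLeast {i : ℕ | minIter M lam ≤ i ∧
        InexactProx f P.h lam (1 / 2) xp (aippACG f P.h M lam xp i).z (aippACG f P.h M lam xp i).u
          (aippACG f P.h M lam xp i).ε ∧
        (aippACG f P.h M lam xp i).ε ≤ ρ ^ 2 / (32 * (M + 1 / lam)) * lam} i) :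
    HaltsWithin P y₀ ξ ρ (Mem.init xp)
      (aippOutput f P.h M lam (aippACG f P.h M lam xp i).z) (14 * i) := by
  have hpos := hS.aippData.minIter_pos
  have hle : minIter M lam ≤ i := hi.1.1
  refine (hS.halts_init (N := 14 * (i - minIter M lam + 1)) hxp
    fun j icpt slope hj hΓ => ?_).mono (by omega)
  obtain ⟨icpt', slope', hΓ', h⟩ := hS.assumptions.result_aippsStep (ρ := ρ) hS.ξ_pos hxp false j
    hS.M_eq hS.lam_eq hS.f_eq rfl rfl hΓ
  have hres' : ‖xp - (aippACG f P.h M lam xp (j + 1)).z +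
      (aippACG f P.h M lam xp (j + 1)).u‖ ≤ lam * (ρ / 4) / 5 := by rw [hj]; exact hres
  by_cases hε : (aippACG f P.h M lam xp (j + 1)).ε ≤ ρ ^ 2 / (32 * (M + 1 / lam)) * lam
  · have hij : i = j + 1 := by
      have := hi.2 ⟨hj.ge, (hS.aippData.proxIterate hxp (by omega)).inexactProx hS.aippData
        (hS.aippData.eighteen_le_A hxp hj.ge), hε⟩
      omega
    rw [stepDecision_output (Or.inr ⟨rfl, hj.ge, hres'⟩) (hS.criterion hxp hj.ge) hε,
      hS.result_outputProg (hS.aippData.proxIterate hxp (by omega)).z_mem] at h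
    rw [hij]
    exact (haltsWithin_done h).mono (by omega)
  · rw [stepDecision_refine (Or.inr ⟨rfl, hj.ge, hres'⟩) (hS.criterion hxp hj.ge) hε] at h
    have hij : i ≠ j + 1 := by rintro rfl; exact hε hi.1.2.2
    exact (HaltsWithin.step h (hS.halts_refining hxp hi (i - (j + 1) - 1) (j + 1) icpt' slope'
      hj.ge (by omega) hΓ')).mono (by omega)

theorem halts_next (hS : AIPPSSetup P y₀ ξ M lam f) (hxp : xp ∈ P.X)
    (hres : ¬ ‖xp - (aippACG f P.h M lam xp (minIter M lam)).z +
      (aippACG f P.h M lam xp (minIter M lam)).u‖ ≤ lam * (ρ / 4) / 5)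
    (hN : HaltsWithin P y₀ ξ ρ (Mem.init (aippACG f P.h M lam xp (minIter M lam)).z) b N) :
    HaltsWithin P y₀ ξ ρ (Mem.init xp) b (14 * minIter M lam + N) := by
  have hpos := hS.aippData.minIter_pos
  refine (hS.halts_init (N := 14 + N) hxp fun j icpt slope hj hΓ => ?_).mono (by omega)
  obtain ⟨icpt', slope', hΓ', h⟩ := hS.assumptions.result_aippsStep (ρ := ρ) hS.ξ_pos hxp false j
    hS.M_eq hS.lam_eq hS.f_eq rfl rfl hΓ
  rw [stepDecision_restart rfl (show minIter M lam ≤ j + 1 from hj.ge)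
    (hS.criterion hxp hj.ge) (by rw [hj]; exact hres)] at h
  rw [← hj] at hN
  exact HaltsWithin.step h hN

/-- The decrease of the objective over an outer iteration which is not the last. -/
theorem decrease (hS : AIPPSSetup P y₀ ξ M lam f) (hρ : 0 < ρ) (hxp : xp ∈ P.X)
    (hres : ¬ ‖xp - (aippACG f P.h M lam xp (minIter M lam)).z +
      (aippACG f P.h M lam xp (minIter M lam)).u‖ ≤ lam * (ρ / 4) / 5) :
    lam * (f (aippACG f P.h M lam xp (minIter M lam)).z +
        (P.h (aippACG f P.h M lam xp (minIter M lam)).z).toReal) + (lam * ρ) ^ 2 / 1600 ≤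
      lam * (f xp + (P.h xp).toReal) := by
  have hd := hS.aippData
  have h1 := (hd.proxIterate hxp hd.minIter_pos).descent (hd.eighteen_le_A hxp le_rfl) hxp
  push Not at hres
  have hl := hd.lam_pos
  have h2 := pow_le_pow_left₀ (by positivity) hres.le 2
  nlinarith

/-- The cost of the implementation along a run of the AIPP method. -/
theorem halts_of_run (hS : AIPPSSetup P y₀ ξ M lam f) (hρ : 0 < ρ) {c : ℝ}
    (hc : ∀ x ∈ P.X, c ≤ lam * (f x + (P.h x).toReal))
    (hrun : AIPPRun f P.h M lam (1 / 2) ρ xp b) (hxp : xp ∈ P.X) :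
    ∃ N : ℕ, HaltsWithin P y₀ ξ ρ (Mem.init xp) b N ∧
      (N : ℝ) ≤ 14 * (minIter M lam * ((lam * (f xp + (P.h xp).toReal) - c) /
        ((lam * ρ) ^ 2 / 1600)) + refineIter M lam) := by
  have hd := hS.aippData
  have hl := hd.lam_pos
  have hdpos : 0 < (lam * ρ) ^ 2 / 1600 := by positivity
  induction hrun with
  | finish xp j i hj hres hi =>
    obtain rfl := hj.unique (hd.isLeast_minIter hxp)
    refine ⟨14 * i, hS.halts_finish hxp hres hi, ?_⟩
    have h1 : i ≤ refineIter M lam := hi.2 (hd.refineIter_mem hxp hres)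
    have h1' : (i : ℝ) ≤ refineIter M lam := by exact_mod_cast h1
    have h2 : 0 ≤ (minIter M lam : ℝ) * ((lam * (f xp + (P.h xp).toReal) - c) /
        ((lam * ρ) ^ 2 / 1600)) :=
      mul_nonneg (Nat.cast_nonneg _) (div_nonneg (by linarith [hc xp hxp]) hdpos.le)
    push_cast
    linarith
  | next xp j out hj hres hnext ih =>
    obtain rfl := hj.unique (hd.isLeast_minIter hxp)
    have hz := (hd.proxIterate hxp hd.minIter_pos).z_mem
    obtain ⟨N, hN, hNle⟩ := ih hz
    refine ⟨_, hS.halts_next hxp hres hN, ?_⟩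
    have h1 := hS.decrease hρ hxp hres
    set z := (aippACG f P.h M lam xp (minIter M lam)).z
    -- The gap measured in guaranteed decrements is a potential that drops by at least one per
    -- nonfinal outer iteration.
    have h2 : (lam * (f z + (P.h z).toReal) - c) / ((lam * ρ) ^ 2 / 1600) + 1 ≤
        (lam * (f xp + (P.h xp).toReal) - c) / ((lam * ρ) ^ 2 / 1600) := by
      rw [div_add_one hdpos.ne', div_le_div_iff_of_pos_right hdpos]
      linarith
    have h3 := mul_le_mul_of_nonneg_left h2 (Nat.cast_nonneg (α := ℝ) (minIter M lam))
    push_cast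
    linarith

/-- The cost in terms of the distance of the starting point to approximate solutions. -/
theorem halts_of_run_of_gap (hS : AIPPSSetup P y₀ ξ M lam f) (hρ : 0 < ρ) {c R : ℝ}
    (hc : ∀ x ∈ P.X, c ≤ lam * (f x + (P.h x).toReal)) (hR0 : 0 ≤ R)
    (hrun : AIPPRun f P.h M lam (1 / 2) ρ xp b) (hxp : xp ∈ P.X)
    (hR : ∀ z ∈ P.X, (∀ x ∈ P.X, lam * (f z + (P.h z).toReal) ≤
      lam * (f x + (P.h x).toReal) + 19 / 36 * ‖x - xp‖ ^ 2) →
      lam * (f z + (P.h z).toReal) - c ≤ R) :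
    ∃ N : ℕ, HaltsWithin P y₀ ξ ρ (Mem.init xp) b N ∧
      (N : ℝ) ≤ 14 * (minIter M lam * (R / ((lam * ρ) ^ 2 / 1600)) + 2 * refineIter M lam) := by
  have hd := hS.aippData
  have hl := hd.lam_pos
  have hdpos : 0 < (lam * ρ) ^ 2 / 1600 := by positivity
  have hmr : (minIter M lam : ℝ) ≤ refineIter M lam := by
    exact_mod_cast Nat.le_add_right (minIter M lam) _
  have hm0 : (0 : ℝ) ≤ minIter M lam := Nat.cast_nonneg _
  cases hrun with
  | finish _ j i hj hres hi =>
    obtain rfl := hj.unique (hd.isLeast_minIter hxp)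
    refine ⟨14 * i, hS.halts_finish hxp hres hi, ?_⟩
    have h1 : i ≤ refineIter M lam := hi.2 (hd.refineIter_mem hxp hres)
    have h1' : (i : ℝ) ≤ refineIter M lam := by exact_mod_cast h1
    have h2 : 0 ≤ (minIter M lam : ℝ) * (R / ((lam * ρ) ^ 2 / 1600)) := by positivity
    push_cast
    linarith
  | next _ j _ hj hres hnext =>
    obtain rfl := hj.unique (hd.isLeast_minIter hxp)
    have hit := hd.proxIterate hxp hd.minIter_pos
    have hz := hit.z_mem
    -- The potential argument starts only at `x₁`, since the gap at `x₀` itself is not bounded by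
    -- `R`; the extra first iteration is covered by the second `refineIter`.
    obtain ⟨N, hN, hNle⟩ := hS.halts_of_run hρ hc hnext hz
    refine ⟨_, hS.halts_next hxp hres hN, ?_⟩
    have h1 := hR _ hz fun x hx => hit.value_le_of_mem (hd.eighteen_le_A hxp le_rfl) hx
    have h2 := div_le_div_of_nonneg_right h1 hdpos.le
    have h3 := mul_le_mul_of_nonneg_left h2 hm0
    push_cast
    linarith

/-- Induction on an upper bound for the gap counted in guaranteed decrements: a large residual uses
one up, and a small residual ends the run because the refined tolerance is eventually met. -/
theorem exists_run (hS : AIPPSSetup P y₀ ξ M lam f) (hρ : 0 < ρ) {c : ℝ}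
    (hc : ∀ x ∈ P.X, c ≤ lam * (f x + (P.h x).toReal)) (hxp : xp ∈ P.X) :
    ∃ out, AIPPRun f P.h M lam (1 / 2) ρ xp out := by
  classical
  have hd := hS.aippData
  have hl := hd.lam_pos
  have hdpos : 0 < (lam * ρ) ^ 2 / 1600 := by positivity
  have key : ∀ n : ℕ, ∀ xp ∈ P.X,
      lam * (f xp + (P.h xp).toReal) - c < n * ((lam * ρ) ^ 2 / 1600) →
      ∃ out, AIPPRun f P.h M lam (1 / 2) ρ xp out := by
    intro n
    induction n with
    | zero =>
      intro xp hxp h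
      have := hc xp hxp
      simp at h
      linarith
    | succ n ih =>
      intro xp hxp h
      by_cases hres : ‖xp - (aippACG f P.h M lam xp (minIter M lam)).z +
          (aippACG f P.h M lam xp (minIter M lam)).u‖ ≤ lam * (ρ / 4) / 5
      · have hex : ∃ i, i ∈ {i : ℕ | minIter M lam ≤ i ∧
          InexactProx f P.h lam (1 / 2) xp (aippACG f P.h M lam xp i).z
            (aippACG f P.h M lam xp i).u (aippACG f P.h M lam xp i).ε ∧
          (aippACG f P.h M lam xp i).ε ≤ ρ ^ 2 / (32 * (M + 1 / lam)) * lam} :=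
          ⟨_, hd.refineIter_mem hxp hres⟩
        exact ⟨_, AIPPRun.finish xp _ (Nat.find hex) (hd.isLeast_minIter hxp) hres
          ⟨Nat.find_spec hex, fun i hi => Nat.find_min' hex hi⟩⟩
      · have h1 := hS.decrease hρ hxp hres
        obtain ⟨out, hout⟩ := ih _ (hd.proxIterate hxp hd.minIter_pos).z_mem (by
          push_cast at h
          linarith)
        exact ⟨out, AIPPRun.next xp _ out (hd.isLeast_minIter hxp) hres hout⟩
  obtain ⟨n, hn⟩ := exists_nat_gt ((lam * (f xp + (P.h xp).toReal) - c) / ((lam * ρ) ^ 2 / 1600))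
  exact key n xp hxp ((div_lt_iff₀ hdpos).1 hn)

/-- The output of the AIPP method is an approximate stationary point. -/
theorem run_output (hS : AIPPSSetup P y₀ ξ M lam f) (hρ : 0 < ρ) {x u : E} {out : E × E}
    (hrun : AIPPRun f P.h M lam (1 / 2) ρ xp out) (hout : out = (x, u)) (hxp : xp ∈ P.X) :
    x ∈ P.X ∧ ‖u‖ ≤ ρ ∧ ∀ x' ∈ P.X,
      (P.h x).toReal + inner ℝ (u - gradient f x) (x' - x) ≤ (P.h x').toReal := by
  have hd := hS.aippData
  induction hrun with
  | finish xp j i hj hres hi =>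
    obtain rfl := hj.unique (hd.isLeast_minIter hxp)
    have hit := hd.proxIterate hxp (hd.minIter_pos.trans hi.1.1)
    have h1 := (hd.output_spec hit.z_mem).1
    have h2 := hd.norm_output_le hρ hit (hd.residual_small hxp hres hi.1.1).2 hi.1.2.2
    have h3 := fun x' (hx' : x' ∈ P.X) => hd.output_subgradient hit.z_mem hx'
    rw [hout] at h1 h2 h3
    exact ⟨h1, h2, h3⟩
  | next xp j out hj hres hnext ih =>
    obtain rfl := hj.unique (hd.isLeast_minIter hxp)
    exact ih hout (hd.proxIterate hxp hd.minIter_pos).z_mem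

end AIPPSSetup

end RunAnalysis

/-! ### Existence of directional derivatives under weak convexity. -/

section DirectionalDerivative

variable {E : Type u} [NormedAddCommGroup E] [InnerProductSpace ℝ E]

/-- A weakly convex extended-valued function has directional derivatives at points where it has a
linear-quadratic lower support, and these are bounded below accordingly. -/
theorem exists_hasDirDeriv {X : Set E} {ψ : E → EReal} {q : E → ℝ} {m δ : ℝ}
    (hψ : ∀ x ∈ X, ψ x = (q x : EReal)) (hψ' : ∀ x ∉ X, ψ x = ⊤)
    (hq : StrongConvexOn X (-m) q) {x : E} (hx : x ∈ X) {κ : ℝ} (hκ : 0 ≤ κ) (hδ : 0 ≤ δ)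
    (hsupp : ∀ x' ∈ X, q x - δ * ‖x' - x‖ - κ * ‖x' - x‖ ^ 2 ≤ q x') (d : E) :
    ∃ ℓ, HasDirDeriv ψ x d ℓ ∧ (‖d‖ ≤ 1 → ((-δ : ℝ) : EReal) ≤ ℓ) := by
  by_cases hd : ∃ t₀ : ℝ, 0 < t₀ ∧ x + t₀ • d ∈ X
  · obtain ⟨t₀, ht₀, hmem₀⟩ := hd
    have hcomb : ∀ s t : ℝ, 0 < t → x + s • d = (1 - s / t) • x + (s / t) • (x + t • d) := by
      intro s t ht
      have : s • d = (s / t) • t • d := by rw [smul_smul, div_mul_cancel₀ s ht.ne']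
      rw [smul_add, ← this]; module
    have hmem : ∀ t ∈ Set.Ioo 0 t₀, x + t • d ∈ X := by
      intro t ht
      rw [hcomb t t₀ ht₀]
      exact hq.1 hx hmem₀ (by rw [sub_nonneg, div_le_one ht₀]; exact ht.2.le)
        (div_nonneg ht.1.le ht₀.le) (by ring)
    set r : ℝ → ℝ := fun t => (q (x + t • d) - q x) / t with hr
    have hlow : ∀ t ∈ Set.Ioo 0 t₀, -(δ * ‖d‖) - κ * ‖d‖ ^ 2 * t ≤ r t := by
      intro t ht
      have h1 := hsupp _ (hmem t ht)
      rw [add_sub_cancel_left, norm_smul, Real.norm_of_nonneg ht.1.le] at h1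
      rw [hr, le_div_iff₀ ht.1]
      nlinarith
    -- Adding `m/2 ‖d‖² t` compensates the weak convexity: the corrected quotient is monotone in
    -- `t`, and the support bounds it below, so it converges as `t ↓ 0`.
    set σ : ℝ → ℝ := fun t => r t + m / 2 * ‖d‖ ^ 2 * t with hσ
    have hmono : MonotoneOn σ (Set.Ioo 0 t₀) := by
      intro s hs t ht hst
      have hs0 := hs.1
      have ht0 := ht.1
      have h1 := hq.2 hx (hmem t ht)
        (show 0 ≤ 1 - s / t by rw [sub_nonneg, div_le_one ht0]; exact hst)
        (show 0 ≤ s / t by positivity) (by ring)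
      rw [← hcomb s t ht0] at h1
      have e : ‖x - (x + t • d)‖ ^ 2 = t ^ 2 * ‖d‖ ^ 2 := by
        rw [sub_add_cancel_left, norm_neg, norm_smul, mul_pow, Real.norm_eq_abs, sq_abs]
      simp only [smul_eq_mul] at h1
      rw [e] at h1
      have h2 : q (x + s • d) - q x ≤ s / t * (q (x + t • d) - q x) +
          m / 2 * ‖d‖ ^ 2 * (s * (t - s)) := by
        have : (1 - s / t) * (s / t) * (-m / 2 * (t ^ 2 * ‖d‖ ^ 2)) =
          -(m / 2 * ‖d‖ ^ 2 * (s * (t - s))) := by field_simp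
        linarith
      have h3 : r s ≤ r t + m / 2 * ‖d‖ ^ 2 * (t - s) := by
        rw [hr]
        simp only
        rw [div_le_iff₀ hs0]
        calc _ ≤ _ := h2
          _ = _ := by field_simp
      simp only [hσ]
      linarith
    have hbdd : BddBelow (σ '' Set.Ioo 0 t₀) := by
      refine ⟨-(δ * ‖d‖) - κ * ‖d‖ ^ 2 * t₀ - |m / 2 * ‖d‖ ^ 2| * t₀, ?_⟩
      rintro _ ⟨t, ht, rfl⟩
      have h1 := hlow t ht
      have h2 : κ * ‖d‖ ^ 2 * t ≤ κ * ‖d‖ ^ 2 * t₀ :=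
        mul_le_mul_of_nonneg_left ht.2.le (by positivity)
      have h3 : |m / 2 * ‖d‖ ^ 2| * t ≤ |m / 2 * ‖d‖ ^ 2| * t₀ :=
        mul_le_mul_of_nonneg_left ht.2.le (abs_nonneg _)
      have h4 : -|m / 2 * ‖d‖ ^ 2| * t ≤ m / 2 * ‖d‖ ^ 2 * t :=
        mul_le_mul_of_nonneg_right (neg_abs_le _) ht.1.le
      simp only [hσ]
      linarith
    have hσlim := hmono.tendsto_nhdsWithin_Ioo_right (Set.nonempty_Ioo.2 ht₀) hbdd
    set ℓ := sInf (σ '' Set.Ioo 0 t₀)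
    have hlin : ∀ c : ℝ, Tendsto (fun t : ℝ => c * t) (𝓝[>] 0) (𝓝 0) := by
      intro c
      have : Continuous fun t : ℝ => c * t := by fun_prop
      simpa using (this.tendsto 0).mono_left nhdsWithin_le_nhds
    have hrlim : Tendsto r (𝓝[>] 0) (𝓝 ℓ) := by
      have := hσlim.sub (hlin (m / 2 * ‖d‖ ^ 2))
      simpa [hσ] using this
    have hIoo : ∀ᶠ t in 𝓝[>] (0 : ℝ), t ∈ Set.Ioo 0 t₀ := Ioo_mem_nhdsGT ht₀
    refine ⟨(ℓ : EReal), ?_, fun hd1 => ?_⟩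
    · refine Tendsto.congr' ?_ ((continuous_coe_real_ereal.tendsto ℓ).comp hrlim)
      filter_upwards [hIoo] with t ht
      rw [hψ _ (hmem t ht), hψ x hx, ← EReal.coe_sub, ← EReal.coe_div]
      rfl
    · refine EReal.coe_le_coe_iff.2 ?_
      have h1 : -(δ * ‖d‖) ≤ ℓ := by
        have h2 : Tendsto (fun t : ℝ => -(δ * ‖d‖) - κ * ‖d‖ ^ 2 * t) (𝓝[>] 0)
            (𝓝 (-(δ * ‖d‖) - 0)) := (hlin _).const_sub _
        rw [sub_zero] at h2
        exact le_of_tendsto_of_tendsto h2 hrlim (by filter_upwards [hIoo] with t ht using hlow t ht)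
      nlinarith
  -- The open ray never meets `X`, so every difference quotient is `⊤`.
  · push Not at hd
    refine ⟨⊤, ?_, fun _ => le_top⟩
    refine tendsto_const_nhds.congr' ?_
    filter_upwards [self_mem_nhdsWithin] with t ht
    have ht' : 0 < t := ht
    rw [hψ' _ (hd t ht'), hψ x hx, EReal.top_sub_coe,
      EReal.top_div_of_pos_ne_top (by exact_mod_cast ht') (EReal.coe_ne_top t)]

end DirectionalDerivative

/-! ### From smoothed stationarity to a nearby directionally stationary point. -/

section Stationarity

variable {E : Type u} [NormedAddCommGroup E] [InnerProductSpace ℝ E] [FiniteDimensional ℝ E]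
  {F : Type v} [NormedAddCommGroup F] [InnerProductSpace ℝ F]
  {P : Problem E F} {y₀ : F} {ξ δ τ : ℝ} {x x₀ u : E}

namespace Problem.Assumptions

theorem phat_eq_coe (hP : P.Assumptions) (hx : x ∈ P.X) :
    P.phat x = ((P.p x + (P.h x).toReal : ℝ) : EReal) := by
  rw [phat, ConvBar.eq_coe hP.h_mem hx, ← EReal.coe_add]
  rfl

theorem phat_eq_top (hP : P.Assumptions) (hx : x ∉ P.X) : P.phat x = ⊤ := by
  rw [phat, ConvBar.eq_top hP.h_mem hx, EReal.coe_add_top]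

theorem strongConvexOn_phat (hP : P.Assumptions) :
    StrongConvexOn P.X (-P.m) fun x => P.p x + (P.h x).toReal := by
  have h := hP.strongConvexOn_p
  rw [strongConvexOn_iff_convex] at h ⊢
  refine (h.add (ConvBar.convexOn hP.h_mem hP.convex_X)).congr fun x _ => ?_
  simp only [Pi.add_apply]
  ring

/-- Approximate stationarity for the smoothed problem yields approximate directional stationarity
of a nearby point for the original problem. -/
theorem nearDirStationary (hP : P.Assumptions) (hy₀ : y₀ ∈ P.Y) (hδ : 0 < δ) (hξ : 0 < ξ)
    (hτ : 0 < τ) (h1 : P.Dy / τ ≤ ξ) (h2 : 2 * P.Dy * τ ≤ P.m * δ ^ 2)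
    (h3 : 32 * P.m * P.Dy * τ ≤ δ ^ 2) (hx : x ∈ P.X) (hu : ‖u‖ ≤ δ / 2)
    (hsub : ∀ x' ∈ P.X, (P.h x).toReal + inner ℝ (u - gradient (P.pSmooth y₀ ξ) x) (x' - x) ≤
      (P.h x').toReal) : P.NearDirStationary δ x := by
  have hm := hP.m_pos
  have hD : 0 ≤ P.Dy := Metric.diam_nonneg
  set q : E → ℝ := fun x => P.p x + (P.h x).toReal with hq
  have hη : P.Dy ^ 2 / (2 * ξ) ≤ τ * P.Dy / 2 := by
    rw [div_le_iff₀ hτ] at h1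
    rw [div_le_iff₀ (by positivity)]
    nlinarith
  have hlow : ∀ x' ∈ P.X, q x - τ * P.Dy / 2 + inner ℝ u (x' - x) - P.m / 2 * ‖x' - x‖ ^ 2 ≤
      q x' := by
    intro x' hx'
    have h4 := hsub x' hx'
    have h5 := hP.pSmooth_lower (y₀ := y₀) hξ hx' hx
    have h6 := hP.pSmooth_le_p (y₀ := y₀) hξ (hP.X_subset_Ω hx')
    have h7 := hP.p_le_pSmooth_add hξ hy₀ (hP.X_subset_Ω hx)
    rw [inner_sub_left] at h4
    simp only [hq]
    linarith
  have hcont : Continuous fun x' : E => P.m * ‖x' - x‖ ^ 2 - inner ℝ u x' := by fun_prop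
  obtain ⟨g, hg⟩ := hP.p_support hx
  -- The candidate `x̂` is a proximal point of the tilted function `p̂ - ⟨u, ·⟩`. The coefficient
  -- `m` is twice what is needed to cancel the weak convexity of `p`, so growth `m/2` remains.
  obtain ⟨w, hw, hmin⟩ := ConvBar.exists_min hP.h_mem hP.convex_X hx
    (g := fun x' => P.p x' + (P.m * ‖x' - x‖ ^ 2 - inner ℝ u x'))
    (a := P.p x - inner ℝ u x) (b := ‖g - u‖) (κ := P.m / 2)
    (hP.lowerSemicontinuousOn_p.add (hcont.lowerSemicontinuous.lowerSemicontinuousOn _))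
    (by positivity) (fun x' hx' => by
      have h4 := hg x' hx'
      have h5 := (abs_le.1 (abs_real_inner_le_norm (g - u) (x' - x))).1
      rw [inner_sub_left, inner_sub_right u] at h5
      linarith)
  have hG : ∀ x' ∈ P.X, q w + P.m * ‖w - x‖ ^ 2 - inner ℝ u w ≤
      q x' + P.m * ‖x' - x‖ ^ 2 - inner ℝ u x' := by
    intro x' hx'
    have h4 := hmin x' hx'
    simp only [hq]
    linarith
  -- `x` minimizes the tilted function up to `τ D_y/2` and a concave term `m/2 ‖· - x‖²`; comparison
  -- with the optimality of `w` leaves `m/2 ‖w - x‖² ≤ τ D_y/2`.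
  have hdist : P.m * ‖w - x‖ ^ 2 ≤ τ * P.Dy := by
    have h4 := hG x hx
    have h5 := hlow w hw
    rw [sub_self, norm_zero] at h4
    rw [inner_sub_right] at h5
    linarith
  have hd1 : ‖w - x‖ ≤ δ := by
    apply le_of_sq_le_sq _ hδ.le
    have : P.m * ‖w - x‖ ^ 2 ≤ P.m * δ ^ 2 := by nlinarith
    exact le_of_mul_le_mul_left this hm
  have hd2 : 2 * P.m * ‖w - x‖ ≤ δ / 2 := by
    apply le_of_sq_le_sq _ (by positivity)
    have : (2 * P.m * ‖w - x‖) ^ 2 = 4 * P.m * (P.m * ‖w - x‖ ^ 2) := by ring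
    rw [this]
    nlinarith
  -- The slope at `w` is made of `u` and `2m(w - x)`, each of norm at most `δ/2`.
  have hsupp : ∀ x' ∈ P.X, q w - δ * ‖x' - w‖ - P.m * ‖x' - w‖ ^ 2 ≤ q x' := by
    intro x' hx'
    have h4 := hG x' hx'
    rw [sq_norm_sub_expand x' w x] at h4
    have h5 := (abs_le.1 (abs_real_inner_le_norm u (x' - w))).1
    have h6 := (abs_le.1 (abs_real_inner_le_norm (w - x) (x' - w))).2
    rw [inner_sub_right] at h5
    have h7 := mul_le_mul_of_nonneg_right hu (norm_nonneg (x' - w))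
    have h8 := mul_le_mul_of_nonneg_right hd2 (norm_nonneg (x' - w))
    have h9 := mul_le_mul_of_nonneg_left h6 (by positivity : 0 ≤ 2 * P.m)
    linarith
  have hdir := exists_hasDirDeriv (fun x hx => hP.phat_eq_coe hx) (fun x hx => hP.phat_eq_top hx)
    hP.strongConvexOn_phat hw hm.le hδ.le hsupp
  choose D hD1 hD2 using hdir
  exact ⟨w, hw, hd1, D, hD1, le_iInf₂ fun d hd => hD2 d hd⟩

end Problem.Assumptions

end Stationarity

/-! ### Translation of the bounds into `Ω_ξ` and `R(p̂; λ)`. -/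

section Complexity

variable {E : Type u} [NormedAddCommGroup E] [InnerProductSpace ℝ E] [FiniteDimensional ℝ E]
  {F : Type v} [NormedAddCommGroup F] [InnerProductSpace ℝ F]
  {P : Problem E F} {y₀ : F} {ξ δ lam : ℝ} {x₀ : E}

namespace Problem.Assumptions

theorem exists_iInf_phat (hP : P.Assumptions) : ∃ c : ℝ, (⨅ x, P.phat x) = (c : EReal) ∧
    ∀ x ∈ P.X, c ≤ P.p x + (P.h x).toReal := by
  obtain ⟨c, hc⟩ := hP.finite_inf
  have he : (⨅ x, P.phat x) = (c : EReal) := by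
    rw [← hc]
    refine le_antisymm (le_iInf₂ fun x _ => iInf_le _ x) (le_iInf fun x => ?_)
    by_cases hx : x ∈ P.X
    · exact iInf₂_le x hx
    · rw [hP.phat_eq_top hx]; exact le_top
  refine ⟨c, he, fun x hx => EReal.coe_le_coe_iff.1 ?_⟩
  rw [← he, ← hP.phat_eq_coe hx]
  exact iInf_le _ x

theorem le_toReal_Rfun (hP : P.Assumptions) (hlam : 0 < lam) (hx₀ : x₀ ∈ P.X) {c r : ℝ}
    (hc : (⨅ x, P.phat x) = (c : EReal))
    (hr : ∀ x ∈ P.X, r ≤ 1 / 2 * ‖x - x₀‖ ^ 2 + lam * (P.p x + (P.h x).toReal - c)) :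
    r ≤ (Rfun P.phat x₀ lam).toReal := by
  have hterm : ∀ x ∈ P.X, ((‖x₀ - x‖ ^ 2 / 2 : ℝ) : EReal) + (lam : EReal) * (P.phat x - c) =
      ((1 / 2 * ‖x - x₀‖ ^ 2 + lam * (P.p x + (P.h x).toReal - c) : ℝ) : EReal) := by
    intro x hx
    rw [hP.phat_eq_coe hx, ← EReal.coe_sub, ← EReal.coe_mul, ← EReal.coe_add, norm_sub_rev]
    congr 1; ring
  have h1 : (r : EReal) ≤ Rfun P.phat x₀ lam := by
    rw [Rfun, hc]
    refine le_iInf fun x => ?_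
    by_cases hx : x ∈ P.X
    · rw [hterm x hx]; exact EReal.coe_le_coe_iff.2 (hr x hx)
    · rw [hP.phat_eq_top hx, EReal.top_sub_coe, EReal.coe_mul_top_of_pos hlam, EReal.coe_add_top]
      exact le_top
  have h2 : Rfun P.phat x₀ lam ≠ ⊤ := by
    have h3 : Rfun P.phat x₀ lam ≤ _ := iInf_le _ x₀
    rw [hc, hterm x₀ hx₀] at h3
    exact (lt_of_le_of_lt h3 (EReal.coe_lt_top _)).ne
  have := EReal.toReal_le_toReal h1 (EReal.coe_ne_bot r) h2
  simpa using this

theorem toReal_Rfun_nonneg (hP : P.Assumptions) (hlam : 0 < lam) (hx₀ : x₀ ∈ P.X) :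
    0 ≤ (Rfun P.phat x₀ lam).toReal := by
  obtain ⟨c, hc, hle⟩ := hP.exists_iInf_phat
  refine hP.le_toReal_Rfun hlam hx₀ hc fun x hx => ?_
  have := hle x hx
  have h1 : 0 ≤ lam * (P.p x + (P.h x).toReal - c) := mul_nonneg hlam.le (by linarith)
  positivity

theorem two_le_Omegaxi (hP : P.Assumptions) : 2 ≤ Omegaxi P.m P.Lx P.Ly ξ := by
  have hm := Real.sqrt_pos.2 hP.m_pos
  have h1 := Real.sqrt_le_sqrt hP.m_le_Lx
  have h2 : 0 ≤ √ξ * P.Ly := mul_nonneg (Real.sqrt_nonneg _) hP.Ly_pos.le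
  have h3 : 1 ≤ (√ξ * P.Ly + √P.Lx) / √P.m := by rw [one_le_div hm]; linarith
  rw [Omegaxi]; linarith

/-- As `m ≤ L_x`, `√(ξ(L_x + m)) ≤ 2√ξ √L_x`, so `L_ξ` is at most the perfect square `(√ξ L_y +
√L_x)²`; dividing by `4m` produces `Ω_ξ²/4`. -/
theorem lam_mul_Lxi_le (hP : P.Assumptions) (hξ : 0 < ξ) :
    1 / (4 * P.m) * Lxi P.m P.Lx P.Ly ξ ≤ Omegaxi P.m P.Lx P.Ly ξ ^ 2 / 4 := by
  have hm := hP.m_pos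
  have hsm := Real.sqrt_pos.2 hm
  have hLx := hP.Lx_pos
  have hLy := hP.Ly_pos
  have e1 : √(ξ * (P.Lx + P.m)) ≤ 2 * (√ξ * √P.Lx) := by
    rw [Real.sqrt_mul hξ.le]
    have : √(P.Lx + P.m) ≤ 2 * √P.Lx := by
      rw [Real.sqrt_le_left (by positivity), mul_pow, Real.sq_sqrt hLx.le]
      linarith [hP.m_le_Lx]
    nlinarith [Real.sqrt_nonneg ξ]
  have e2 : (√ξ * P.Ly + √P.Lx) ^ 2 / P.m ≤ Omegaxi P.m P.Lx P.Ly ξ ^ 2 := by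
    have : (√ξ * P.Ly + √P.Lx) ^ 2 / P.m = ((√ξ * P.Ly + √P.Lx) / √P.m) ^ 2 := by
      rw [div_pow, Real.sq_sqrt hm.le]
    rw [this, Omegaxi]
    apply pow_le_pow_left₀ (by positivity)
    linarith
  have e3 : Lxi P.m P.Lx P.Ly ξ ≤ (√ξ * P.Ly + √P.Lx) ^ 2 := by
    have h1 := Real.sq_sqrt hξ.le
    have h2 := Real.sq_sqrt hLx.le
    rw [Lxi]
    have h3 := mul_le_mul_of_nonneg_left e1 hLy.le
    have h4 : (√ξ * P.Ly + √P.Lx) ^ 2 = ξ * P.Ly ^ 2 + 2 * (√ξ * √P.Lx) * P.Ly + P.Lx := by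
      rw [add_sq, mul_pow, h1, h2]; ring
    rw [h4]
    linarith
  have e4 : 1 / (4 * P.m) * Lxi P.m P.Lx P.Ly ξ = Lxi P.m P.Lx P.Ly ξ / P.m / 4 := by
    field_simp
  rw [e4]
  have := div_le_div_of_nonneg_right e3 hm.le
  linarith

end Problem.Assumptions

theorem one_le_logOnePlus (t : ℝ) : 1 ≤ logOnePlus t := le_max_left _ _

namespace AIPPSSetup

variable {M : ℝ} {f : E → ℝ}

theorem sqrt_le_Omegaxi (hS : AIPPSSetup P y₀ ξ M lam f) :
    √(2 * lam * M + 1) ≤ Omegaxi P.m P.Lx P.Ly ξ := by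
  have h1 := hS.assumptions.lam_mul_Lxi_le hS.ξ_pos
  have h2 := hS.assumptions.two_le_Omegaxi (ξ := ξ)
  rw [← hS.lam_eq, ← hS.M_eq] at h1
  rw [Real.sqrt_le_left (by linarith)]
  nlinarith

theorem minIter_le (hS : AIPPSSetup P y₀ ξ M lam f) :
    (minIter M lam : ℝ) ≤ 7 * Omegaxi P.m P.Lx P.Ly ξ := by
  have h1 := hS.sqrt_le_Omegaxi
  have h2 := hS.assumptions.two_le_Omegaxi (ξ := ξ)
  have h3 : (minIter M lam : ℝ) < 6 * √(2 * lam * M + 1) + 1 :=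
    Nat.ceil_lt_add_one (by positivity)
  linarith

theorem refineIter_le (hS : AIPPSSetup P y₀ ξ M lam f) :
    (refineIter M lam : ℝ) ≤
      12 * (Omegaxi P.m P.Lx P.Ly ξ * logOnePlus (Omegaxi P.m P.Lx P.Ly ξ)) := by
  have h1 := hS.sqrt_le_Omegaxi
  have h2 := hS.assumptions.two_le_Omegaxi (ξ := ξ)
  have h3 := hS.minIter_le
  have h4 := hS.assumptions.lam_mul_Lxi_le hS.ξ_pos
  rw [← hS.lam_eq, ← hS.M_eq] at h4
  have hp := mul_pos hS.aippData.lam_pos hS.aippData.M_pos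
  set W := Omegaxi P.m P.Lx P.Ly ξ
  have h5 : Real.log (lam * M + 1) ≤ 2 * logOnePlus W := by
    calc _ ≤ Real.log (W ^ 2) := Real.log_le_log (by linarith) (by nlinarith)
      _ = 2 * Real.log W := by rw [Real.log_pow]; norm_num
      _ ≤ _ := by
        have : Real.log W ≤ logOnePlus W := le_max_right _ _
        linarith
  have h6 := one_le_logOnePlus W
  have h7 : 0 ≤ Real.log (lam * M + 1) := Real.log_nonneg (by linarith)
  have h8 : (⌈2 * √(2 * lam * M + 1) * Real.log (lam * M + 1)⌉₊ : ℝ) <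
      2 * √(2 * lam * M + 1) * Real.log (lam * M + 1) + 1 := Nat.ceil_lt_add_one (by positivity)
  have h9 : √(2 * lam * M + 1) * Real.log (lam * M + 1) ≤ W * (2 * logOnePlus W) :=
    mul_le_mul h1 h5 h7 (by linarith)
  have h10 : W ≤ W * logOnePlus W := le_mul_of_one_le_right (by linarith) h6
  rw [refineIter]
  push_cast
  linarith

/-- Lower bounds and gaps for the smoothed objective in terms of the original one. -/
theorem exists_gap (hS : AIPPSSetup P y₀ ξ M lam f) (hy₀ : y₀ ∈ P.Y) (hx₀ : x₀ ∈ P.X) :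
    ∃ c : ℝ, (∀ x ∈ P.X, c ≤ lam * (f x + (P.h x).toReal)) ∧
      ∀ z ∈ P.X, (∀ x ∈ P.X, lam * (f z + (P.h z).toReal) ≤
        lam * (f x + (P.h x).toReal) + 19 / 36 * ‖x - x₀‖ ^ 2) →
        lam * (f z + (P.h z).toReal) - c ≤
          19 / 18 * (Rfun P.phat x₀ lam).toReal + lam * (P.Dy ^ 2 / (2 * ξ)) := by
  have hP := hS.assumptions
  have hlam := hS.aippData.lam_pos
  obtain ⟨c, hc, hle⟩ := hP.exists_iInf_phat
  have hf1 : ∀ x ∈ P.X, f x ≤ P.p x := by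
    intro x hx; rw [hS.f_eq]; exact hP.pSmooth_le_p hS.ξ_pos (hP.X_subset_Ω hx)
  have hf2 : ∀ x ∈ P.X, P.p x ≤ f x + P.Dy ^ 2 / (2 * ξ) := by
    intro x hx; rw [hS.f_eq]; exact hP.p_le_pSmooth_add hS.ξ_pos hy₀ (hP.X_subset_Ω hx)
  refine ⟨lam * (c - P.Dy ^ 2 / (2 * ξ)), fun x hx => ?_, fun z hz hzle => ?_⟩
  · apply mul_le_mul_of_nonneg_left _ hlam.le
    linarith [hf2 x hx, hle x hx]
  -- The factor `18/19` normalizes `19/36 ‖x - x₀‖²` to the `1/2 ‖x - x₀‖²` of `R`; the objective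
  -- gap only shrinks under it, being nonnegative.
  · have h1 := hP.le_toReal_Rfun hlam hx₀ hc
      (r := 18 / 19 * (lam * (f z + (P.h z).toReal) - lam * c)) fun x hx => by
        have h2 := hzle x hx
        have h3 : lam * (f x + (P.h x).toReal) ≤ lam * (P.p x + (P.h x).toReal) :=
          mul_le_mul_of_nonneg_left (by linarith [hf1 x hx]) hlam.le
        have h4 : 0 ≤ lam * (P.p x + (P.h x).toReal - c) :=
          mul_nonneg hlam.le (by linarith [hle x hx])
        linarith
    linarith

end AIPPSSetup

namespace Problem.Assumptions

theorem aippsSetup (hP : P.Assumptions) (hξ : 0 < ξ) :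
    AIPPSSetup P y₀ ξ (Lxi P.m P.Lx P.Ly ξ) (1 / (4 * P.m)) (P.pSmooth y₀ ξ) :=
  ⟨hP, hξ, rfl, rfl, rfl⟩

/-- The oracle complexity of the AIPP-S scheme. -/
theorem oracle_complexity (hP : P.Assumptions) (hy₀ : y₀ ∈ P.Y) (hx₀ : x₀ ∈ P.X) (hξ : 0 < ξ)
    (hδ : 0 < δ) {out : E × E} (hrun : AIPPSRun P ξ x₀ y₀ (δ / 2) out) :
    ∃ T : ℕ, AIPPSOracleRun P ξ x₀ y₀ (δ / 2) out T ∧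
      (T : ℝ) ≤ 1000000 * P.oracleBound x₀ ξ δ := by
  have hS := hP.aippsSetup (y₀ := y₀) hξ
  have hl := hS.aippData.lam_pos
  obtain ⟨c, hc, hgap⟩ := hS.exists_gap hy₀ hx₀
  have hmin := hS.minIter_le
  have href := hS.refineIter_le
  have hR0 := hP.toReal_Rfun_nonneg hl hx₀
  have hW := hP.two_le_Omegaxi (ξ := ξ)
  rw [oracleBound]
  rw [AIPPSRun] at hrun
  set lam := 1 / (4 * P.m)
  set M := Lxi P.m P.Lx P.Ly ξ
  set W := Omegaxi P.m P.Lx P.Ly ξ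
  set R := (Rfun P.phat x₀ lam).toReal
  have hη : 0 ≤ lam * (P.Dy ^ 2 / (2 * ξ)) := by positivity
  obtain ⟨N, ⟨T, hTN, hT⟩, hN⟩ := hS.halts_of_run_of_gap (by positivity) hc (by positivity)
    hrun hx₀ hgap
  refine ⟨T, hT, ?_⟩
  have hTN' : (T : ℝ) ≤ N := by exact_mod_cast hTN
  have e : (19 / 18 * R + lam * (P.Dy ^ 2 / (2 * ξ))) / ((lam * (δ / 2)) ^ 2 / 1600) =
      60800 / 9 * (R / (lam ^ 2 * δ ^ 2)) + 3200 * (P.Dy ^ 2 / (lam * ξ * δ ^ 2)) := by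
    field_simp
    ring
  rw [e] at hN
  have h1 : 0 ≤ R / (lam ^ 2 * δ ^ 2) := by positivity
  have h2 : 0 ≤ P.Dy ^ 2 / (lam * ξ * δ ^ 2) := by positivity
  set a := R / (lam ^ 2 * δ ^ 2)
  set b := P.Dy ^ 2 / (lam * ξ * δ ^ 2)
  have h3 := mul_le_mul_of_nonneg_right hmin
    (by positivity : 0 ≤ 60800 / 9 * a + 3200 * b)
  have h4 := one_le_logOnePlus W
  have h5 : 0 ≤ W * a := by positivity
  have h6 : 0 ≤ W * b := by positivity
  have h7 : 0 ≤ W * logOnePlus W := by positivity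
  linarith

/-- With equality, `τ` is proportional to `δ²`, so `ξ = K/δ²` and `Ω_ξ ≤ W/δ` for `δ ≤ 1`. The
bracket is `O(δ⁻²)`: the first term has this order, the second is constant, and the logarithm is
crudely bounded by `Ω_ξ`. -/
theorem isBigO_oracleBound (hP : P.Assumptions) (hx₀ : x₀ ∈ P.X) (hD : 0 < P.Dy) :
    Asymptotics.IsBigO (nhdsWithin (0 : ℝ) (Set.Ioi 0))
      (fun δ : ℝ => P.oracleBound x₀
        (P.Dy / min (P.m * δ ^ 2 / (2 * P.Dy)) (δ ^ 2 / (32 * P.m * P.Dy))) δ)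
      (fun δ : ℝ => (δ ^ 3)⁻¹) := by
  have hm := hP.m_pos
  have hLy := hP.Ly_pos
  set lam := 1 / (4 * P.m) with hlam
  have hl : 0 < lam := by positivity
  set a := min (P.m / (2 * P.Dy)) (1 / (32 * P.m * P.Dy)) with ha
  have ha0 : 0 < a := lt_min (by positivity) (by positivity)
  set K := P.Dy / a with hK
  have hK0 : 0 < K := by positivity
  set W := Omegaxi P.m P.Lx P.Ly K with hW
  have hW2 : 2 ≤ W := hP.two_le_Omegaxi
  set R := (Rfun P.phat x₀ lam).toReal with hR
  have hR0 : 0 ≤ R := hP.toReal_Rfun_nonneg hl hx₀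
  refine Asymptotics.IsBigO.of_bound (W * (R / lam ^ 2 + P.Dy ^ 2 / (lam * K) + W)) ?_
  filter_upwards [Ioc_mem_nhdsGT (zero_lt_one' ℝ)] with δ hδ
  obtain ⟨hδ0, hδ1⟩ := hδ
  have hξ : P.Dy / min (P.m * δ ^ 2 / (2 * P.Dy)) (δ ^ 2 / (32 * P.m * P.Dy)) = K / δ ^ 2 := by
    have : min (P.m * δ ^ 2 / (2 * P.Dy)) (δ ^ 2 / (32 * P.m * P.Dy)) = a * δ ^ 2 := by
      rw [ha, min_mul_of_nonneg _ _ (by positivity)]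
      congr 1 <;> ring
    rw [this, hK, div_div]
  rw [hξ, oracleBound]
  rw [← hlam, ← hR]
  set V := Omegaxi P.m P.Lx P.Ly (K / δ ^ 2) with hV
  have hV2 : 2 ≤ V := hP.two_le_Omegaxi
  have hVW : V ≤ W / δ := by
    rw [hV, hW, Omegaxi, Omegaxi, Real.sqrt_div' _ (by positivity), Real.sqrt_sq hδ0.le,
      le_div_iff₀ hδ0]
    have e : (1 + (√K / δ * P.Ly + √P.Lx) / √P.m) * δ =
        δ + (√K * P.Ly + √P.Lx * δ) / √P.m := by
      field_simp
    rw [e]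
    have : (√K * P.Ly + √P.Lx * δ) / √P.m ≤ (√K * P.Ly + √P.Lx) / √P.m := by
      apply div_le_div_of_nonneg_right _ (Real.sqrt_nonneg _)
      have := mul_le_of_le_one_right (Real.sqrt_nonneg P.Lx) hδ1
      linarith
    linarith
  have hlog : logOnePlus V ≤ W / δ ^ 2 := by
    have h1 : logOnePlus V ≤ V := by
      refine max_le (by linarith) ?_
      have := Real.log_le_sub_one_of_pos (by linarith : 0 < V)
      linarith
    refine h1.trans (hVW.trans ?_)
    apply div_le_div_of_nonneg_left (by linarith) (by positivity)
    nlinarith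
  have hlog0 : 0 ≤ logOnePlus V := zero_le_one.trans (one_le_logOnePlus V)
  have e1 : R / (lam ^ 2 * δ ^ 2) = R / lam ^ 2 / δ ^ 2 := by rw [div_div]
  have e2 : P.Dy ^ 2 / (lam * (K / δ ^ 2) * δ ^ 2) ≤ P.Dy ^ 2 / (lam * K) / δ ^ 2 := by
    have : lam * (K / δ ^ 2) * δ ^ 2 = lam * K := by field_simp
    rw [this]
    rw [le_div_iff₀ (by positivity)]
    apply mul_le_of_le_one_right (by positivity)
    nlinarith
  have hnn : 0 ≤ V * (R / (lam ^ 2 * δ ^ 2) + P.Dy ^ 2 / (lam * (K / δ ^ 2) * δ ^ 2) +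
      logOnePlus V) := by positivity
  rw [Real.norm_of_nonneg hnn, Real.norm_of_nonneg (by positivity), e1]
  calc _ ≤ W / δ * (R / lam ^ 2 / δ ^ 2 + P.Dy ^ 2 / (lam * K) / δ ^ 2 + W / δ ^ 2) := by
        apply mul_le_mul hVW _ (by positivity) (by positivity)
        linarith
    _ = _ := by field_simp

end Problem.Assumptions

end Complexity

end AIPPS

end

theorem proposition3p3 :
    ∃ C : ℝ, 0 < C ∧
      ∀ (E : Type u) [NormedAddCommGroup E] [InnerProductSpace ℝ E] [FiniteDimensional ℝ E]
        (F : Type v) [NormedAddCommGroup F] [InnerProductSpace ℝ F] [FiniteDimensional ℝ F]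
        (P : AIPPS.Problem E F), P.Assumptions →
      ∀ x₀ ∈ P.X, ∀ y₀ ∈ P.Y,
        (∀ δ ξ τ : ℝ, 0 < δ → 0 < ξ → 0 < τ → P.Dy / τ ≤ ξ →
          2 * P.Dy * τ ≤ P.m * δ ^ 2 → 32 * P.m * P.Dy * τ ≤ δ ^ 2 →
          (∃ out : E × E, AIPPS.AIPPSRun P ξ x₀ y₀ (δ / 2) out) ∧
          ∀ x u : E, AIPPS.AIPPSRun P ξ x₀ y₀ (δ / 2) (x, u) →
            (∃ T : ℕ, AIPPS.AIPPSOracleRun P ξ x₀ y₀ (δ / 2) (x, u) T ∧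
              (T : ℝ) ≤ C * P.oracleBound x₀ ξ δ) ∧
            x ∈ P.X ∧ P.NearDirStationary δ x) ∧
        (0 < P.Dy →
          Asymptotics.IsBigO (nhdsWithin (0 : ℝ) (Set.Ioi 0))
            (fun δ : ℝ => P.oracleBound x₀
              (P.Dy / min (P.m * δ ^ 2 / (2 * P.Dy)) (δ ^ 2 / (32 * P.m * P.Dy))) δ)
            (fun δ : ℝ => (δ ^ 3)⁻¹)) := by
  refine ⟨1000000, by norm_num, ?_⟩
  intro E _ _ _ F _ _ _ P hP x₀ hx₀ y₀ hy₀
  refine ⟨fun δ ξ τ hδ hξ hτ h1 h2 h3 => ?_, fun hD => hP.isBigO_oracleBound hx₀ hD⟩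
  have hS := hP.aippsSetup (y₀ := y₀) hξ
  obtain ⟨c, hc, -⟩ := hS.exists_gap hy₀ hx₀
  refine ⟨hS.exists_run (half_pos hδ) hc hx₀, fun x u hrun => ?_⟩
  obtain ⟨hx, hu, hsub⟩ := hS.run_output (half_pos hδ) hrun rfl hx₀
  exact ⟨hP.oracle_complexity hy₀ hx₀ hξ hδ hrun, hx,
    hP.nearDirStationary hy₀ hδ hξ hτ h1 h2 h3 hx hu hsub⟩
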